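/- Let $0<\lambda<1$, $0<\gamma<1$, $\mathcal L=\{\operatorname{Re}s=\gamma\}$, $\mathcal D^+=\{\operatorname{Re}s\le\gamma\}$, $\mathcal D^-=\{\operatorname{Re}s\ge\gamma\}$, and $$G_0(s)=\begin{pmatrix}\lambda^{-s}\cot\frac{\pi s}{2}&0\\ 2&-\lambda^{s+1}\tan\frac{\pi s}{2}\end{pmatrix}.$$ **Definitions.** Let $D$ be one of $\mathcal D^\pm$. A function or column $y$ has order $\alpha\in\mathbb Z$ at infinity in $D$ if $\|s^{\alpha}y(s)\|$ is bounded and bounded away from $0$ for all $s\in D$ with $|s|$ large (for a column whose components have orders, $\alpha$ is their minimum). A *canonical factorization* of a matrix function $G$ on $\mathcal L$ is a pair $X^\pm$ of matrix functions analytic in the interior of $\mathcal D^\pm$, continuous and nonsingular in $\mathcal D^\pm$, with $G=X^+[X^-]^{-1}$ on $\mathcal L$, which have normal form at infinity: the $j$-th columns of $X^+$ and of $X^-$ have a common order $\kappa_j$ at infinity, and $\det X^\pm$ have order $\kappa_1+\kappa_2$. The numbers $\kappa_1,\kappa_2$ are partial indices of $G$. The system $(\kappa_1,\kappa_2)$ of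 partial indices of $G$ is *stable* if there is $\varepsilon>0$ such that (i) every $G'$ on $\mathcal L$ with all $|G'_{ij}-G_{ij}|<\varepsilon$ on $\mathcal L$ which has partial indices has the same ones up to order, and (ii) $G(\gamma+it)+F(t)$ has the partial indices $(\kappa_1,\kappa_2)$ whenever the entries of $F$ are $C^2$ on $\mathbb R$ with $|F_{ij}^{(k)}(t)|\le\varepsilon/(1+t^2)$, $k=0,1,2$. **Statement.** (a) There are unique real numbers $a_{l,n,k}$, $b_{l,n,k}$ ($l=1,2$; $n,k\ge0$) with $$b_{l,n,0}=-\frac{2\delta_{l1}}{\pi},\qquad a_{l,n,0}=\frac{2\delta_{l2}}{\pi}+\frac{b_{l,0,0}}{\pi(n+\frac12)},$$ $$b_{l,n,k+1}=\frac1\pi\sum_{m=0}^{\lfloor k/2\rfloor}\frac{a_{l,m,k-2m}}{n+m+\frac12}\ (k\ge0),\qquad a_{l,n,k}=\frac1\pi\sum_{m=0}^{\lfloor k/2\rfloor}\frac{b_{l,m,k-2m}}{n+m+\frac12}\ (k\ge1).$$ The series $A^+_{ln}=\lambda^{2n+1}\sum_k a_{l,n,k}\lambda^k$ and $B^-_{ln}=\lambda^{2n}\sum_k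 b_{l,n,k}\lambda^k$ converge, and $(A^+_{ln}),(B^-_{ln})$ is the unique pair of complex families for which the following series converge absolutely and $$A^+_{ln}=\frac{\lambda^{2n+1}}{\pi}\Bigl(\sum_{m\ge0}\frac{B^-_{lm}}{n+m+\frac12}+2\delta_{l2}\Bigr),\qquad B^-_{ln}=\frac{\lambda^{2n}}{\pi}\Bigl(\sum_{m\ge0}\frac{A^+_{lm}}{n+m+\frac12}-2\delta_{l1}\Bigr),\qquad n\ge0,\ l=1,2.$$ (b) The series $\Psi_l^+(s)=\sum_m\frac{A^+_{lm}}{s-2m-1}$ and $\Omega_l^-(s)=\sum_m\frac{B^-_{lm}}{s+2m}$ converge off the points $2m+1$, respectively $-2m$ ($m\ge0$), and are meromorphic in $\mathbb C$. The matrices $X^\pm=(\chi^\pm_{ml})$ with $$\chi_{2l}^+=\Psi_l^++\delta_{l1},\qquad \chi_{2l}^-=\tfrac1\lambda[\Omega_l^-+\delta_{l2}],$$ $$\chi_{1l}^+=\tfrac12\bigl\{\Omega_l^-+\delta_{l2}+\lambda^{-s}\cot\tfrac{\pi s}2[\Psi_l^++\delta_{l1}]\bigr\},\qquad \chi_{1l}^-=\tfrac12\bigl\{\Psi_l^++\delta_{l1}+\lambda^{s}\tan\tfrac{\pi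 s}2[\Omega_l^-+\delta_{l2}]\bigr\}$$ are, after removal of the removable singularities $s=-2n$ in $\mathcal D^+$ and $s=2n+1$ in $\mathcal D^-$ ($n\ge0$), analytic on $\mathcal D^+$ and $\mathcal D^-$ respectively, and $$G_0=X^+[X^-]^{-1}\ \text{on }\mathcal L,\qquad \det X^+=-\tfrac12\ \text{in }\mathcal D^+,\qquad \det X^-=\tfrac1{2\lambda}\ \text{in }\mathcal D^-.$$ (c) As $s\to\infty$ in $\mathcal D^+$: $\chi^+_{21}\to1$, $\chi^+_{12}\to\frac12$, $s\chi^+_{22}$ has a finite nonzero limit. As $s\to\infty$ in $\mathcal D^-$: $\chi^-_{11}\to\frac12$, $\chi^-_{22}\to\frac1\lambda$, $s\chi^-_{21}$ has a finite nonzero limit. The functions $\chi^+_{11}$ and $\chi^-_{12}$ are bounded in $\mathcal D^+$ and $\mathcal D^-$, and $s\chi^+_{11}$ and $s\chi^-_{12}$ have finite nonzero limits as $s\to\infty$ in $\mathcal D^+$, respectively $\mathcal D^-$, inside any sector $|\operatorname{Im}s|\le K|\operatorname{Re}s|$. (d) $X^\pm$ is a canonical factorization of $G_0$ with partial indices $\kappa_1=\kappa_2=0$,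 and this system of partial indices is stable. -/

import Mathlib

open Complex Filter Topology

noncomputable section

/-- The left half-plane `Re s ≤ γ`, boundary line included. -/
def Dplus (γ : ℝ) : Set ℂ := {s | s.re ≤ γ}

/-- The right half-plane `Re s ≥ γ`, boundary line included. -/
def Dminus (γ : ℝ) : Set ℂ := {s | γ ≤ s.re}

/-- The Kronecker symbol. -/
def kron (l k : Fin 2) : ℂ := if l = k then 1 else 0

/-- The filter "`s → ∞`, `s ∈ D`". -/
def atInftyIn (D : Set ℂ) : Filter ℂ := Bornology.cobounded ℂ ⊓ 𝓟 D

/-- The triangular matrix coefficient `G₀`. -/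
def G0 (lam : ℝ) (s : ℂ) : Matrix (Fin 2) (Fin 2) ℂ :=
  !![(lam : ℂ) ^ (-s) * Complex.cot (Real.pi * s / 2), 0;
     2, -((lam : ℂ) ^ (s + 1) * Complex.tan (Real.pi * s / 2))]

/-! ### The coefficients of the meromorphic series

The column number `l = 1, 2` is represented by `l = 0, 1 : Fin 2`. -/

/-- The infinite systems of linear algebraic equations for the coefficients, the convergence of
all the series in them included. -/
structure SolvesSystem (lam : ℝ) (A B : Fin 2 → ℕ → ℂ) : Prop where
  summable_A : ∀ (l : Fin 2) (n : ℕ), Summable fun m : ℕ => A l m / ((n : ℂ) + m + 1 / 2)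
  summable_B : ∀ (l : Fin 2) (n : ℕ), Summable fun m : ℕ => B l m / ((n : ℂ) + m + 1 / 2)
  eq_A : ∀ (l : Fin 2) (n : ℕ), A l n =
    (lam : ℂ) ^ (2 * n + 1) / Real.pi *
      ((∑' m : ℕ, B l m / ((n : ℂ) + m + 1 / 2)) + 2 * kron l 1)
  eq_B : ∀ (l : Fin 2) (n : ℕ), B l n =
    (lam : ℂ) ^ (2 * n) / Real.pi *
      ((∑' m : ℕ, A l m / ((n : ℂ) + m + 1 / 2)) - 2 * kron l 0)

/-- The recurrence relations for the power series coefficients (in `λ`) `a l n k`, `b l n k`. -/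
structure Recurrences (a b : Fin 2 → ℕ → ℕ → ℝ) : Prop where
  b_zero : ∀ (l : Fin 2) (n : ℕ), b l n 0 = -(if l = 0 then 2 / Real.pi else 0)
  a_zero : ∀ (l : Fin 2) (n : ℕ), a l n 0 =
    (if l = 1 then 2 / Real.pi else 0) + 1 / Real.pi * (b l 0 0 / ((n : ℝ) + 1 / 2))
  b_succ : ∀ (l : Fin 2) (n k : ℕ), b l n (k + 1) =
    1 / Real.pi * ∑ m ∈ Finset.range (k / 2 + 1), a l m (k - 2 * m) / ((n : ℝ) + m + 1 / 2)
  a_pos : ∀ (l : Fin 2) (n k : ℕ), 0 < k → a l n k =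
    1 / Real.pi * ∑ m ∈ Finset.range (k / 2 + 1), b l m (k - 2 * m) / ((n : ℝ) + m + 1 / 2)

/-- `A⁺_{ln} = λ^{2n+1} ∑ₖ a_{l,n,k} λᵏ`. -/
def coefA (lam : ℝ) (a : Fin 2 → ℕ → ℕ → ℝ) (l : Fin 2) (n : ℕ) : ℂ :=
  ((lam ^ (2 * n + 1) * ∑' k : ℕ, a l n k * lam ^ k : ℝ) : ℂ)

/-- `B⁻_{ln} = λ^{2n} ∑ₖ b_{l,n,k} λᵏ`. -/
def coefB (lam : ℝ) (b : Fin 2 → ℕ → ℕ → ℝ) (l : Fin 2) (n : ℕ) : ℂ :=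
  ((lam ^ (2 * n) * ∑' k : ℕ, b l n k * lam ^ k : ℝ) : ℂ)

/-- `Ψ⁺_l(s) = ∑ₘ A⁺_{lm} / (s - 2m - 1)`. -/
def Psi (A : Fin 2 → ℕ → ℂ) (l : Fin 2) (s : ℂ) : ℂ := ∑' m : ℕ, A l m / (s - 2 * m - 1)

/-- `Ω⁻_l(s) = ∑ₘ B⁻_{lm} / (s + 2m)`. -/
def Omega (B : Fin 2 → ℕ → ℂ) (l : Fin 2) (s : ℂ) : ℂ := ∑' m : ℕ, B l m / (s + 2 * m)

/-- The explicit expression for `X⁺(s)`; meaningful in `D⁺` off the removable singularities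
`s = 0, -2, -4, …`. -/
def XplusExpr (lam : ℝ) (A B : Fin 2 → ℕ → ℂ) (s : ℂ) : Matrix (Fin 2) (Fin 2) ℂ :=
  Matrix.of fun i l =>
    if i = 0 then
      1 / 2 * (Omega B l s + kron l 1 +
        (lam : ℂ) ^ (-s) * Complex.cot (Real.pi * s / 2) * (Psi A l s + kron l 0))
    else Psi A l s + kron l 0

/-- The explicit expression for `X⁻(s)`; meaningful in `D⁻` off the removable singularities
`s = 1, 3, 5, …`. -/
def XminusExpr (lam : ℝ) (A B : Fin 2 → ℕ → ℂ) (s : ℂ) : Matrix (Fin 2) (Fin 2) ℂ :=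
  Matrix.of fun i l =>
    if i = 0 then
      1 / 2 * (Psi A l s + kron l 0 +
        (lam : ℂ) ^ s * Complex.tan (Real.pi * s / 2) * (Omega B l s + kron l 1))
    else 1 / (lam : ℂ) * (Omega B l s + kron l 1)

/-! ### Orders at infinity, canonical factorization, partial indices -/

/-- `y` has order `α` at infinity in `D`: `y(s) = s^{-α} ỹ(s)` with `ỹ` bounded, and bounded away
from zero, near infinity in `D`. It is used for scalar functions and for columns with the maximum
norm; when each component of a column has an order, the order of the column is their minimum. -/
def HasOrderAtInfty {E : Type*} [NormedAddCommGroup E] [NormedSpace ℂ E]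
    (D : Set ℂ) (y : ℂ → E) (α : ℤ) : Prop :=
  ∃ c C R : ℝ, 0 < c ∧ ∀ s ∈ D, R ≤ ‖s‖ → c ≤ ‖s ^ α • y s‖ ∧ ‖s ^ α • y s‖ ≤ C

/-- `X^±` is a canonical factorization of `G` along the line `Re s = γ` with the orders `κ` of its
columns: the factors are analytic in the half-planes, continuous and nonsingular up to the line,
`G = X⁺ (X⁻)⁻¹` on the line, and `X^±` have the normal form at infinity: the order of the
determinant is the sum of the orders of the columns. -/
structure IsCanonicalFactorization (γ : ℝ) (G Xp Xm : ℂ → Matrix (Fin 2) (Fin 2) ℂ)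
    (κ : Fin 2 → ℤ) : Prop where
  analytic_plus : ∀ i j, DiffContOnCl ℂ (fun s => Xp s i j) {s : ℂ | s.re < γ}
  analytic_minus : ∀ i j, DiffContOnCl ℂ (fun s => Xm s i j) {s : ℂ | γ < s.re}
  factor : ∀ s : ℂ, s.re = γ → G s = Xp s * (Xm s)⁻¹
  det_plus : ∀ s ∈ Dplus γ, (Xp s).det ≠ 0
  det_minus : ∀ s ∈ Dminus γ, (Xm s).det ≠ 0
  order_plus : ∀ j, HasOrderAtInfty (Dplus γ) (fun s i => Xp s i j) (κ j)
  order_minus : ∀ j, HasOrderAtInfty (Dminus γ) (fun s i => Xm s i j) (κ j)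
  normal_plus : HasOrderAtInfty (Dplus γ) (fun s => (Xp s).det) (∑ j, κ j)
  normal_minus : HasOrderAtInfty (Dminus γ) (fun s => (Xm s).det) (∑ j, κ j)

/-- `κ` is a system of partial indices of `G` along the line `Re s = γ`. -/
def HasPartialIndices (γ : ℝ) (G : ℂ → Matrix (Fin 2) (Fin 2) ℂ) (κ : Fin 2 → ℤ) : Prop :=
  ∃ Xp Xm : ℂ → Matrix (Fin 2) (Fin 2) ℂ, IsCanonicalFactorization γ G Xp Xm κ

/-- Stability: small perturbations of `G` on the line do not change the partial indices. Every
uniformly close matrix function that has partial indices has the same ones up to order, and every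
perturbation `G + F` with `F`, `F'`, `F''` small (with a quadratic decay) does have them. -/
structure StablePartialIndices (γ : ℝ) (G : ℂ → Matrix (Fin 2) (Fin 2) ℂ)
    (κ : Fin 2 → ℤ) : Prop where
  indices : HasPartialIndices γ G κ
  unchanged : ∃ ε : ℝ, 0 < ε ∧ ∀ (G' : ℂ → Matrix (Fin 2) (Fin 2) ℂ) (κ' : Fin 2 → ℤ),
    (∀ s : ℂ, s.re = γ → ∀ i j, ‖G' s i j - G s i j‖ < ε) → HasPartialIndices γ G' κ' →
      ∃ σ : Equiv.Perm (Fin 2), ∀ j, κ' j = κ (σ j)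
  persistent : ∃ ε : ℝ, 0 < ε ∧ ∀ F : ℝ → Matrix (Fin 2) (Fin 2) ℂ,
    (∀ i j, ContDiff ℝ 2 fun t => F t i j) →
    (∀ i j, ∀ k ≤ 2, ∀ t : ℝ, ‖iteratedDeriv k (fun t => F t i j) t‖ ≤ ε / (1 + t ^ 2)) →
      HasPartialIndices γ (fun s => G s + F s.im) κ

end

/-! For the explicit expressions the relation `G0 * X⁻ = X⁺` is an algebraic identity in the strip 0
< Re s < 1. The content is that the expressions have no poles in their half-planes, that their
determinants are constant, and that they are controlled at infinity. The candidate poles of χ⁺_{1l}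
at s = -2n come from Ω and from the cotangent; the total residue there vanishes exactly when the
second infinite system holds. The reflection s ↦ 1 - s brings χ⁻_{1l} to the same shape, and there
the residue condition is the first system. One study of `rowExpr` under `PolesCancel` therefore
serves both factors.

The systems are governed by the matrix 1 / (π(n + m + 1/2)). The weights (2n choose n) / 4ⁿ show by
a Schur test that this matrix is only just bounded by 1, so every gain must come from the damping
λ^{2m}. `exists_supersolution` extracts it: there is a bounded v ≥ 1 with 1 + Tv ≤ v for the damped
operator T. This single inequality bounds the power series in λ uniformly in n
(`Recurrences.exists_bound`), and it makes the homogeneous system a contraction, whence uniqueness.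
The coefficients of each column have a constant sign, so the sums of A and B that appear as limits
at infinity do not vanish.

The cotangent is bounded off discs of radius 1/2 around its poles, and the maximum principle carries
bounds and limits into the discs. In the strip det X⁺ = -λ det X⁻, so the two sides glue to a
bounded entire function. It is constant by Liouville, with value -1/2 read off at infinity. Bounded
entries and a determinant bounded away from zero (`GoodFactor`) then give zero partial indices.

For the first half of stability, suppose a nearby G' has a nonzero index. A column of its factors
(positive index) or a row of their inverses (negative index) decays at infinity. Multiplied by X^±
or their inverses it yields decaying functions analytic in the two half-planes and close to each
other on the line. By Cauchy's theorem such functions are orthogonal in L² of the line, so closeness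
forces them to vanish there (`eq_zero_of_close`), against nonsingularity.

For the second half write G + F = X⁺ (1 + (X⁺)⁻¹ F X⁻) (X⁻)⁻¹. The factors continue to a strip
around the line, so their derivatives on the line are bounded, and the middle term is 1 plus the
Fourier transform of a small L¹ matrix. A Wiener–Hopf equation solved by a Neumann series factors it
with bounded factors (`exists_wiener_factorization`). -/

noncomputable section

/-! ### The Hilbert matrix: a sharp Schur test and a supersolution. -/

/-- The weights `(2n choose n) / 4ⁿ`, an eigenvector of the Hilbert matrix `1 / (n + m + 1/2)`. -/
def hilbertWeight (n : ℕ) : ℝ := (n.centralBinom : ℝ) / 4 ^ n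

lemma hilbertWeight_pos (n : ℕ) : 0 < hilbertWeight n := by
  unfold hilbertWeight
  have := Nat.centralBinom_pos n
  positivity

lemma hilbertWeight_zero : hilbertWeight 0 = 1 := by simp [hilbertWeight]

lemma hilbertWeight_succ (n : ℕ) :
    (2 * (n : ℝ) + 2) * hilbertWeight (n + 1) = (2 * n + 1) * hilbertWeight n := by
  have h := Nat.succ_mul_centralBinom_succ n
  have h' : ((n : ℝ) + 1) * (n + 1).centralBinom = 2 * (2 * n + 1) * n.centralBinom := by
    exact_mod_cast h
  unfold hilbertWeight
  rw [pow_succ]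
  field_simp
  linear_combination 2 * h'

lemma hilbertWeight_le_one (n : ℕ) : hilbertWeight n ≤ 1 := by
  induction n with
  | zero => simp [hilbertWeight_zero]
  | succ n ih =>
    have := hilbertWeight_succ n
    have hp := hilbertWeight_pos n
    by_contra! h
    nlinarith

/-- `cos θ · ∑_{m < N} w_m sin^{2m} θ` is at most `1` on `[0, π/2]`. -/
lemma cos_mul_sum_hilbertWeight_le (N : ℕ) {θ : ℝ} (h0 : 0 ≤ θ) (h1 : θ ≤ Real.pi / 2) :
    Real.cos θ * ∑ m ∈ Finset.range N, hilbertWeight m * Real.sin θ ^ (2 * m) ≤ 1 := by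
  rcases Nat.eq_zero_or_pos N with rfl | hN
  · simp
  set f : ℝ → ℝ := fun θ =>
    Real.cos θ * ∑ m ∈ Finset.range N, hilbertWeight m * Real.sin θ ^ (2 * m) with hf
  -- These are partial sums of the binomial series of (1 - sin²)^(-1/2), so by the recursion of the
  -- weights their derivative telescopes to a single term. For N = 0 the truncated exponent 2N - 1
  -- is harmless because of the factor N.
  have key : ∀ x : ℝ, ∀ N : ℕ,
      -Real.sin x * (∑ m ∈ Finset.range N, hilbertWeight m * Real.sin x ^ (2 * m)) +
      Real.cos x * (∑ m ∈ Finset.range N,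
        hilbertWeight m * ((2 * m : ℕ) * Real.sin x ^ (2 * m - 1) * Real.cos x))
      = -(2 * N) * hilbertWeight N * Real.sin x ^ (2 * N - 1) := by
    intro x N
    induction N with
    | zero => simp
    | succ k ih =>
      rw [Finset.sum_range_succ, Finset.sum_range_succ]
      have hw := hilbertWeight_succ k
      have hc : Real.cos x ^ 2 = 1 - Real.sin x ^ 2 := by rw [Real.cos_sq']
      have e2 : 2 * (k + 1) - 1 = 2 * k + 1 := by omega
      rw [e2]
      push_cast at ih ⊢
      have e1 : ((k : ℝ)) * Real.sin x ^ (2 * k - 1) * Real.sin x ^ 2 =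
          k * Real.sin x ^ (2 * k + 1) := by
        rcases Nat.eq_zero_or_pos k with rfl | hk
        · simp
        · rw [mul_assoc, ← pow_add]; congr 2; omega
      have e3 : Real.sin x ^ (2 * k + 1) = Real.sin x ^ (2 * k) * Real.sin x := pow_succ _ _
      rw [e3] at e1 ⊢
      linear_combination ih + 2 * k * hilbertWeight k * Real.sin x ^ (2 * k - 1) * hc
        - 2 * hilbertWeight k * e1 + Real.sin x ^ (2 * k) * Real.sin x * hw
  have hd : ∀ x, HasDerivAt f (-(2 * N) * hilbertWeight N * Real.sin x ^ (2 * N - 1)) x := by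
    intro x
    rw [← key x N]
    refine (Real.hasDerivAt_cos x).mul ?_
    refine HasDerivAt.fun_sum fun m _ => ?_
    exact ((Real.hasDerivAt_sin x).pow (2 * m)).const_mul _
  have hanti : AntitoneOn f (Set.Icc 0 (Real.pi / 2)) := by
    refine antitoneOn_of_deriv_nonpos (convex_Icc _ _)
      (fun x _ => (hd x).continuousAt.continuousWithinAt)
      (fun x _ => (hd x).differentiableAt.differentiableWithinAt) ?_
    intro x hx
    rw [interior_Icc] at hx
    rw [(hd x).deriv]
    have hs : 0 ≤ Real.sin x := Real.sin_nonneg_of_nonneg_of_le_pi hx.1.le (by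
      linarith [hx.2, Real.pi_pos])
    have := hilbertWeight_pos N
    have : 0 ≤ (2 * N) * hilbertWeight N * Real.sin x ^ (2 * N - 1) := by positivity
    linarith
  have h := hanti (a := 0) ⟨le_rfl, by positivity⟩ ⟨h0, h1⟩ h0
  have f0 : f 0 = 1 := by
    simp only [hf, Real.cos_zero, Real.sin_zero, one_mul]
    rw [Finset.sum_eq_single_of_mem 0 (Finset.mem_range.2 hN)]
    · simp [hilbertWeight_zero]
    · intro b _ hb
      simp [hb]
  rw [f0] at h
  exact h

/-- The full sum is 2 arcsin 1 = π. To avoid the series at its boundary point, θ minus the truncated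
arcsine series in sin θ is shown to increase on [0, π/2]. -/
lemma sum_hilbertWeight_div_le (N : ℕ) :
    ∑ m ∈ Finset.range N, hilbertWeight m / ((m : ℝ) + 1 / 2) ≤ Real.pi := by
  set g : ℝ → ℝ := fun θ => θ -
    ∑ m ∈ Finset.range N, hilbertWeight m / (2 * m + 1) * Real.sin θ ^ (2 * m + 1) with hg
  have hd : ∀ x, HasDerivAt g
      (1 - Real.cos x * ∑ m ∈ Finset.range N, hilbertWeight m * Real.sin x ^ (2 * m)) x := by
    intro x
    refine (hasDerivAt_id x).sub ?_
    rw [Finset.mul_sum]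
    refine HasDerivAt.fun_sum fun m _ => ?_
    convert! ((Real.hasDerivAt_sin x).pow (2 * m + 1)).const_mul (hilbertWeight m / (2 * m + 1))
      using 1
    push_cast
    field_simp
  have hmono : MonotoneOn g (Set.Icc 0 (Real.pi / 2)) := by
    refine monotoneOn_of_deriv_nonneg (convex_Icc _ _)
      (fun x _ => (hd x).continuousAt.continuousWithinAt)
      (fun x _ => (hd x).differentiableAt.differentiableWithinAt) ?_
    intro x hx
    rw [interior_Icc] at hx
    rw [(hd x).deriv]
    linarith [cos_mul_sum_hilbertWeight_le N hx.1.le hx.2.le]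
  have hp := Real.pi_pos
  have h := hmono (a := 0) (b := Real.pi / 2) ⟨le_rfl, by positivity⟩ ⟨by positivity, le_rfl⟩
    (by positivity)
  simp only [hg, Real.sin_zero, Real.sin_pi_div_two, one_pow, mul_one] at h
  have e : ∑ m ∈ Finset.range N, hilbertWeight m / ((m : ℝ) + 1 / 2) =
      2 * ∑ m ∈ Finset.range N, hilbertWeight m / (2 * m + 1) := by
    rw [Finset.mul_sum]
    refine Finset.sum_congr rfl fun m _ => ?_
    field_simp
    try ring
  rw [e]
  have z : ∑ x ∈ Finset.range N, hilbertWeight x / (2 * (x : ℝ) + 1) * 0 ^ (2 * x + 1) = 0 :=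
    Finset.sum_eq_zero fun m _ => by simp
  rw [z] at h
  linarith

/-- The sharp Schur test for the Hilbert matrix. -/
lemma sum_hilbertWeight_le (N n : ℕ) :
    ∑ m ∈ Finset.range N, hilbertWeight m / ((n : ℝ) + m + 1 / 2) ≤
      Real.pi * hilbertWeight n := by
  induction n with
  | zero => simpa [hilbertWeight_zero] using sum_hilbertWeight_div_le N
  | succ n ih =>
    -- The sums for n + 1 and n are proportional up to a boundary term at m = N. Its sign is
    -- favourable, so it is dropped, and the factors match the recursion of the weights.
    have tele : ∀ N : ℕ, (2 * (n : ℝ) + 2) *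
        ∑ m ∈ Finset.range N, hilbertWeight m / (((n + 1 : ℕ) : ℝ) + m + 1 / 2) =
        (2 * n + 1) * ∑ m ∈ Finset.range N, hilbertWeight m / ((n : ℝ) + m + 1 / 2) -
          2 * N * hilbertWeight N / (n + N + 1 / 2) := by
      intro N
      induction N with
      | zero => simp
      | succ k ihk =>
        rw [Finset.sum_range_succ, Finset.sum_range_succ, mul_add, ihk, mul_add]
        have hw := hilbertWeight_succ k
        have hw' : hilbertWeight (k + 1) = (2 * k + 1) * hilbertWeight k / (2 * k + 2) := by
          field_simp; linarith
        rw [hw']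
        push_cast
        field_simp
        ring
    have ht := tele N
    have hpos : 0 ≤ 2 * N * hilbertWeight N / ((n : ℝ) + N + 1 / 2) := by
      have := hilbertWeight_pos N
      positivity
    have hs := hilbertWeight_succ n
    have h2 : (2 * (n : ℝ) + 2) *
        ∑ m ∈ Finset.range N, hilbertWeight m / (((n + 1 : ℕ) : ℝ) + m + 1 / 2) ≤
        (2 * n + 2) * (Real.pi * hilbertWeight (n + 1)) := by
      rw [ht]
      have : (2 * (n : ℝ) + 1) * ∑ m ∈ Finset.range N, hilbertWeight m / ((n : ℝ) + m + 1 / 2) ≤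
        (2 * n + 1) * (Real.pi * hilbertWeight n) := by gcongr
      have e : (2 * (n : ℝ) + 2) * (Real.pi * hilbertWeight (n + 1)) =
        (2 * n + 1) * (Real.pi * hilbertWeight n) := by linear_combination Real.pi * hs
      linarith
    exact le_of_mul_le_mul_left h2 (by positivity)

/-- A bounded strict supersolution for the damped Hilbert matrix. -/
lemma exists_supersolution {r : ℝ} (h0 : 0 < r) (h1 : r < 1) :
    ∃ (v : ℕ → ℝ) (V : ℝ), (∀ n, 1 ≤ v n) ∧ (∀ n, v n ≤ V) ∧ ∀ n N : ℕ,
      1 + 1 / Real.pi * ∑ m ∈ Finset.range N, r ^ (2 * m) * v m / ((n : ℝ) + m + 1 / 2) ≤ v n := by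
  have hp := Real.pi_pos
  have hr2 : r ^ 2 < 1 := by nlinarith
  obtain ⟨K, hK⟩ : ∃ K : ℝ, K = (1 - r ^ 2)⁻¹ := ⟨_, rfl⟩
  have hKpos : 0 < K := by rw [hK]; exact inv_pos.2 (by linarith)
  have hw1 : hilbertWeight 1 = 1 / 2 := by
    have := hilbertWeight_succ 0
    simp only [hilbertWeight_zero] at this
    push_cast at this
    linarith
  -- Chosen so that M (1 - r²) / 2 = 3K; then 3K / (n + 3/2) pays for K / (n + 1/2) at every n, with
  -- equality at n = 0.
  obtain ⟨M, hM⟩ : ∃ M : ℝ, M = 6 * K * K := ⟨_, rfl⟩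
  have hMpos : 0 < M := by rw [hM]; positivity
  refine ⟨fun n => 1 + M * hilbertWeight n, 1 + M, fun n => ?_, fun n => ?_, fun n N => ?_⟩
  · have := hilbertWeight_pos n
    have : 0 ≤ M * hilbertWeight n := by positivity
    linarith
  · have := hilbertWeight_le_one n
    nlinarith
  -- The range is enlarged so that it contains m = 1, the first index where r^{2m} < 1. The term m =
  -- 0 is not damped and gives no gain.
  · have hmono : ∑ m ∈ Finset.range N, r ^ (2 * m) * (1 + M * hilbertWeight m) /
        ((n : ℝ) + m + 1 / 2) ≤ ∑ m ∈ Finset.range (N + 2), r ^ (2 * m) *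
          (1 + M * hilbertWeight m) / ((n : ℝ) + m + 1 / 2) := by
      refine Finset.sum_le_sum_of_subset_of_nonneg (Finset.range_mono (by omega)) fun m _ _ => ?_
      have := hilbertWeight_pos m
      positivity
    have hsplit : ∑ m ∈ Finset.range (N + 2), r ^ (2 * m) *
          (1 + M * hilbertWeight m) / ((n : ℝ) + m + 1 / 2) =
        ∑ m ∈ Finset.range (N + 2), (r ^ 2) ^ m / ((n : ℝ) + m + 1 / 2) +
        M * ∑ m ∈ Finset.range (N + 2), r ^ (2 * m) * hilbertWeight m /
          ((n : ℝ) + m + 1 / 2) := by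
      rw [Finset.mul_sum, ← Finset.sum_add_distrib]
      refine Finset.sum_congr rfl fun m _ => ?_
      rw [pow_mul]
      ring
    have hA : ∑ m ∈ Finset.range (N + 2), (r ^ 2) ^ m / ((n : ℝ) + m + 1 / 2) ≤
        K / (n + 1 / 2) := by
      calc _ ≤ ∑ m ∈ Finset.range (N + 2), (r ^ 2) ^ m / ((n : ℝ) + 1 / 2) := by
            refine Finset.sum_le_sum fun m _ => ?_
            gcongr
            have : (0 : ℝ) ≤ m := by positivity
            linarith
        _ = (∑ m ∈ Finset.range (N + 2), (r ^ 2) ^ m) / ((n : ℝ) + 1 / 2) := by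
            rw [Finset.sum_div]
        _ ≤ _ := by
            gcongr
            rw [hK, ← tsum_geometric_of_lt_one (by positivity) hr2]
            exact (summable_geometric_of_lt_one (by positivity) hr2).sum_le_tsum _
              fun _ _ => by positivity
    have hB : ∑ m ∈ Finset.range (N + 2), r ^ (2 * m) * hilbertWeight m /
          ((n : ℝ) + m + 1 / 2) ≤ Real.pi * hilbertWeight n -
          (1 - r ^ 2) * (1 / 2) / (n + 3 / 2) := by
      have h3 : (1 - r ^ 2) * (1 / 2) / ((n : ℝ) + 3 / 2) ≤ ∑ m ∈ Finset.range (N + 2),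
          (1 - r ^ (2 * m)) * hilbertWeight m / ((n : ℝ) + m + 1 / 2) := by
        have := Finset.single_le_sum (s := Finset.range (N + 2)) (f := fun m : ℕ =>
          (1 - r ^ (2 * m)) * hilbertWeight m / ((n : ℝ) + m + 1 / 2)) (fun m _ => by
            have := hilbertWeight_pos m
            have h4 : r ^ (2 * m) ≤ 1 := pow_le_one₀ h0.le h1.le
            have : 0 ≤ 1 - r ^ (2 * m) := by linarith
            positivity) (a := 1) (by simp)
        simp only [hw1] at this
        have e : (n : ℝ) + (1 : ℕ) + 1 / 2 = n + 3 / 2 := by push_cast; ring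
        rw [e] at this
        simpa using this
      have h5 := sum_hilbertWeight_le (N + 2) n
      have h6 : ∑ m ∈ Finset.range (N + 2), r ^ (2 * m) * hilbertWeight m /
          ((n : ℝ) + m + 1 / 2) + ∑ m ∈ Finset.range (N + 2),
          (1 - r ^ (2 * m)) * hilbertWeight m / ((n : ℝ) + m + 1 / 2) =
          ∑ m ∈ Finset.range (N + 2), hilbertWeight m / ((n : ℝ) + m + 1 / 2) := by
        rw [← Finset.sum_add_distrib]
        refine Finset.sum_congr rfl fun m _ => by ring
      linarith
    have hC : K / ((n : ℝ) + 1 / 2) ≤ M * ((1 - r ^ 2) * (1 / 2) / (n + 3 / 2)) := by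
      have : M * ((1 - r ^ 2) * (1 / 2) / ((n : ℝ) + 3 / 2)) = 3 * K / (n + 3 / 2) := by
        have h7 : K * (1 - r ^ 2) = 1 := by rw [hK]; exact inv_mul_cancel₀ (by linarith)
        rw [hM, show 6 * K * K * ((1 - r ^ 2) * (1 / 2) / ((n : ℝ) + 3 / 2)) =
          3 * K * (K * (1 - r ^ 2)) / (n + 3 / 2) by ring, h7, mul_one]
      rw [this, div_le_div_iff₀ (by positivity) (by positivity)]
      have : (0 : ℝ) ≤ n := by positivity
      nlinarith
    have hfin : ∑ m ∈ Finset.range N, r ^ (2 * m) * (1 + M * hilbertWeight m) /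
        ((n : ℝ) + m + 1 / 2) ≤ M * (Real.pi * hilbertWeight n) := by
      have := mul_le_mul_of_nonneg_left hB hMpos.le
      rw [mul_sub] at this
      linarith
    have : 1 / Real.pi * ∑ m ∈ Finset.range N, r ^ (2 * m) * (1 + M * hilbertWeight m) /
        ((n : ℝ) + m + 1 / 2) ≤ 1 / Real.pi * (M * (Real.pi * hilbertWeight n)) := by gcongr
    have e : 1 / Real.pi * (M * (Real.pi * hilbertWeight n)) = M * hilbertWeight n := by
      field_simp
    simp only
    linarith


/-! ### The recurrences: existence, uniqueness, signs and bounds. -/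

/-- The `k`-th power series coefficients `(b l · k, a l · k)`, computed from the recurrences. -/
def recCoef (l : Fin 2) : ℕ → (ℕ → ℝ) × (ℕ → ℝ)
  | 0 => (fun _ => -(if l = 0 then 2 / Real.pi else 0), fun n =>
      (if l = 1 then 2 / Real.pi else 0) +
        1 / Real.pi * (-(if l = 0 then 2 / Real.pi else 0) / ((n : ℝ) + 1 / 2)))
  | k + 1 =>
    -- The m = 0 term of a at order k + 1 involves b at the same order, so b is computed first and
    -- reused; all other references go to lower orders.
    let bk : ℕ → ℝ := fun n =>
      1 / Real.pi * ∑ m ∈ Finset.range (k / 2 + 1),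
        (recCoef l (k - 2 * m)).2 m / ((n : ℝ) + m + 1 / 2)
    (bk, fun n => 1 / Real.pi * ∑ m ∈ Finset.range ((k + 1) / 2 + 1),
      (if h : m = 0 then bk 0 else (recCoef l (k + 1 - 2 * m)).1 m) / ((n : ℝ) + m + 1 / 2))
  termination_by k => k

lemma recurrences_recCoef :
    Recurrences (fun l n k => (recCoef l k).2 n) (fun l n k => (recCoef l k).1 n) where
  b_zero l n := by rw [recCoef]
  a_zero l n := by rw [recCoef]
  b_succ l n k := by rw [recCoef]
  a_pos l n k hk := by
    obtain ⟨k, rfl⟩ : ∃ j, k = j + 1 := ⟨k - 1, by omega⟩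
    conv_lhs => rw [recCoef]
    refine congrArg _ (Finset.sum_congr rfl fun m _ => ?_)
    split_ifs with h
    · subst h
      simp only [Nat.mul_zero, Nat.sub_zero]
      conv_rhs => rw [recCoef]
    · rfl

lemma Recurrences.a_eq {a b : Fin 2 → ℕ → ℕ → ℝ} (h : Recurrences a b) (l : Fin 2) (n k : ℕ) :
    a l n k = 1 / Real.pi *
        ∑ m ∈ Finset.range (k / 2 + 1), b l m (k - 2 * m) / ((n : ℝ) + m + 1 / 2) +
      (if k = 0 then (if l = 1 then 2 / Real.pi else 0) else 0) := by
  rcases Nat.eq_zero_or_pos k with rfl | hk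
  · rw [h.a_zero]
    simp [add_comm]
  · rw [h.a_pos l n k hk, if_neg hk.ne', add_zero]

lemma Recurrences.unique {a b a' b' : Fin 2 → ℕ → ℕ → ℝ} (h : Recurrences a b)
    (h' : Recurrences a' b') : a' = a ∧ b' = b := by
  have key : ∀ k l n, a' l n k = a l n k ∧ b' l n k = b l n k := by
    intro k
    induction k using Nat.strong_induction_on with
    | _ k ih =>
      intro l
      have hb : ∀ n, b' l n k = b l n k := by
        intro n
        rcases k with _ | k
        · rw [h.b_zero, h'.b_zero]
        · rw [h.b_succ, h'.b_succ]
          congr 1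
          refine Finset.sum_congr rfl fun m _ => ?_
          rw [(ih (k - 2 * m) (by omega) l m).1]
      refine fun n => ⟨?_, hb n⟩
      rw [h.a_eq, h'.a_eq]
      congr 2
      refine Finset.sum_congr rfl fun m _ => ?_
      rcases Nat.eq_zero_or_pos m with rfl | hm
      · simp only [Nat.mul_zero, Nat.sub_zero, hb]
      -- The range restriction on m has been discarded, so k = 0 with m > 0 must be covered; there k
      -- - 2m truncates to 0.
      · rcases Nat.eq_zero_or_pos k with rfl | hk
        · simp only [Nat.zero_sub, hb]
        · rw [(ih (k - 2 * m) (by omega) l m).2]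
  exact ⟨by ext l n k; exact (key k l n).1, by ext l n k; exact (key k l n).2⟩

/-- The coefficients of the column `l = 1` are nonnegative, those of `l = 0` are nonpositive. -/
lemma Recurrences.sign {a b : Fin 2 → ℕ → ℕ → ℝ} (h : Recurrences a b) (l : Fin 2) (n k : ℕ) :
    0 ≤ (-1) ^ (l.val + 1) * a l n k ∧ 0 ≤ (-1) ^ (l.val + 1) * b l n k := by
  have hp := Real.pi_pos
  induction k using Nat.strong_induction_on generalizing n with
  | _ k ih =>
    have hb : ∀ n, 0 ≤ (-1) ^ (l.val + 1) * b l n k := by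
      intro n
      rcases k with _ | k
      · rw [h.b_zero]
        fin_cases l <;> simp
        positivity
      · rw [h.b_succ, mul_left_comm, Finset.mul_sum]
        refine mul_nonneg (by positivity) (Finset.sum_nonneg fun m _ => ?_)
        rw [← mul_div_assoc]
        exact div_nonneg (ih (k - 2 * m) (by omega) m).1 (by positivity)
    refine ⟨?_, hb n⟩
    rw [h.a_eq, mul_add, mul_left_comm, Finset.mul_sum]
    refine add_nonneg (mul_nonneg (by positivity) (Finset.sum_nonneg fun m _ => ?_)) ?_
    · rw [← mul_div_assoc]
      refine div_nonneg ?_ (by positivity)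
      rcases Nat.eq_zero_or_pos (2 * m) with hm | hm
      · rw [hm]; exact hb m
      · rcases Nat.eq_zero_or_pos k with rfl | hk
        · rw [Nat.zero_sub]; exact hb m
        · exact (ih (k - 2 * m) (by omega) m).2
    · split_ifs with h1 h2
      · subst h2; simp; positivity
      · simp
      · simp

/-- Substitute k = 2m + j. The terms with k < K have m, j < K, and since everything is nonnegative
the index set may be enlarged to the full square. -/
lemma sum_range_shift_le {r : ℝ} (h0 : 0 < r) {c : ℕ → ℕ → ℝ} (hc : ∀ m j, 0 ≤ c m j)
    {h : ℕ → ℝ} (hh : ∀ m, 0 ≤ h m) (K : ℕ) :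
    ∑ k ∈ Finset.range K, r ^ k * ∑ m ∈ Finset.range (k / 2 + 1), c m (k - 2 * m) * h m ≤
      ∑ m ∈ Finset.range K, r ^ (2 * m) * (∑ j ∈ Finset.range K, c m j * r ^ j) * h m := by
  have e : ∀ k ∈ Finset.range K, r ^ k * ∑ m ∈ Finset.range (k / 2 + 1), c m (k - 2 * m) * h m =
      ∑ m ∈ Finset.range K, if 2 * m ≤ k then r ^ k * (c m (k - 2 * m) * h m) else 0 := by
    intro k hk
    rw [Finset.mul_sum, ← Finset.sum_filter]
    refine Finset.sum_congr ?_ fun _ _ => rfl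
    ext m
    simp only [Finset.mem_range, Finset.mem_filter] at hk ⊢
    omega
  rw [Finset.sum_congr rfl e, Finset.sum_comm]
  refine Finset.sum_le_sum fun m _ => ?_
  rw [mul_right_comm, Finset.mul_sum]
  rcases le_or_gt K (2 * m) with hK | hK
  · rw [Finset.sum_eq_zero]
    · exact Finset.sum_nonneg fun j _ => by
        have := hc m j
        have := hh m
        positivity
    · intro k hk
      rw [if_neg]
      have := Finset.mem_range.1 hk
      omega
  · obtain ⟨K', rfl⟩ : ∃ j, K = 2 * m + j := ⟨K - 2 * m, by omega⟩
    rw [Finset.sum_range_add, Finset.sum_eq_zero, zero_add]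
    · refine (Finset.sum_le_sum_of_subset_of_nonneg (Finset.range_mono (by omega :
        K' ≤ 2 * m + K')) fun j _ _ => ?_).trans (Finset.sum_le_sum fun j _ => ?_)
      · split_ifs
        · have := hc m (2 * m + j - 2 * m)
          have := hh m
          positivity
        · rfl
      · rw [if_pos (by omega), Nat.add_sub_cancel_left, pow_add]
        exact le_of_eq (by ring)
    · intro k hk
      rw [if_neg]
      have := Finset.mem_range.1 hk
      omega

/-- Summability of the power series at every `r < 1`, with bounds uniform in `n`. -/
lemma Recurrences.exists_bound {a b : Fin 2 → ℕ → ℕ → ℝ} (h : Recurrences a b) {r : ℝ}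
    (h0 : 0 < r) (h1 : r < 1) : ∃ V : ℝ, ∀ l n K,
      ∑ k ∈ Finset.range K, |a l n k| * r ^ k ≤ V ∧
      ∑ k ∈ Finset.range K, |b l n k| * r ^ k ≤ V := by
  obtain ⟨v, V, hv1, hvV, hv⟩ := exists_supersolution h0 h1
  have hp := Real.pi_pos
  have hp1 : 2 / Real.pi ≤ 1 := by
    rw [div_le_one hp]; linarith [Real.pi_gt_three]
  -- Partial sums below v are sent below v - 1. The missing 1 leaves room for the inhomogeneous
  -- terms, which are at most 2/π ≤ 1.
  have hT : ∀ (c : ℕ → ℕ → ℝ) (K n : ℕ), (∀ m, ∑ j ∈ Finset.range K, |c m j| * r ^ j ≤ v m) →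
      ∑ k ∈ Finset.range K, |1 / Real.pi * ∑ m ∈ Finset.range (k / 2 + 1),
        c m (k - 2 * m) / ((n : ℝ) + m + 1 / 2)| * r ^ k ≤ v n - 1 := by
    intro c K n hc
    calc _ ≤ ∑ k ∈ Finset.range K, 1 / Real.pi * (r ^ k * ∑ m ∈ Finset.range (k / 2 + 1),
          |c m (k - 2 * m)| * ((n : ℝ) + m + 1 / 2)⁻¹) := by
          refine Finset.sum_le_sum fun k _ => ?_
          rw [abs_mul, abs_of_pos (by positivity : 0 < 1 / Real.pi), mul_assoc, mul_comm (r ^ k)]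
          gcongr
          refine (Finset.abs_sum_le_sum_abs _ _).trans (le_of_eq ?_)
          refine Finset.sum_congr rfl fun m _ => ?_
          rw [abs_div, div_eq_mul_inv, abs_of_pos (by positivity : 0 < (n : ℝ) + m + 1 / 2)]
      _ ≤ 1 / Real.pi * ∑ m ∈ Finset.range K,
            r ^ (2 * m) * (∑ j ∈ Finset.range K, |c m j| * r ^ j) * ((n : ℝ) + m + 1 / 2)⁻¹ := by
          rw [← Finset.mul_sum]
          refine mul_le_mul_of_nonneg_left ?_ (by positivity)
          exact sum_range_shift_le (c := fun m j => |c m j|)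
            (h := fun m : ℕ => ((n : ℝ) + m + 1 / 2)⁻¹) h0 (fun _ _ => abs_nonneg _)
            (fun m => by positivity) K
      _ ≤ 1 / Real.pi * ∑ m ∈ Finset.range K, r ^ (2 * m) * v m / ((n : ℝ) + m + 1 / 2) := by
          refine mul_le_mul_of_nonneg_left (Finset.sum_le_sum fun m _ => ?_) (by positivity)
          rw [div_eq_mul_inv (r ^ (2 * m) * v m)]
          gcongr
          exact hc m
      _ ≤ _ := by linarith [hv n K]
  have key : ∀ l K n, ∑ k ∈ Finset.range K, |a l n k| * r ^ k ≤ v n ∧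
      ∑ k ∈ Finset.range K, |b l n k| * r ^ k ≤ v n := by
    intro l K
    induction K with
    | zero =>
      intro n
      simp only [Finset.range_zero, Finset.sum_empty]
      exact ⟨by linarith [hv1 n], by linarith [hv1 n]⟩
    | succ K ih =>
      -- The recurrence for b raises the order by one, so K + 1 orders of b use only K orders of a.
      -- The bound for a then uses the bound for b just obtained.
      have hb : ∀ n, ∑ k ∈ Finset.range (K + 1), |b l n k| * r ^ k ≤ v n := by
        intro n
        have h2 := hT (fun m k => a l m k) K n (fun m => (ih m).1)
        rw [Finset.sum_range_succ']
        have hz : |b l n 0| * r ^ 0 ≤ 1 := by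
          rw [h.b_zero, abs_neg, pow_zero, mul_one]
          split_ifs
          · rw [abs_of_pos (by positivity)]; exact hp1
          · simp
        have hs : ∑ k ∈ Finset.range K, |b l n (k + 1)| * r ^ (k + 1) ≤ v n - 1 := by
          refine le_trans (Finset.sum_le_sum fun k _ => ?_) h2
          rw [h.b_succ]
          gcongr _ * ?_
          exact pow_le_pow_of_le_one h0.le h1.le (Nat.le_succ k)
        linarith
      refine fun n => ⟨?_, hb n⟩
      have h2 := hT (fun m k => b l m k) (K + 1) n hb
      calc _ ≤ ∑ k ∈ Finset.range (K + 1), (|1 / Real.pi * ∑ m ∈ Finset.range (k / 2 + 1),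
            b l m (k - 2 * m) / ((n : ℝ) + m + 1 / 2)| * r ^ k + if k = 0 then 1 else 0) := by
            refine Finset.sum_le_sum fun k _ => ?_
            rw [h.a_eq]
            refine (mul_le_mul_of_nonneg_right (abs_add_le _ _) (by positivity)).trans ?_
            rw [add_mul]
            gcongr
            split_ifs with hk hl
            · subst hk; rw [abs_of_pos (by positivity)]; simpa using hp1
            · subst hk; simp
            · simp
        _ ≤ v n := by
            rw [Finset.sum_add_distrib]
            simp only [Finset.sum_ite_eq', Finset.mem_range, Nat.succ_pos, if_true]
            linarith
  exact ⟨V, fun l n K => ⟨(key l K n).1.trans (hvV n), (key l K n).2.trans (hvV n)⟩⟩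

/-- Row m of the double series over (m, k) has absolute sum at most 2V r^{2m}, because 1 / (n + m +
1/2) ≤ 2. It is therefore absolutely summable and can be summed by rows or by columns. -/
lemma hasSum_shifted_convolution {r : ℝ} (h0 : 0 < r) (h1 : r < 1) {c : ℕ → ℕ → ℝ} {V : ℝ}
    (hV : ∀ m K, ∑ j ∈ Finset.range K, |c m j| * r ^ j ≤ V) (n : ℕ) :
    HasSum (fun k => (∑ m ∈ Finset.range (k / 2 + 1),
      c m (k - 2 * m) / ((n : ℝ) + m + 1 / 2)) * r ^ k)
      (∑' m : ℕ, r ^ (2 * m) * (∑' j, c m j * r ^ j) / ((n : ℝ) + m + 1 / 2)) := by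
  have hsum : ∀ m, Summable fun j => |c m j| * r ^ j := fun m =>
    summable_of_sum_range_le (fun j => by positivity) (hV m)
  have htsum : ∀ m, ∑' j, |c m j| * r ^ j ≤ V := fun m =>
    (hsum m).tsum_le_of_sum_range_le (hV m)
  have hsum' : ∀ m, Summable fun j => c m j * r ^ j := fun m => by
    refine Summable.of_norm ?_
    convert hsum m using 2 with j
    rw [norm_mul, Real.norm_eq_abs, norm_pow, Real.norm_of_nonneg h0.le]
  set F : ℕ → ℕ → ℝ := fun m k =>
    if 2 * m ≤ k then c m (k - 2 * m) * r ^ k / ((n : ℝ) + m + 1 / 2) else 0 with hF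
  have shift : ∀ (d : ℕ → ℕ → ℝ) m S, HasSum (fun j => d m j * r ^ j) S → HasSum (fun k =>
      if 2 * m ≤ k then d m (k - 2 * m) * r ^ k / ((n : ℝ) + m + 1 / 2) else 0)
      (r ^ (2 * m) * S / ((n : ℝ) + m + 1 / 2)) := by
    intro d m S hS
    have hinj : Function.Injective fun j : ℕ => j + 2 * m := add_left_injective _
    rw [← hinj.hasSum_iff]
    · convert! (hS.mul_left (r ^ (2 * m))).div_const ((n : ℝ) + m + 1 / 2) using 1
      funext j
      simp only [Function.comp_apply, Nat.add_sub_cancel]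
      rw [if_pos (by omega), pow_add]
      ring
    · intro k hk
      rw [if_neg]
      intro hle
      exact hk ⟨k - 2 * m, by simp only; omega⟩
  have hrow : ∀ m, HasSum (F m)
      (r ^ (2 * m) * (∑' j, c m j * r ^ j) / ((n : ℝ) + m + 1 / 2)) := fun m =>
    shift c m _ (hsum' m).hasSum
  have habs : ∀ m, HasSum (fun k => ‖F m k‖)
      (r ^ (2 * m) * (∑' j, |c m j| * r ^ j) / ((n : ℝ) + m + 1 / 2)) := fun m => by
    convert! shift (fun m j => |c m j|) m _ (hsum m).hasSum using 1
    funext k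
    simp only [hF]
    split_ifs
    · rw [norm_div, norm_mul, Real.norm_eq_abs, norm_pow, Real.norm_of_nonneg h0.le,
        Real.norm_of_nonneg (by positivity : 0 ≤ (n : ℝ) + m + 1 / 2)]
    · simp
  have hr2 : r ^ 2 < 1 := by nlinarith
  have hF2 : Summable fun p : ℕ × ℕ => F p.1 p.2 := by
    refine Summable.of_norm ?_
    rw [summable_prod_of_nonneg (fun _ => norm_nonneg _)]
    refine ⟨fun m => (habs m).summable, ?_⟩
    have : Summable fun m : ℕ => (r ^ 2) ^ m * (V * 2) :=
      (summable_geometric_of_lt_one (by positivity) hr2).mul_right _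
    refine Summable.of_nonneg_of_le (fun m => tsum_nonneg fun _ => norm_nonneg _) (fun m => ?_) this
    rw [(habs m).tsum_eq, ← pow_mul, mul_div_assoc]
    gcongr
    have hV0 : 0 ≤ V := by simpa using hV 0 0
    rw [div_eq_mul_inv]
    have : ((n : ℝ) + m + 1 / 2)⁻¹ ≤ 2 := by
      rw [inv_le_comm₀ (by positivity) (by positivity)]
      have : (0 : ℝ) ≤ (n : ℝ) + m := by positivity
      linarith
    gcongr
    exact htsum m
  have hS : HasSum (fun p : ℕ × ℕ => F p.2 p.1) (∑' m, ∑' k, F m k) := by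
    rw [← hF2.tsum_prod]
    exact ((Equiv.prodComm ℕ ℕ).hasSum_iff (f := fun p : ℕ × ℕ => F p.1 p.2)).2 hF2.hasSum
  have hcol : ∀ k, HasSum (fun m => F m k) ((∑ m ∈ Finset.range (k / 2 + 1),
      c m (k - 2 * m) / ((n : ℝ) + m + 1 / 2)) * r ^ k) := by
    intro k
    have e : (∑ m ∈ Finset.range (k / 2 + 1),
      c m (k - 2 * m) / ((n : ℝ) + m + 1 / 2)) * r ^ k =
      ∑ m ∈ Finset.range (k / 2 + 1), F m k := by
      rw [Finset.sum_mul]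
      refine Finset.sum_congr rfl fun m hm => ?_
      have := Finset.mem_range.1 hm
      simp only [hF]
      rw [if_pos (by omega)]
      ring
    rw [e]
    refine hasSum_sum_of_ne_finset_zero fun m hm => ?_
    rw [Finset.mem_range] at hm
    simp only [hF]
    rw [if_neg (by omega)]
  have := hS.prod_fiberwise hcol
  convert this using 1
  exact tsum_congr fun m => (hrow m).tsum_eq.symm


/-! ### The infinite systems: the solution, its uniqueness and nonvanishing sums. -/

section Coefficients

variable {a b : Fin 2 → ℕ → ℕ → ℝ} {lam : ℝ}

lemma Recurrences.exists_bound_tsum (h : Recurrences a b) (h0 : 0 < lam) (h1 : lam < 1) :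
    ∃ V : ℝ, 0 ≤ V ∧ ∀ l n,
      (Summable fun k => a l n k * lam ^ k) ∧ (Summable fun k => b l n k * lam ^ k) ∧
      |∑' k, a l n k * lam ^ k| ≤ V ∧ |∑' k, b l n k * lam ^ k| ≤ V := by
  obtain ⟨V, hV⟩ := h.exists_bound h0 h1
  have key : ∀ c : ℕ → ℝ, (∀ K, ∑ k ∈ Finset.range K, |c k| * lam ^ k ≤ V) →
      (Summable fun k => c k * lam ^ k) ∧ |∑' k, c k * lam ^ k| ≤ V := by
    intro c hc
    have e : ∀ k, ‖c k * lam ^ k‖ = |c k| * lam ^ k := fun k => by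
      rw [norm_mul, Real.norm_eq_abs, norm_pow, Real.norm_of_nonneg h0.le]
    have hs : Summable fun k => ‖c k * lam ^ k‖ := by
      simp only [e]
      exact summable_of_sum_range_le (fun j => by positivity) hc
    refine ⟨hs.of_norm, ?_⟩
    refine (norm_tsum_le_tsum_norm hs).trans (hs.tsum_le_of_sum_range_le fun K => ?_)
    simp only [e]
    exact hc K
  refine ⟨V, by simpa using (hV 0 0 0).1, fun l n => ?_⟩
  have ha := key (a l n) fun K => (hV l n K).1
  have hb := key (b l n) fun K => (hV l n K).2
  exact ⟨ha.1, hb.1, ha.2, hb.2⟩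

/-- Summation of the recurrence against λᵏ turns the shift of the order by 2m into the factor
λ^{2m}. The result is the equation for A divided by λ^{2n+1}. -/
lemma Recurrences.tsum_a (h : Recurrences a b) (h0 : 0 < lam) (h1 : lam < 1) (l : Fin 2)
    (n : ℕ) : ∑' k, a l n k * lam ^ k =
      1 / Real.pi * ((∑' m : ℕ, lam ^ (2 * m) * (∑' k, b l m k * lam ^ k) /
        ((n : ℝ) + m + 1 / 2)) + if l = 1 then 2 else 0) := by
  obtain ⟨V, hV⟩ := h.exists_bound h0 h1
  have hs := hasSum_shifted_convolution h0 h1 (c := b l) (fun m K => (hV l m K).2) n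
  have h2 : HasSum (fun k => if k = 0 then (if l = 1 then 2 / Real.pi else 0) else 0)
      (if l = 1 then 2 / Real.pi else 0) := hasSum_ite_eq 0 _
  refine HasSum.tsum_eq ?_
  convert! (hs.mul_left (1 / Real.pi)).add h2 using 1
  · funext k
    rw [h.a_eq, add_mul, mul_assoc]
    congr 1
    split_ifs with hk hl
    · simp [hk]
    · simp
    · simp
  · rw [mul_add]
    congr 1
    split_ifs <;> ring

lemma Recurrences.tsum_b (h : Recurrences a b) (h0 : 0 < lam) (h1 : lam < 1) (l : Fin 2)
    (n : ℕ) : ∑' k, b l n k * lam ^ k =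
      1 / Real.pi * (lam * (∑' m : ℕ, lam ^ (2 * m) * (∑' k, a l m k * lam ^ k) /
        ((n : ℝ) + m + 1 / 2)) - if l = 0 then 2 else 0) := by
  obtain ⟨V, hV⟩ := h.exists_bound h0 h1
  obtain ⟨W, -, hW⟩ := h.exists_bound_tsum h0 h1
  have hs := hasSum_shifted_convolution h0 h1 (c := a l) (fun m K => (hV l m K).1) n
  rw [(hW l n).2.1.tsum_eq_zero_add]
  have e : ∀ k, b l n (k + 1) * lam ^ (k + 1) = lam / Real.pi *
      ((∑ m ∈ Finset.range (k / 2 + 1), a l m (k - 2 * m) / ((n : ℝ) + m + 1 / 2)) * lam ^ k) := by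
    intro k
    rw [h.b_succ, pow_succ]
    ring
  rw [tsum_congr e, (hs.mul_left (lam / Real.pi)).tsum_eq, h.b_zero]
  split_ifs <;> ring

lemma solvesSystem_coef (h : Recurrences a b) (h0 : 0 < lam) (h1 : lam < 1) :
    SolvesSystem lam (coefA lam a) (coefB lam b) := by
  obtain ⟨V, hV0, hV⟩ := h.exists_bound_tsum h0 h1
  have hr2 : lam ^ 2 < 1 := by nlinarith
  have hden : ∀ n m : ℕ, ((n : ℂ) + m + 1 / 2) = (((n : ℝ) + m + 1 / 2 : ℝ) : ℂ) := by
    intro n m; push_cast; ring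
  have hsum : ∀ (c : ℕ → ℝ) (n : ℕ), (∀ m, |c m| ≤ V * (lam ^ 2) ^ m) →
      Summable fun m : ℕ => c m / ((n : ℝ) + m + 1 / 2) := by
    intro c n hc
    refine Summable.of_norm_bounded (g := fun m => V * (lam ^ 2) ^ m * 2)
      (((summable_geometric_of_lt_one (by positivity) hr2).mul_left V).mul_right 2) fun m => ?_
    rw [norm_div, Real.norm_eq_abs, div_eq_mul_inv, ← norm_inv]
    gcongr
    · exact hc m
    · rw [Real.norm_of_nonneg (by positivity), inv_le_comm₀ (by positivity) (by positivity)]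
      have : (0 : ℝ) ≤ (n : ℝ) + m := by positivity
      linarith
  have hA : ∀ l m, |lam ^ (2 * m + 1) * ∑' k, a l m k * lam ^ k| ≤ V * (lam ^ 2) ^ m := by
    intro l m
    rw [abs_mul, abs_of_pos (by positivity), mul_comm, ← pow_mul]
    gcongr ?_ * ?_
    · exact (hV l m).2.2.1
    · exact pow_le_pow_of_le_one h0.le h1.le (Nat.le_succ _)
  have hB : ∀ l m, |lam ^ (2 * m) * ∑' k, b l m k * lam ^ k| ≤ V * (lam ^ 2) ^ m := by
    intro l m
    rw [abs_mul, abs_of_pos (by positivity), mul_comm, ← pow_mul]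
    gcongr ?_ * ?_
    exact (hV l m).2.2.2
  refine ⟨fun l n => ?_, fun l n => ?_, fun l n => ?_, fun l n => ?_⟩
  · have := (Complex.hasSum_ofReal.2 (hsum _ n (hA l)).hasSum).summable
    simpa only [coefA, hden, Complex.ofReal_div] using this
  · have := (Complex.hasSum_ofReal.2 (hsum _ n (hB l)).hasSum).summable
    simpa only [coefB, hden, Complex.ofReal_div] using this
  · simp only [coefA, coefB, hden, ← Complex.ofReal_div, ← Complex.ofReal_tsum]
    rw [h.tsum_a h0 h1, kron]
    push_cast
    split_ifs
    · push_cast; ring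
    · push_cast; ring
  · simp only [coefA, coefB, hden, ← Complex.ofReal_div, ← Complex.ofReal_tsum]
    rw [h.tsum_b h0 h1, kron]
    have : ∑' m : ℕ, lam ^ (2 * m + 1) * (∑' k, a l m k * lam ^ k) / ((n : ℝ) + m + 1 / 2) =
      lam * ∑' m : ℕ, lam ^ (2 * m) * (∑' k, a l m k * lam ^ k) / ((n : ℝ) + m + 1 / 2) := by
      rw [← tsum_mul_left]
      exact tsum_congr fun m => by ring
    rw [this]
    push_cast
    split_ifs
    · push_cast; ring
    · push_cast; ring

/-- Every solution of the system decays geometrically. -/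
lemma SolvesSystem.exists_bound {A B : Fin 2 → ℕ → ℂ} (h : SolvesSystem lam A B) (h0 : 0 < lam)
    (h1 : lam < 1) : ∃ C : ℝ, 0 ≤ C ∧ ∀ l n, ‖A l n‖ ≤ C * (lam ^ 2) ^ n ∧
      ‖B l n‖ ≤ C * (lam ^ 2) ^ n := by
  have hp := Real.pi_pos
  have key : ∀ c : ℕ → ℂ, (∀ n : ℕ, Summable fun m : ℕ => c m / ((n : ℂ) + m + 1 / 2)) →
      ∃ S : ℝ, ∀ n : ℕ, ‖∑' m : ℕ, c m / ((n : ℂ) + m + 1 / 2)‖ ≤ S := by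
    intro c hc
    -- The denominators grow with n, so the absolute sum for n = 0 dominates all the others. The
    -- prefactor λ^{2n} in the equations then gives the decay.
    refine ⟨∑' m : ℕ, ‖c m / (((0 : ℕ) : ℂ) + m + 1 / 2)‖, fun n => ?_⟩
    refine (norm_tsum_le_tsum_norm (hc n).norm).trans ?_
    refine (hc n).norm.tsum_le_tsum (fun m => ?_) (hc 0).norm
    have hd : ∀ n : ℕ, ‖(n : ℂ) + m + 1 / 2‖ = (n : ℝ) + m + 1 / 2 := by
      intro n
      rw [show (n : ℂ) + m + 1 / 2 = (((n : ℝ) + m + 1 / 2 : ℝ) : ℂ) by push_cast; ring,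
        Complex.norm_real, Real.norm_of_nonneg (by positivity)]
    rw [norm_div, norm_div, hd, hd]
    gcongr
    simp
  choose SA hSA using fun l => key (A l) (h.summable_A l)
  choose SB hSB using fun l => key (B l) (h.summable_B l)
  have hSA0 : ∀ l, 0 ≤ SA l := fun l => (norm_nonneg _).trans (hSA l 0)
  have hSB0 : ∀ l, 0 ≤ SB l := fun l => (norm_nonneg _).trans (hSB l 0)
  have hk : ∀ l k, ‖2 * kron l k‖ ≤ 2 := by
    intro l k; unfold kron; split_ifs <;> simp
  refine ⟨1 / Real.pi * (∑ l, (SA l + SB l) + 2), ?_, fun l n => ?_⟩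
  · have := Finset.sum_nonneg fun l (_ : l ∈ Finset.univ) => add_nonneg (hSA0 l) (hSB0 l)
    positivity
  have hle : SA l + SB l ≤ ∑ l, (SA l + SB l) :=
    Finset.single_le_sum (f := fun l => SA l + SB l)
      (fun l _ => add_nonneg (hSA0 l) (hSB0 l)) (Finset.mem_univ l)
  have hn : ∀ k : ℕ, ‖(lam : ℂ) ^ k / Real.pi‖ = lam ^ k * (1 / Real.pi) := by
    intro k
    rw [norm_div, norm_pow, Complex.norm_real, Complex.norm_real, Real.norm_of_nonneg h0.le,
      Real.norm_of_nonneg hp.le]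
    ring
  constructor
  · rw [h.eq_A l n, norm_mul, hn, ← pow_mul]
    have h2 := (norm_add_le (∑' m : ℕ, B l m / ((n : ℂ) + m + 1 / 2)) (2 * kron l 1)).trans
      (add_le_add (hSB l n) (hk l 1))
    have h3 : lam ^ (2 * n + 1) ≤ lam ^ (2 * n) :=
      pow_le_pow_of_le_one h0.le h1.le (Nat.le_succ _)
    calc _ ≤ lam ^ (2 * n) * (1 / Real.pi) * (SB l + 2) := by gcongr
      _ ≤ lam ^ (2 * n) * (1 / Real.pi) * (∑ l, (SA l + SB l) + 2) := by
        gcongr; linarith [hSA0 l]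
      _ = _ := by ring
  · rw [h.eq_B l n, norm_mul, hn, ← pow_mul]
    have h2 := (norm_sub_le (∑' m : ℕ, A l m / ((n : ℂ) + m + 1 / 2)) (2 * kron l 0)).trans
      (add_le_add (hSA l n) (hk l 0))
    calc _ ≤ lam ^ (2 * n) * (1 / Real.pi) * (SA l + 2) := by gcongr
      _ ≤ lam ^ (2 * n) * (1 / Real.pi) * (∑ l, (SA l + SB l) + 2) := by
        gcongr; linarith [hSB0 l]
      _ = _ := by ring

/-- One step of the contraction argument for the homogeneous system. -/
lemma norm_tsum_div_le {r : ℝ} {v : ℕ → ℝ} {V M : ℝ} (hv1 : ∀ n, 1 ≤ v n) (hvV : ∀ n, v n ≤ V)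
    (hv : ∀ n N : ℕ, 1 + 1 / Real.pi * ∑ m ∈ Finset.range N, r ^ (2 * m) * v m /
      ((n : ℝ) + m + 1 / 2) ≤ v n) {c : ℕ → ℂ} (hM : 0 ≤ M)
    (hc : ∀ m, ‖c m‖ ≤ M * r ^ (2 * m) * v m) (n : ℕ) :
    ‖1 / (Real.pi : ℂ) * ∑' m : ℕ, c m / ((n : ℂ) + m + 1 / 2)‖ ≤ M * (1 - 1 / V) * v n := by
  have hp := Real.pi_pos
  have hd : ∀ m : ℕ, ‖(n : ℂ) + m + 1 / 2‖ = (n : ℝ) + m + 1 / 2 := by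
    intro m
    rw [show (n : ℂ) + m + 1 / 2 = (((n : ℝ) + m + 1 / 2 : ℝ) : ℂ) by push_cast; ring,
      Complex.norm_real, Real.norm_of_nonneg (by positivity)]
  have hfin : ∀ N, ∑ m ∈ Finset.range N, ‖c m / ((n : ℂ) + m + 1 / 2)‖ ≤
      Real.pi * (M * (v n - 1)) := by
    intro N
    calc _ ≤ ∑ m ∈ Finset.range N, M * (r ^ (2 * m) * v m / ((n : ℝ) + m + 1 / 2)) := by
          refine Finset.sum_le_sum fun m _ => ?_
          rw [norm_div, hd, ← mul_div_assoc, ← mul_assoc]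
          gcongr
          exact hc m
      _ = Real.pi * (M * (1 / Real.pi * ∑ m ∈ Finset.range N, r ^ (2 * m) * v m /
            ((n : ℝ) + m + 1 / 2))) := by
          have e : ∀ S, Real.pi * (M * (1 / Real.pi * S)) = M * S := fun S => by field_simp
          rw [← Finset.mul_sum, e]
      _ ≤ _ := by
          gcongr
          linarith [hv n N]
  have hs : Summable fun m : ℕ => ‖c m / ((n : ℂ) + m + 1 / 2)‖ :=
    summable_of_sum_range_le (fun _ => norm_nonneg _) hfin
  rw [norm_mul, norm_div, norm_one, Complex.norm_real, Real.norm_of_nonneg hp.le]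
  have h1 := (norm_tsum_le_tsum_norm hs).trans (hs.tsum_le_of_sum_range_le hfin)
  have hVpos : 0 < V := by linarith [hv1 0, hvV 0]
  -- Since v ≤ V, the loss of 1 in the supersolution inequality is a proportional loss: v - 1 ≤ (1 -
  -- 1/V) v.
  have h2 : v n / V ≤ 1 := (div_le_one hVpos).2 (hvV n)
  calc _ ≤ 1 / Real.pi * (Real.pi * (M * (v n - 1))) := by gcongr
    _ = M * (v n - 1) := by field_simp
    _ ≤ M * (v n - v n / V) := by gcongr
    _ = _ := by ring

lemma SolvesSystem.unique {A B A' B' : Fin 2 → ℕ → ℂ} (h : SolvesSystem lam A B)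
    (h' : SolvesSystem lam A' B') (h0 : 0 < lam) (h1 : lam < 1) : A' = A ∧ B' = B := by
  obtain ⟨v, V, hv1, hvV, hv⟩ := exists_supersolution h0 h1
  obtain ⟨C, hC0, hC⟩ := h.exists_bound h0 h1
  obtain ⟨C', hC0', hC'⟩ := h'.exists_bound h0 h1
  have hVpos : 0 < V := by linarith [hv1 0, hvV 0]
  have hV1 : 1 ≤ V := (hv1 0).trans (hvV 0)
  have hq0 : 0 ≤ 1 - 1 / V := by
    have := (div_le_one hVpos).2 hV1
    linarith
  have hq1 : 1 - 1 / V < 1 := by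
    have : 0 < 1 / V := by positivity
    linarith
  -- The difference solves the homogeneous system, and each pass gains the factor 1 - 1/V in the
  -- norm weighted by λ^{2n} v n. The start k = 0 is the a priori geometric decay.
  have key : ∀ k l n, ‖A' l n - A l n‖ ≤ (C + C') * (1 - 1 / V) ^ k * lam ^ (2 * n) * v n ∧
      ‖B' l n - B l n‖ ≤ (C + C') * (1 - 1 / V) ^ k * lam ^ (2 * n) * v n := by
    intro k
    induction k with
    | zero =>
      intro l n
      have hx : (C' + C) * (lam ^ 2) ^ n ≤
          (C + C') * (1 - 1 / V) ^ 0 * lam ^ (2 * n) * v n := by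
        rw [← pow_mul, pow_zero, mul_one, add_comm C' C]
        exact le_mul_of_one_le_right (by positivity) (hv1 n)
      refine ⟨(norm_sub_le _ _).trans (le_trans ?_ hx), (norm_sub_le _ _).trans (le_trans ?_ hx)⟩
      · rw [add_mul]; exact add_le_add (hC' l n).1 (hC l n).1
      · rw [add_mul]; exact add_le_add (hC' l n).2 (hC l n).2
    | succ k ih =>
      intro l n
      have hn : ∀ k : ℕ, ‖(lam : ℂ) ^ k‖ = lam ^ k := fun k => by
        rw [norm_pow, Complex.norm_real, Real.norm_of_nonneg h0.le]
      have eA : A' l n - A l n = (lam : ℂ) ^ (2 * n + 1) *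
          (1 / Real.pi * ∑' m : ℕ, (B' l m - B l m) / ((n : ℂ) + m + 1 / 2)) := by
        simp only [sub_div]
        rw [(h'.summable_B l n).tsum_sub (h.summable_B l n), h.eq_A, h'.eq_A]
        ring
      have eB : B' l n - B l n = (lam : ℂ) ^ (2 * n) *
          (1 / Real.pi * ∑' m : ℕ, (A' l m - A l m) / ((n : ℂ) + m + 1 / 2)) := by
        simp only [sub_div]
        rw [(h'.summable_A l n).tsum_sub (h.summable_A l n), h.eq_B, h'.eq_B]
        ring
      have hM : 0 ≤ (C + C') * (1 - 1 / V) ^ k := by positivity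
      have bA := norm_tsum_div_le hv1 hvV hv hM (fun m => (ih l m).1) n
      have bB := norm_tsum_div_le hv1 hvV hv hM (fun m => (ih l m).2) n
      have hvn : 0 ≤ v n := by linarith [hv1 n]
      have h3 : lam ^ (2 * n + 1) ≤ lam ^ (2 * n) :=
        pow_le_pow_of_le_one h0.le h1.le (Nat.le_succ _)
      constructor
      · rw [eA, norm_mul, hn]
        calc _ ≤ lam ^ (2 * n) * ((C + C') * (1 - 1 / V) ^ k * (1 - 1 / V) * v n) := by gcongr
          _ = _ := by ring
      · rw [eB, norm_mul, hn]
        calc _ ≤ lam ^ (2 * n) * ((C + C') * (1 - 1 / V) ^ k * (1 - 1 / V) * v n) := by gcongr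
          _ = _ := by ring
  have hlim : ∀ n, Tendsto (fun k : ℕ => (C + C') * (1 - 1 / V) ^ k * lam ^ (2 * n) * v n)
      atTop (𝓝 0) := by
    intro n
    have := (((tendsto_pow_atTop_nhds_zero_of_lt_one hq0 hq1).const_mul (C + C')).mul_const
      (lam ^ (2 * n))).mul_const (v n)
    simpa using this
  have hz : ∀ (z : ℂ) n, (∀ k, ‖z‖ ≤ (C + C') * (1 - 1 / V) ^ k * lam ^ (2 * n) * v n) →
      z = 0 := fun z n hk => norm_le_zero_iff.1 (ge_of_tendsto' (hlim n) hk)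
  constructor
  · ext l n
    exact sub_eq_zero.1 (hz _ n fun k => (key k l n).1)
  · ext l n
    exact sub_eq_zero.1 (hz _ n fun k => (key k l n).2)

/-- All terms of this column are nonnegative, and the leading one is positive because a 1 0 0 = 2/π.
The sum of B in the column 0 is treated likewise, with terms of the opposite sign and b 0 0 0 =
-2/π. -/
lemma tsum_coefA_ne_zero (h : Recurrences a b) (h0 : 0 < lam) (h1 : lam < 1) :
    ∑' m, coefA lam a 1 m ≠ 0 := by
  obtain ⟨C, hC0, hC⟩ := (solvesSystem_coef h h0 h1).exists_bound h0 h1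
  obtain ⟨V, hV0, hV⟩ := h.exists_bound_tsum h0 h1
  have hr2 : lam ^ 2 < 1 := by nlinarith
  have hs : Summable (coefA lam a 1) := Summable.of_norm_bounded
    ((summable_geometric_of_lt_one (by positivity) hr2).mul_left C) fun m => (hC 1 m).1
  simp only [coefA] at hs ⊢
  rw [← Complex.ofReal_tsum, Complex.ofReal_ne_zero]
  have hnn : ∀ n k, 0 ≤ a 1 n k * lam ^ k := fun n k => by
    have := (h.sign 1 n k).1
    simp at this
    positivity
  refine ne_of_gt ((Complex.summable_ofReal.1 hs).tsum_pos (fun m =>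
    mul_nonneg (by positivity) (tsum_nonneg (hnn m))) 0 (mul_pos (by positivity) ?_))
  refine (hV 1 0).1.tsum_pos (hnn 0) 0 ?_
  rw [h.a_zero, h.b_zero]
  simp
  positivity

lemma tsum_coefB_ne_zero (h : Recurrences a b) (h0 : 0 < lam) (h1 : lam < 1) :
    ∑' m, coefB lam b 0 m ≠ 0 := by
  obtain ⟨C, hC0, hC⟩ := (solvesSystem_coef h h0 h1).exists_bound h0 h1
  obtain ⟨V, hV0, hV⟩ := h.exists_bound_tsum h0 h1
  have hr2 : lam ^ 2 < 1 := by nlinarith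
  have hs : Summable (coefB lam b 0) := Summable.of_norm_bounded
    ((summable_geometric_of_lt_one (by positivity) hr2).mul_left C) fun m => (hC 0 m).2
  simp only [coefB] at hs ⊢
  rw [← Complex.ofReal_tsum, Complex.ofReal_ne_zero, ← neg_ne_zero, ← tsum_neg]
  have hnn : ∀ n k, 0 ≤ -(b 0 n k * lam ^ k) := fun n k => by
    have := (h.sign 0 n k).2
    simp at this
    rw [← neg_mul]
    exact mul_nonneg (by linarith) (by positivity)
  have e : ∀ m, -(lam ^ (2 * m) * ∑' k, b 0 m k * lam ^ k) =
      lam ^ (2 * m) * ∑' k, -(b 0 m k * lam ^ k) := fun m => by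
    rw [tsum_neg]; ring
  have hs' := (Complex.summable_ofReal.1 hs).neg
  simp only [e] at hs' ⊢
  refine ne_of_gt (hs'.tsum_pos (fun m =>
    mul_nonneg (by positivity) (tsum_nonneg (hnn m))) 0 (mul_pos (by positivity) ?_))
  refine (hV 0 0).2.1.neg.tsum_pos (hnn 0) 0 ?_
  rw [h.b_zero]
  simp
  positivity

end Coefficients


/-! ### Series of simple fractions. -/

/-- The sum of a series of simple fractions with poles at `0, -2, -4, …`. -/
def poleSeries (c : ℕ → ℂ) (s : ℂ) : ℂ := ∑' m : ℕ, c m / (s + 2 * m)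

/-- The points at distance at least `δ` from `0, -2, -4, …`. -/
def awayFromPoles (δ : ℝ) : Set ℂ := {s | ∀ m : ℕ, δ ≤ ‖s + 2 * m‖}

lemma one_le_norm_of_ne {s : ℂ} {m n : ℕ} (hn : ‖s + 2 * n‖ < 1) (h : m ≠ n) :
    1 ≤ ‖s + 2 * m‖ := by
  obtain ⟨d, hd⟩ : ∃ d : ℤ, d = (m : ℤ) - n := ⟨_, rfl⟩
  have h1 : (1 : ℝ) ≤ |(d : ℝ)| := by
    exact_mod_cast Int.one_le_abs (show d ≠ 0 by omega)
  have h2 : ‖(2 * d : ℂ)‖ = 2 * |(d : ℝ)| := by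
    rw [norm_mul, Complex.norm_intCast]
    simp
  have h3 : (2 * d : ℂ) = (s + 2 * m) - (s + 2 * n) := by
    rw [hd]; push_cast; ring
  have h4 := norm_sub_le (s + 2 * m) (s + 2 * n)
  rw [← h3, h2] at h4
  linarith

/-- The poles different from `s` stay away from `s`. -/
lemma exists_pole_dist (s : ℂ) : ∃ δ : ℝ, 0 < δ ∧ ∀ m : ℕ, s + 2 * m ≠ 0 → δ ≤ ‖s + 2 * m‖ := by
  by_cases h : ∃ n : ℕ, s + 2 * n ≠ 0 ∧ ‖s + 2 * n‖ < 1
  · obtain ⟨n, hn0, hn1⟩ := h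
    refine ⟨‖s + 2 * n‖, norm_pos_iff.2 hn0, fun m hm => ?_⟩
    rcases eq_or_ne m n with rfl | hmn
    · rfl
    · exact hn1.le.trans (one_le_norm_of_ne hn1 hmn)
  · push Not at h
    exact ⟨1, one_pos, h⟩

section PoleSeries

variable {c : ℕ → ℂ}

/-- No condition on s is needed: division by zero makes the term at a pole zero, and the other
denominators stay away from zero. -/
lemma summable_poleSeries (hc : Summable fun m => ‖c m‖) (s : ℂ) :
    Summable fun m : ℕ => c m / (s + 2 * m) := by
  obtain ⟨δ, hδ, h⟩ := exists_pole_dist s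
  refine Summable.of_norm_bounded (hc.mul_right δ⁻¹) fun m => ?_
  rw [norm_div, div_eq_mul_inv]
  by_cases hm : s + 2 * m = 0
  · rw [hm]; simp; positivity
  · gcongr
    exact h m hm

lemma norm_poleSeries_le (hc : Summable fun m => ‖c m‖) {δ : ℝ} (hδ : 0 < δ) {s : ℂ}
    (hs : s ∈ awayFromPoles δ) : ‖poleSeries c s‖ ≤ (∑' m, ‖c m‖) / δ := by
  have hb : ∀ m : ℕ, ‖c m / (s + 2 * m)‖ ≤ ‖c m‖ * δ⁻¹ := fun m => by
    rw [norm_div, div_eq_mul_inv]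
    gcongr
    exact hs m
  rw [div_eq_mul_inv, ← tsum_mul_right]
  exact tsum_of_norm_bounded (hc.mul_right δ⁻¹).hasSum hb

/-- A pole with vanishing coefficient is admitted so that the statement applies at -2n once the n-th
coefficient is replaced by zero. -/
lemma analyticAt_poleSeries (hc : Summable fun m => ‖c m‖) {s : ℂ}
    (h0 : ∀ m : ℕ, s + 2 * m = 0 → c m = 0) : AnalyticAt ℂ (poleSeries c) s := by
  obtain ⟨δ, hδ, h⟩ := exists_pole_dist s
  have hδ2 : 0 < δ / 2 := by positivity
  have hb : ∀ m : ℕ, ∀ z ∈ Metric.ball s (δ / 2), s + 2 * m ≠ 0 → δ / 2 ≤ ‖z + 2 * m‖ := by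
    intro m z hz hm
    have h1 := h m hm
    have h2 : ‖s + 2 * m‖ ≤ ‖z + 2 * m‖ + ‖z - s‖ := by
      have := norm_sub_le (z + 2 * m) (z - s)
      rwa [show z + 2 * m - (z - s) = s + 2 * m by ring] at this
    have h3 := mem_ball_iff_norm.1 hz
    linarith
  have hd : DifferentiableOn ℂ (poleSeries c) (Metric.ball s (δ / 2)) := by
    refine differentiableOn_tsum_of_summable_norm (hc.mul_right (δ / 2)⁻¹) (fun m => ?_)
      Metric.isOpen_ball fun m z hz => ?_
    · by_cases hm : s + 2 * m = 0
      · simp [h0 m hm]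
      · refine DifferentiableOn.div (by fun_prop) (by fun_prop) fun z hz h5 => ?_
        have := hb m z hz hm
        rw [h5, norm_zero] at this
        linarith
    · by_cases hm : s + 2 * m = 0
      · simp [h0 m hm]
      · rw [norm_div, div_eq_mul_inv]
        gcongr
        exact hb m z hz hm
  exact hd.analyticAt (Metric.ball_mem_nhds s hδ2)

lemma summable_norm_update (hc : Summable fun m => ‖c m‖) (n : ℕ) :
    Summable fun m => ‖Function.update c n 0 m‖ := by
  refine Summable.of_nonneg_of_le (fun _ => norm_nonneg _) (fun m => ?_) hc
  rcases eq_or_ne m n with rfl | h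
  · simp
  · simp [h]

lemma poleSeries_eq_add (hc : Summable fun m => ‖c m‖) (n : ℕ) (s : ℂ) :
    poleSeries c s = c n / (s + 2 * n) + poleSeries (Function.update c n 0) s := by
  unfold poleSeries
  rw [(summable_poleSeries hc s).tsum_eq_add_tsum_ite n]
  congr 1
  refine tsum_congr fun m => ?_
  rcases eq_or_ne m n with rfl | h
  · simp
  · simp [h]

lemma analyticAt_poleSeries_update (hc : Summable fun m => ‖c m‖) (n : ℕ) :
    AnalyticAt ℂ (poleSeries (Function.update c n 0)) (-(2 * n)) := by
  refine analyticAt_poleSeries (summable_norm_update hc n) fun m hm => ?_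
  have : (m : ℂ) = n := by linear_combination hm / 2
  have : m = n := by exact_mod_cast this
  simp [this]

lemma meromorphicAt_poleSeries (hc : Summable fun m => ‖c m‖) (s : ℂ) :
    MeromorphicAt (poleSeries c) s := by
  by_cases h : ∃ n : ℕ, s = -(2 * n)
  · obtain ⟨n, rfl⟩ := h
    rw [show poleSeries c = fun s => c n / (s + 2 * n) + poleSeries (Function.update c n 0) s from
      funext (poleSeries_eq_add hc n)]
    refine MeromorphicAt.add ?_ (analyticAt_poleSeries_update hc n).meromorphicAt
    exact (MeromorphicAt.const _ _).div
      (AnalyticAt.meromorphicAt (by fun_prop))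
  · push Not at h
    exact (analyticAt_poleSeries hc fun m hm => absurd (eq_neg_of_add_eq_zero_left hm)
      (h m)).meromorphicAt

/-- Dominated convergence: each s c_m / (s + 2m) tends to c_m. Off the discs |s| ≤ |s + 2m| + 2m is
at most a constant times (m + 1) |s + 2m|, which is where the weight m + 1 is used. -/
lemma tendsto_mul_poleSeries (hc : Summable fun m => ‖c m‖ * ((m : ℝ) + 1)) {δ : ℝ} (hδ : 0 < δ) :
    Tendsto (fun s => s * poleSeries c s) (atInftyIn (awayFromPoles δ)) (𝓝 (∑' m, c m)) := by
  have e : (fun s => s * poleSeries c s) = fun s => ∑' m : ℕ, s * (c m / (s + 2 * m)) := by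
    funext s
    rw [poleSeries, tsum_mul_left]
  rw [e]
  refine tendsto_tsum_of_dominated_convergence
    (bound := fun m => ‖c m‖ * ((m : ℝ) + 1) * (1 + 2 / δ)) (hc.mul_right _) (fun m => ?_) ?_
  · have h1 : Tendsto (fun s : ℂ => (s + 2 * m)⁻¹) (atInftyIn (awayFromPoles δ)) (𝓝 0) := by
      refine tendsto_inv₀_cobounded.comp ?_
      have : Tendsto (fun s : ℂ => s + 2 * m) (Bornology.cobounded ℂ) (Bornology.cobounded ℂ) := by
        rw [← tendsto_norm_atTop_iff_cobounded]
        refine tendsto_atTop_mono (fun s => ?_)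
          (tendsto_atTop_add_const_right _ (-‖(2 * m : ℂ)‖) tendsto_norm_cobounded_atTop)
        have := norm_sub_le (s + 2 * m) (2 * m)
        rw [add_sub_cancel_right] at this
        linarith
      exact this.mono_left inf_le_left
    have h2 : Tendsto (fun s : ℂ => c m - c m * (2 * m) * (s + 2 * m)⁻¹)
        (atInftyIn (awayFromPoles δ)) (𝓝 (c m)) := by
      simpa using (h1.const_mul (c m * (2 * m))).const_sub (c m)
    refine h2.congr' ?_
    filter_upwards [mem_inf_of_right (mem_principal_self _)] with s hs
    have : s + 2 * m ≠ 0 := norm_pos_iff.1 (hδ.trans_le (hs m))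
    field_simp
    ring
  · filter_upwards [mem_inf_of_right (mem_principal_self _)] with s hs m
    have h1 := hs m
    have hpos : 0 < ‖s + 2 * m‖ := hδ.trans_le h1
    have h2 : ‖s‖ ≤ ‖s + 2 * m‖ + 2 * m := by
      have := norm_sub_le (s + 2 * m) (2 * m)
      rw [add_sub_cancel_right] at this
      simpa using this
    rw [norm_mul, norm_div, ← mul_div_assoc, div_le_iff₀ hpos]
    have h3 : ‖s‖ ≤ ((m : ℝ) + 1) * (1 + 2 / δ) * ‖s + 2 * m‖ := by
      have h4 : 2 ≤ 2 / δ * ‖s + 2 * m‖ := by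
        rw [div_mul_eq_mul_div, le_div_iff₀ hδ]; linarith
      have hm : (0 : ℝ) ≤ m := by positivity
      nlinarith
    nlinarith [norm_nonneg (c m)]

lemma summable_norm_of_weighted (hc : Summable fun m => ‖c m‖ * ((m : ℝ) + 1)) :
    Summable fun m => ‖c m‖ :=
  Summable.of_nonneg_of_le (fun _ => norm_nonneg _) (fun m =>
    le_mul_of_one_le_right (norm_nonneg _) (by
      have : (0 : ℝ) ≤ m := by positivity
      linarith)) hc

lemma tendsto_poleSeries (hc : Summable fun m => ‖c m‖ * ((m : ℝ) + 1)) {δ : ℝ} (hδ : 0 < δ) :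
    Tendsto (poleSeries c) (atInftyIn (awayFromPoles δ)) (𝓝 0) := by
  have h1 : Tendsto (fun s : ℂ => s⁻¹) (atInftyIn (awayFromPoles δ)) (𝓝 0) :=
    tendsto_inv₀_cobounded.mono_left inf_le_left
  have h2 := h1.mul (tendsto_mul_poleSeries hc hδ)
  rw [zero_mul] at h2
  refine h2.congr' ?_
  have : ∀ᶠ s : ℂ in Bornology.cobounded ℂ, s ≠ 0 := Bornology.eventually_ne_cobounded 0
  filter_upwards [mem_inf_of_left this] with s hs
  field_simp

end PoleSeries

/-! ### Lower bounds for the sine and bounds for the cotangent. -/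

section Trig

lemma norm_sq_sin (z : ℂ) : ‖Complex.sin z‖ ^ 2 = Real.sin z.re ^ 2 + Real.sinh z.im ^ 2 := by
  conv_lhs => rw [Complex.sin_eq]
  rw [← Complex.ofReal_sin, ← Complex.ofReal_cos, ← Complex.ofReal_cosh, ← Complex.ofReal_sinh,
    ← Complex.ofReal_mul, ← Complex.ofReal_mul, Complex.sq_norm, Complex.normSq_add_mul_I]
  have h1 := Real.cosh_sq z.im
  have h2 := Real.sin_sq_add_cos_sq z.re
  linear_combination Real.sin z.re ^ 2 * h1 + Real.sinh z.im ^ 2 * h2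

lemma norm_cos_le (z : ℂ) : ‖Complex.cos z‖ ≤ 1 + ‖Complex.sin z‖ := by
  have h : Complex.cos z ^ 2 = 1 - Complex.sin z ^ 2 := by
    linear_combination Complex.sin_sq_add_cos_sq z
  have h2 : ‖Complex.cos z‖ ^ 2 ≤ 1 + ‖Complex.sin z‖ ^ 2 := by
    rw [← norm_pow, h, ← norm_pow]
    exact (norm_sub_le _ _).trans (by simp)
  nlinarith [norm_nonneg (Complex.sin z), norm_nonneg (Complex.cos z)]

/-- Jordan's inequality handles the real part, and |y| ≤ |sinh y| the imaginary part. -/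
lemma norm_le_norm_sin {z : ℂ} (hz : |z.re| ≤ Real.pi / 2) :
    2 / Real.pi * ‖z‖ ≤ ‖Complex.sin z‖ := by
  have hp := Real.pi_pos
  refine le_of_sq_le_sq ?_ (norm_nonneg _)
  rw [norm_sq_sin, mul_pow, Complex.sq_norm, Complex.normSq_apply]
  have h1 := Real.mul_abs_le_abs_sin hz
  have h2 : (2 / Real.pi * |z.re|) ^ 2 ≤ Real.sin z.re ^ 2 := by
    rw [← sq_abs (Real.sin z.re)]
    gcongr
  rw [mul_pow, sq_abs] at h2
  have h3 : z.im ^ 2 ≤ Real.sinh z.im ^ 2 := by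
    rw [sq_le_sq, Real.abs_sinh]
    exact Real.self_le_sinh_iff.2 (abs_nonneg _)
  have h4 : (2 / Real.pi) ^ 2 ≤ 1 := by
    refine pow_le_one₀ (by positivity) ?_
    rw [div_le_one hp]; linarith [Real.pi_gt_three]
  nlinarith [sq_nonneg z.im]

/-- The sine is bounded below by the distance to its zeros. -/
lemma exists_norm_sub_le_norm_sin (s : ℂ) :
    ∃ k : ℤ, ‖s - 2 * k‖ ≤ ‖Complex.sin (Real.pi * s / 2)‖ := by
  have hp := Real.pi_pos
  -- Subtracting the nearest even integer brings the argument of the sine into |Re z| ≤ π/2 and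
  -- changes the sine only by a factor of modulus 1.
  refine ⟨round (s.re / 2), ?_⟩
  set k := round (s.re / 2) with hk
  have e : Complex.sin (Real.pi * s / 2) = Complex.sin (Real.pi / 2 * (s - 2 * k)) *
      Complex.cos (k * Real.pi) := by
    rw [show (Real.pi * s / 2 : ℂ) = Real.pi / 2 * (s - 2 * k) + k * Real.pi by ring,
      Complex.sin_add, Complex.sin_int_mul_pi]
    ring
  have hc : ‖Complex.cos (k * Real.pi)‖ = 1 := by
    have h1 := Complex.sin_sq_add_cos_sq (k * Real.pi)
    rw [Complex.sin_int_mul_pi] at h1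
    have h2 : ‖Complex.cos (k * Real.pi)‖ ^ 2 = 1 := by
      rw [← norm_pow, show Complex.cos (k * Real.pi) ^ 2 = 1 by linear_combination h1, norm_one]
    nlinarith [norm_nonneg (Complex.cos (k * Real.pi))]
  rw [e, norm_mul, hc, mul_one]
  have hre : (Real.pi / 2 * (s - 2 * k) : ℂ).re = Real.pi * (s.re / 2 - k) := by
    rw [show (Real.pi / 2 * (s - 2 * k) : ℂ) = ((Real.pi / 2 : ℝ) : ℂ) * (s - 2 * k) by
      push_cast; ring, Complex.re_ofReal_mul]
    simp
    ring
  have h := norm_le_norm_sin (z := Real.pi / 2 * (s - 2 * k)) (by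
    rw [hre, abs_mul, abs_of_pos hp]
    have := abs_sub_round (s.re / 2)
    rw [← hk] at this
    nlinarith)
  rw [norm_mul, ← mul_assoc] at h
  have h1 : 2 / Real.pi * ‖(Real.pi / 2 : ℂ)‖ = 1 := by
    rw [norm_div, Complex.norm_real, Real.norm_of_nonneg hp.le]
    simp
  rwa [h1, one_mul] at h

lemma half_le_norm_sin {s : ℂ} (hre : s.re < 1) (hs : s ∈ awayFromPoles (1 / 2)) :
    1 / 2 ≤ ‖Complex.sin (Real.pi * s / 2)‖ := by
  obtain ⟨k, hk⟩ := exists_norm_sub_le_norm_sin s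
  refine le_trans ?_ hk
  rcases le_or_gt k 0 with h | h
  · obtain ⟨n, rfl⟩ := Int.eq_ofNat_of_zero_le (neg_nonneg.2 h) |>.imp fun n hn => neg_eq_iff_eq_neg.1 hn
    have := hs n
    simpa using this
  · have h1 : (1 : ℝ) ≤ k := by exact_mod_cast h
    have h2 := Complex.abs_re_le_norm (s - 2 * k)
    have h3 : (s - 2 * k).re = s.re - 2 * k := by simp
    rw [h3, abs_of_neg (by linarith)] at h2
    linarith

/-- If |sin| ≥ 1/2, then |cos| ≤ 1 + |sin| ≤ 3 |sin|. -/
lemma norm_cot_le {s : ℂ} (hre : s.re < 1) (hs : s ∈ awayFromPoles (1 / 2)) :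
    ‖Complex.cot (Real.pi * s / 2)‖ ≤ 3 := by
  have h := half_le_norm_sin hre hs
  rw [Complex.cot_eq_cos_div_sin, norm_div, div_le_iff₀ (by linarith)]
  linarith [norm_cos_le (Real.pi * s / 2)]

lemma sin_ne_zero_of_ne {s : ℂ} (hre : s.re < 1) (hs : ∀ n : ℕ, s ≠ -(2 * n)) :
    Complex.sin (Real.pi * s / 2) ≠ 0 := by
  intro h
  obtain ⟨k, hk⟩ := exists_norm_sub_le_norm_sin s
  rw [h, norm_zero, norm_le_zero_iff, sub_eq_zero] at hk
  have h1 : (k : ℝ) < 1 := by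
    have : s.re = 2 * k := by rw [hk]; simp
    have h2 : (2 * k : ℝ) < 1 := by rwa [← this]
    have h3 : (2 * k : ℤ) < 1 := by exact_mod_cast h2
    exact_mod_cast (by omega : k < 1)
  have h1' : k < 1 := by exact_mod_cast h1
  obtain ⟨n, hn⟩ := Int.eq_ofNat_of_zero_le (by omega : 0 ≤ -k)
  refine hs n ?_
  rw [hk, show k = -n by omega]
  push_cast
  ring

end Trig


/-! ### Removal of singularities by punctured limits. -/

section RemovableExtension

/-- The function with all removable singularities removed. -/
def removableExt (f : ℂ → ℂ) (s : ℂ) : ℂ := limUnder (𝓝[≠] s) f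

/-- Agreement with g near s, off s itself, determines the punctured limit at every nearby point. The
extension thus equals g on a full neighbourhood, whatever value f takes at s. -/
lemma removableExt_eventuallyEq {f g : ℂ → ℂ} {s : ℂ} (hg : AnalyticAt ℂ g s)
    (h : f =ᶠ[𝓝[≠] s] g) : removableExt f =ᶠ[𝓝 s] g := by
  have h1 : ∀ᶠ z in 𝓝 s, z ∈ ({s}ᶜ : Set ℂ) → f z = g z := eventually_nhdsWithin_iff.1 h
  have key : ∀ z, f =ᶠ[𝓝[≠] z] g → AnalyticAt ℂ g z → removableExt f z = g z := by
    intro z hz hgz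
    exact Tendsto.limUnder_eq ((hgz.continuousAt.tendsto.mono_left nhdsWithin_le_nhds).congr'
      hz.symm)
  filter_upwards [h1.eventually_nhds, hg.eventually_analyticAt] with z hz hgz
  refine key z ?_ hgz
  by_cases hzs : z = s
  · rw [hzs]; exact h
  · have : ∀ᶠ w in 𝓝 z, w ≠ s := eventually_ne_nhds hzs
    exact (hz.and this |>.mono fun w hw => hw.1 hw.2).filter_mono nhdsWithin_le_nhds

lemma analyticAt_removableExt {f g : ℂ → ℂ} {s : ℂ} (hg : AnalyticAt ℂ g s)
    (h : f =ᶠ[𝓝[≠] s] g) : AnalyticAt ℂ (removableExt f) s :=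
  hg.congr (removableExt_eventuallyEq hg h).symm

lemma removableExt_eq {f : ℂ → ℂ} {s : ℂ} (hf : AnalyticAt ℂ f s) : removableExt f s = f s :=
  (removableExt_eventuallyEq hf EventuallyEq.rfl).self_of_nhds

lemma analyticAt_dslope {f : ℂ → ℂ} {s : ℂ} (hf : AnalyticAt ℂ f s) :
    AnalyticAt ℂ (dslope f s) s := by
  obtain ⟨p, hp⟩ := hf
  exact ⟨_, hp.has_fpower_series_dslope_fslope⟩

end RemovableExtension

/-! ### The first row: cancellation of poles and behaviour at infinity. -/

/-- The common shape of the first rows of `X⁺(s)` and `X⁻(1 - s)`. -/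
def rowExpr (lam : ℝ) (p q : ℕ → ℂ) (p0 q0 s : ℂ) : ℂ :=
  1 / 2 * (poleSeries p s + p0 +
    (lam : ℂ) ^ (-s) * Complex.cot (Real.pi * s / 2) * (q0 - poleSeries q (1 - s)))

/-- The coefficients decay fast, and the poles of `rowExpr` at `0, -2, -4, …` cancel. -/
structure PolesCancel (lam : ℝ) (p q : ℕ → ℂ) (q0 : ℂ) : Prop where
  pos : 0 < lam
  lt_one : lam < 1
  summable_p : Summable fun m => ‖p m‖ * ((m : ℝ) + 1)
  summable_q : Summable fun m => ‖q m‖ * ((m : ℝ) + 1)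
  residue : ∀ n : ℕ, p n = -(2 / Real.pi * (lam : ℂ) ^ (2 * n) * (q0 - poleSeries q (1 + 2 * n)))

lemma one_sub_mem_awayFromPoles {γ : ℝ} {s : ℂ} (hs : s.re ≤ γ) :
    1 - s ∈ awayFromPoles (1 - γ) := by
  intro m
  refine le_trans ?_ (Complex.re_le_norm _)
  have hm : (0 : ℝ) ≤ m := by positivity
  simp
  linarith

section Row

variable {lam : ℝ} {p q : ℕ → ℂ} {p0 q0 : ℂ}

lemma analyticAt_poleSeries_one_sub (hq : Summable fun m => ‖q m‖) {s : ℂ} (hs : s.re < 1) :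
    AnalyticAt ℂ (fun s => poleSeries q (1 - s)) s := by
  have h : AnalyticAt ℂ (poleSeries q) (1 - s) := by
    refine analyticAt_poleSeries hq fun m hm => ?_
    have := one_sub_mem_awayFromPoles (s := s) le_rfl m
    rw [hm, norm_zero] at this
    linarith
  exact h.comp (f := fun s => 1 - s) (by fun_prop)

lemma analyticAt_sin_half (s : ℂ) : AnalyticAt ℂ (fun s => Complex.sin (Real.pi * s / 2)) s :=
  Differentiable.analyticAt (by fun_prop) s

lemma analyticAt_cpow_neg (h0 : 0 < lam) (s : ℂ) : AnalyticAt ℂ (fun s => (lam : ℂ) ^ (-s)) s := by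
  have : (lam : ℂ) ≠ 0 := by exact_mod_cast h0.ne'
  refine Differentiable.analyticAt (fun s => ?_) s
  exact DifferentiableAt.const_cpow (by fun_prop) (Or.inl this)

lemma analyticAt_cos_half (s : ℂ) : AnalyticAt ℂ (fun s => Complex.cos (Real.pi * s / 2)) s :=
  Differentiable.analyticAt (by fun_prop) s

lemma PolesCancel.analyticAt_rowExpr (h : PolesCancel lam p q q0) {s : ℂ} (hs : s.re < 1)
    (hne : ∀ n : ℕ, s ≠ -(2 * n)) : AnalyticAt ℂ (rowExpr lam p q p0 q0) s := by
  have h1 : AnalyticAt ℂ (poleSeries p) s :=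
    analyticAt_poleSeries (summable_norm_of_weighted h.summable_p)
      fun m hm => absurd (eq_neg_of_add_eq_zero_left hm) (hne m)
  have h2 := analyticAt_poleSeries_one_sub (summable_norm_of_weighted h.summable_q) hs
  have h3 : AnalyticAt ℂ (fun s : ℂ => Complex.cot (Real.pi * s / 2)) s := by
    simp only [Complex.cot_eq_cos_div_sin]
    exact (analyticAt_cos_half s).div (analyticAt_sin_half s) (sin_ne_zero_of_ne hs hne)
  exact analyticAt_const.mul ((h1.add analyticAt_const).add
    (((analyticAt_cpow_neg h.pos s).mul h3).mul (analyticAt_const.sub h2)))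

lemma PolesCancel.exists_analyticAt (h : PolesCancel lam p q q0) (n : ℕ) :
    ∃ g : ℂ → ℂ, AnalyticAt ℂ g (-(2 * n)) ∧
      rowExpr lam p q p0 q0 =ᶠ[𝓝[≠] (-(2 * n : ℂ))] g := by
  set c : ℂ := -(2 * n) with hc
  have hcre : c.re < 1 := by
    have : (0 : ℝ) ≤ n := by positivity
    simp [hc]; linarith
  set S : ℂ → ℂ := fun s => Complex.sin (Real.pi * s / 2) with hS
  set k : ℂ → ℂ := dslope S c with hk
  set H : ℂ → ℂ := fun s => q0 - poleSeries q (1 - s) with hH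
  have hSc : S c = 0 := by
    simp only [hS, hc]
    rw [show (Real.pi * -(2 * n) / 2 : ℂ) = ((-n : ℤ) : ℂ) * Real.pi by push_cast; ring]
    exact Complex.sin_int_mul_pi _
  have hcos : Complex.cos (Real.pi * c / 2) ≠ 0 := by
    intro h0
    have := Complex.sin_sq_add_cos_sq (Real.pi * c / 2)
    rw [h0, show Complex.sin (Real.pi * c / 2) = 0 from hSc] at this
    simp at this
  have hpi : (Real.pi : ℂ) ≠ 0 := by exact_mod_cast Real.pi_ne_zero
  have hkc : k c = Complex.cos (Real.pi * c / 2) * (Real.pi / 2) := by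
    rw [hk, dslope_same]
    have h1 : HasDerivAt (fun s : ℂ => (Real.pi * s / 2 : ℂ)) (Real.pi / 2) c := by
      simpa using ((hasDerivAt_id c).const_mul (Real.pi : ℂ)).div_const 2
    exact h1.csin.deriv
  have hkc0 : k c ≠ 0 := by
    rw [hkc]
    exact mul_ne_zero hcos (div_ne_zero hpi two_ne_zero)
  have hkan : AnalyticAt ℂ k c := analyticAt_dslope (analyticAt_sin_half c)
  have hHan : AnalyticAt ℂ H c := analyticAt_const.sub
    (analyticAt_poleSeries_one_sub (summable_norm_of_weighted h.summable_q) hcre)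
  -- With sin(πs/2) = (s - c) k(s) the cotangent term is M(s) / (s - c), and the residue condition
  -- says M(c) = -p n. The two polar terms therefore combine into the difference quotient `dslope M
  -- c`.
  set M : ℂ → ℂ := fun s => (lam : ℂ) ^ (-s) * Complex.cos (Real.pi * s / 2) * H s / k s with hM
  have hMan : AnalyticAt ℂ M c :=
    (((analyticAt_cpow_neg h.pos c).mul (analyticAt_cos_half c)).mul hHan).div hkan hkc0
  have hMc : M c = -p n := by
    simp only [hM, hkc, h.residue n, hH]
    have e1 : (lam : ℂ) ^ (-c) = (lam : ℂ) ^ (2 * n) := by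
      rw [hc, neg_neg, ← Complex.cpow_natCast]; push_cast; rfl
    rw [e1, show 1 - c = 1 + 2 * n by rw [hc]; ring]
    field_simp
  set g : ℂ → ℂ := fun s => 1 / 2 * (poleSeries (Function.update p n 0) s + p0 + dslope M c s)
    with hg
  refine ⟨g, analyticAt_const.mul (((analyticAt_poleSeries_update
    (summable_norm_of_weighted h.summable_p) n).add analyticAt_const).add
      (analyticAt_dslope hMan)), ?_⟩
  have hne : ∀ᶠ s in 𝓝[≠] c, s ≠ c := eventually_mem_nhdsWithin
  filter_upwards [hne, (hkan.continuousAt.eventually_ne hkc0).filter_mono nhdsWithin_le_nhds]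
    with s hs hks
  have hsc : s - c ≠ 0 := sub_ne_zero.2 hs
  have e1 : (s - c) * k s = Complex.sin (Real.pi * s / 2) := by
    have := sub_smul_dslope S c s
    rwa [smul_eq_mul, hSc, sub_zero] at this
  have e2 : (s - c) * dslope M c s = M s + p n := by
    rw [← sub_neg_eq_add, ← hMc, ← smul_eq_mul]
    exact sub_smul_dslope M c s
  have e3 : dslope M c s = (M s + p n) / (s - c) := by
    rw [← e2]; field_simp
  simp only [hg, rowExpr]
  rw [poleSeries_eq_add (summable_norm_of_weighted h.summable_p) n s, e3,
    Complex.cot_eq_cos_div_sin, ← e1, show s + 2 * n = s - c by rw [hc]; ring]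
  simp only [hM, hH]
  field_simp
  ring

/-- The first row entry after removal of the singularities. -/
def rowExt (lam : ℝ) (p q : ℕ → ℂ) (p0 q0 : ℂ) : ℂ → ℂ := removableExt (rowExpr lam p q p0 q0)

lemma PolesCancel.analyticAt_rowExt (h : PolesCancel lam p q q0) {s : ℂ} (hs : s.re < 1) :
    AnalyticAt ℂ (rowExt lam p q p0 q0) s := by
  by_cases hn : ∃ n : ℕ, s = -(2 * n)
  · obtain ⟨n, rfl⟩ := hn
    obtain ⟨g, hg, hfg⟩ := h.exists_analyticAt (p0 := p0) n
    exact analyticAt_removableExt hg hfg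
  · push Not at hn
    exact analyticAt_removableExt (h.analyticAt_rowExpr hs hn) EventuallyEq.rfl

lemma PolesCancel.rowExt_eq (h : PolesCancel lam p q q0) {s : ℂ} (hs : s.re < 1)
    (hn : ∀ n : ℕ, s ≠ -(2 * n)) : rowExt lam p q p0 q0 s = rowExpr lam p q p0 q0 s :=
  removableExt_eq (h.analyticAt_rowExpr hs hn)

lemma ne_of_mem_awayFromPoles {δ : ℝ} (hδ : 0 < δ) {s : ℂ} (hs : s ∈ awayFromPoles δ) (n : ℕ) :
    s ≠ -(2 * n) := by
  rintro rfl
  have := hs n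
  simp at this
  linarith

lemma norm_cpow_neg_mul_cot_le (h0 : 0 < lam) {s : ℂ} (hre : s.re < 1)
    (hs : s ∈ awayFromPoles (1 / 2)) :
    ‖(lam : ℂ) ^ (-s) * Complex.cot (Real.pi * s / 2)‖ ≤ 3 * lam ^ (-s.re) := by
  rw [norm_mul, Complex.norm_cpow_eq_rpow_re_of_pos h0, Complex.neg_re, mul_comm]
  exact mul_le_mul_of_nonneg_right (norm_cot_le hre hs) (Real.rpow_nonneg h0.le _)

lemma rpow_neg_re_le (h0 : 0 < lam) (h1 : lam < 1) {s : ℂ} (hre : s.re < 1) :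
    lam ^ (-s.re) ≤ lam⁻¹ := by
  rw [← Real.rpow_neg_one]
  exact Real.rpow_le_rpow_of_exponent_ge h0 h1.le (by linarith)

/-- A circle of radius `1/2` around a pole stays away from the poles. -/
lemma sphere_subset_awayFromPoles {n : ℕ} {z : ℂ} (hz : ‖z + 2 * n‖ = 1 / 2) :
    z ∈ awayFromPoles (1 / 2) := by
  intro m
  rcases eq_or_ne m n with rfl | h
  · exact hz.ge
  · have := one_le_norm_of_ne (by rw [hz]; norm_num : ‖z + 2 * n‖ < 1) h
    linarith

/-- The maximum principle on the disc of radius 1/2 around -2n, where the bound for the cotangent is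
not available. -/
lemma norm_sub_le_of_sphere {f : ℂ → ℂ} (hf : DifferentiableOn ℂ f {s | s.re < 1}) (L : ℂ) {n : ℕ}
    {M : ℝ} (hM : ∀ z : ℂ, ‖z + 2 * n‖ = 1 / 2 → ‖f z - L‖ ≤ M) {s : ℂ} (hs : ‖s + 2 * n‖ < 1 / 2) :
    ‖f s - L‖ ≤ M := by
  have hd : ∀ z : ℂ, ‖z - (-(2 * n) : ℂ)‖ = ‖z + 2 * n‖ := fun z => by rw [sub_neg_eq_add]
  have hsub : Metric.closedBall (-(2 * n) : ℂ) (1 / 2) ⊆ {s : ℂ | s.re < 1} := by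
    intro z hz
    rw [mem_closedBall_iff_norm, hd] at hz
    have h1 := (Complex.re_le_norm (z + 2 * n)).trans hz
    have : (0 : ℝ) ≤ n := by positivity
    simp at h1 ⊢
    linarith
  refine Complex.norm_le_of_forall_mem_frontier_norm_le (f := fun s => f s - L)
    (U := Metric.ball (-(2 * n) : ℂ) (1 / 2)) Metric.isBounded_ball ?_ ?_ (subset_closure ?_)
  · exact ((hf.mono hsub).sub_const L).diffContOnCl_ball subset_rfl
  · rw [frontier_ball _ (by norm_num)]
    intro z hz
    rw [mem_sphere_iff_norm, hd] at hz
    exact hM z hz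
  · rwa [mem_ball_iff_norm, hd]

/-- By the maximum principle, a limit at infinity off the discs around the poles is a limit at
infinity. -/
lemma tendsto_of_awayFromPoles {f : ℂ → ℂ} (hf : DifferentiableOn ℂ f {s | s.re < 1}) {L : ℂ}
    {D D' : Set ℂ} (hD : D ⊆ D')
    (hdisc : ∀ n : ℕ, ∀ s ∈ D, ‖s + 2 * n‖ < 1 / 2 → ∀ z : ℂ, ‖z + 2 * n‖ = 1 / 2 → z ∈ D')
    (h : Tendsto f (atInftyIn (D' ∩ awayFromPoles (1 / 2))) (𝓝 L)) :
    Tendsto f (atInftyIn D) (𝓝 L) := by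
  have hev : ∀ (E : Set ℂ) (P : ℂ → Prop), (∀ᶠ s in atInftyIn E, P s) ↔
      ∃ R : ℝ, ∀ s ∈ E, R ≤ ‖s‖ → P s := by
    intro E P
    rw [atInftyIn, eventually_inf_principal]
    constructor
    · intro h
      obtain ⟨R, -, hR⟩ := (Metric.hasBasis_cobounded_compl_closedBall (0 : ℂ)).eventually_iff.1 h
      refine ⟨R + 1, fun s hs hn => hR ?_ hs⟩
      simp
      linarith
    · rintro ⟨R, hR⟩
      filter_upwards [tendsto_norm_cobounded_atTop.eventually_ge_atTop R] with s hs hsE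
      exact hR s hsE hs
  rw [Metric.tendsto_nhds] at h ⊢
  intro ε hε
  obtain ⟨R, hR⟩ := (hev _ _).1 (h (ε / 2) (by positivity))
  -- A point on the circle around the pole near s differs from s by at most 1, hence the radius R +
  -- 1.
  refine (hev _ _).2 ⟨R + 1, fun s hs hn => ?_⟩
  by_cases hg : s ∈ awayFromPoles (1 / 2)
  · exact (hR s ⟨hD hs, hg⟩ (by linarith)).trans (by linarith)
  · simp only [awayFromPoles, Set.mem_ofPred_eq, not_forall, not_le] at hg
    obtain ⟨n, hn'⟩ := hg
    rw [dist_eq_norm]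
    refine (norm_sub_le_of_sphere hf L (M := ε / 2) (fun z hz => ?_) hn').trans_lt (by linarith)
    rw [← dist_eq_norm]
    refine (hR z ⟨hdisc n s hs hn' z hz, sphere_subset_awayFromPoles hz⟩ ?_).le
    have h1 : ‖s‖ ≤ ‖z‖ + ‖s + 2 * n‖ + ‖z + 2 * n‖ := by
      calc ‖s‖ = ‖z + (s + 2 * n) - (z + 2 * n)‖ := by congr 1; ring
        _ ≤ _ := (norm_sub_le _ _).trans (by gcongr; exact norm_add_le _ _)
    linarith

lemma tendsto_one_sub_atInftyIn {E F : Set ℂ} (h : ∀ s ∈ E, 1 - s ∈ F) :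
    Tendsto (fun s : ℂ => 1 - s) (atInftyIn E) (atInftyIn F) := by
  refine tendsto_inf.2 ⟨?_, tendsto_principal.2 ?_⟩
  · refine Tendsto.mono_left ?_ inf_le_left
    rw [← tendsto_norm_atTop_iff_cobounded]
    refine tendsto_atTop_mono (fun s => ?_)
      (tendsto_atTop_add_const_right _ (-1) tendsto_norm_cobounded_atTop)
    have := norm_sub_norm_le s 1
    rw [norm_one, norm_sub_rev] at this
    linarith
  · filter_upwards [mem_inf_of_right (mem_principal_self _)] with s hs
    exact h s hs

lemma atInftyIn_mono {E F : Set ℂ} (h : E ⊆ F) : atInftyIn E ≤ atInftyIn F :=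
  inf_le_inf_left _ (principal_mono.2 h)

lemma eventually_mem_atInftyIn (E : Set ℂ) : ∀ᶠ s in atInftyIn E, s ∈ E :=
  mem_inf_of_right (mem_principal_self _)

lemma tendsto_poleSeries_one_sub (hq : Summable fun m => ‖q m‖ * ((m : ℝ) + 1)) {γ : ℝ}
    (hγ : γ < 1) : Tendsto (fun s => poleSeries q (1 - s)) (atInftyIn (Dplus γ)) (𝓝 0) :=
  (tendsto_poleSeries hq (by linarith : 0 < 1 - γ)).comp
    (tendsto_one_sub_atInftyIn fun _ hs => one_sub_mem_awayFromPoles hs)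

lemma Dplus_mono {γ γ' : ℝ} (h : γ ≤ γ') : Dplus γ ⊆ Dplus γ' := fun s hs =>
  show s.re ≤ γ' from (show s.re ≤ γ from hs).trans h

lemma Dplus_half_of_sphere {γ : ℝ} (hγ : 1 / 2 ≤ γ) {n : ℕ} {z : ℂ} (hz : ‖z + 2 * n‖ = 1 / 2) :
    z ∈ Dplus γ := by
  have h1 := (Complex.re_le_norm (z + 2 * n)).trans hz.le
  have : (0 : ℝ) ≤ n := by positivity
  simp [Dplus] at h1 ⊢
  linarith

lemma PolesCancel.differentiableOn_rowExt (h : PolesCancel lam p q q0) :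
    DifferentiableOn ℂ (rowExt lam p q p0 q0) {s | s.re < 1} := fun _ hs =>
  (h.analyticAt_rowExt hs).differentiableAt.differentiableWithinAt

lemma PolesCancel.exists_norm_rowExt_le (h : PolesCancel lam p q q0) {γ : ℝ} (hγ : γ < 1) :
    ∃ C : ℝ, ∀ s ∈ Dplus γ, ‖rowExt lam p q p0 q0 s‖ ≤ C := by
  -- For γ ≥ 1/2 the closed discs around the poles lie in the half-plane, so the maximum principle
  -- needs no boundary case.
  wlog hγ2 : 1 / 2 ≤ γ generalizing γ
  · obtain ⟨C, hC⟩ := this (γ := 1 / 2) (by norm_num) le_rfl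
    exact ⟨C, fun s hs => hC s (le_trans hs (not_le.1 hγ2).le)⟩
  have hp := summable_norm_of_weighted h.summable_p
  have hq := summable_norm_of_weighted h.summable_q
  set C : ℝ := 1 / 2 * ((∑' m, ‖p m‖) / (1 / 2) + ‖p0‖ + 3 * lam⁻¹ *
    (‖q0‖ + (∑' m, ‖q m‖) / (1 - γ)))
  have good : ∀ s ∈ Dplus γ, s ∈ awayFromPoles (1 / 2) → ‖rowExt lam p q p0 q0 s‖ ≤ C := by
    intro s hs hg
    have hs1 : s.re < 1 := lt_of_le_of_lt hs hγ
    rw [h.rowExt_eq hs1 (ne_of_mem_awayFromPoles (by norm_num) hg), rowExpr, norm_mul]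
    have e : ‖(1 / 2 : ℂ)‖ = 1 / 2 := by norm_num
    rw [e]
    refine mul_le_mul_of_nonneg_left ?_ (by norm_num)
    refine (norm_add_le _ _).trans (add_le_add ((norm_add_le _ _).trans (add_le_add_left
      (norm_poleSeries_le hp (by norm_num) hg) _)) ?_)
    rw [norm_mul]
    have h1 := norm_cpow_neg_mul_cot_le h.pos hs1 hg
    have h2 := rpow_neg_re_le h.pos h.lt_one hs1
    have h3 := norm_poleSeries_le hq (by linarith : 0 < 1 - γ)
      (one_sub_mem_awayFromPoles hs)
    have hpos := h.pos
    have h4 : ‖q0 - poleSeries q (1 - s)‖ ≤ ‖q0‖ + (∑' m, ‖q m‖) / (1 - γ) :=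
      (norm_sub_le _ _).trans (by gcongr)
    have h5 : ‖(lam : ℂ) ^ (-s) * Complex.cot (Real.pi * s / 2)‖ ≤ 3 * lam⁻¹ :=
      h1.trans (by gcongr)
    gcongr
  refine ⟨C, fun s hs => ?_⟩
  by_cases hg : s ∈ awayFromPoles (1 / 2)
  · exact good s hs hg
  · simp only [awayFromPoles, Set.mem_ofPred_eq, not_forall, not_le] at hg
    obtain ⟨n, hn⟩ := hg
    have := norm_sub_le_of_sphere (h.differentiableOn_rowExt (p0 := p0)) 0 (M := C) (fun z hz => by
      rw [sub_zero]
      exact good z (Dplus_half_of_sphere hγ2 hz) (sphere_subset_awayFromPoles hz)) hn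
    rwa [sub_zero] at this

/-- The factor λ^(-s) cot is merely bounded along vertical lines. For q0 = 0 the decay of the other
series makes the whole product vanish at infinity. -/
lemma PolesCancel.tendsto_rowExt (h : PolesCancel lam p q 0) {γ : ℝ} (hγ : γ < 1) :
    Tendsto (rowExt lam p q p0 0) (atInftyIn (Dplus γ)) (𝓝 (1 / 2 * p0)) := by
  set γ' := max γ (1 / 2) with hγ'
  have hγ1 : γ' < 1 := max_lt hγ (by norm_num)
  refine tendsto_of_awayFromPoles h.differentiableOn_rowExt (D' := Dplus γ')
    (Dplus_mono (le_max_left _ _))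
    (fun n s _ _ z hz => Dplus_half_of_sphere (le_max_right _ _) hz) ?_
  have h1 : Tendsto (poleSeries p) (atInftyIn (Dplus γ' ∩ awayFromPoles (1 / 2))) (𝓝 0) :=
    (tendsto_poleSeries h.summable_p (by norm_num)).mono_left
      (atInftyIn_mono Set.inter_subset_right)
  have h2 : Tendsto (fun s => poleSeries q (1 - s))
      (atInftyIn (Dplus γ' ∩ awayFromPoles (1 / 2))) (𝓝 0) :=
    (tendsto_poleSeries_one_sub h.summable_q hγ1).mono_left
      (atInftyIn_mono Set.inter_subset_left)
  have h3 : Tendsto (fun s : ℂ => (lam : ℂ) ^ (-s) * Complex.cot (Real.pi * s / 2) *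
      (0 - poleSeries q (1 - s))) (atInftyIn (Dplus γ' ∩ awayFromPoles (1 / 2))) (𝓝 0) := by
    refine squeeze_zero_norm' (a := fun s => 3 * lam⁻¹ * ‖0 - poleSeries q (1 - s)‖) ?_ ?_
    · filter_upwards [eventually_mem_atInftyIn _] with s hs
      have hs1 : s.re < 1 := lt_of_le_of_lt hs.1 hγ1
      rw [norm_mul]
      gcongr
      have hpos := h.pos
      exact (norm_cpow_neg_mul_cot_le h.pos hs1 hs.2).trans (by
        gcongr; exact rpow_neg_re_le h.pos h.lt_one hs1)
    · simpa using (h2.norm.const_mul (3 * lam⁻¹))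
  have h4 := ((h1.add_const p0).add h3).const_mul (1 / 2)
  rw [zero_add, add_zero] at h4
  refine h4.congr' ?_
  filter_upwards [eventually_mem_atInftyIn _] with s hs
  rw [h.rowExt_eq (lt_of_le_of_lt hs.1 hγ1) (ne_of_mem_awayFromPoles (by norm_num) hs.2), rowExpr]

/-- A sector, thickened by a constant. -/
def thickSector (K c : ℝ) : Set ℂ := {s | |s.im| ≤ K * |s.re| + c}

/-- In the sector |s| is at most a multiple of |Re s| plus a constant, so s → ∞ forces Re s → -∞,
and the exponential beats the linear factor. -/
lemma tendsto_mul_rpow_neg_re (h0 : 0 < lam) (h1 : lam < 1) {γ K c : ℝ} (hK : 0 ≤ K) :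
    Tendsto (fun s : ℂ => ‖s‖ * lam ^ (-s.re)) (atInftyIn (Dplus γ ∩ thickSector K c)) (𝓝 0) := by
  have hre : Tendsto (fun s : ℂ => -s.re) (atInftyIn (Dplus γ ∩ thickSector K c)) atTop := by
    have h2 : Tendsto (fun s : ℂ => (‖s‖ - c) / (1 + K) - 2 * |γ|)
        (atInftyIn (Dplus γ ∩ thickSector K c)) atTop := by
      refine tendsto_atTop_add_const_right _ _ (Tendsto.atTop_div_const (by positivity) ?_)
      exact tendsto_atTop_add_const_right _ _
        (tendsto_norm_cobounded_atTop.mono_left inf_le_left)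
    refine tendsto_atTop_mono' _ ?_ h2
    filter_upwards [eventually_mem_atInftyIn _] with s hs
    have h3 : s.re ≤ γ := hs.1
    have h4 : |s.im| ≤ K * |s.re| + c := hs.2
    have h5 := Complex.norm_le_abs_re_add_abs_im s
    have h6 : (‖s‖ - c) / (1 + K) ≤ |s.re| := by
      rw [div_le_iff₀ (by positivity)]; linarith
    have h7 : |s.re| ≤ 2 * |γ| - s.re := by
      have := le_abs_self γ
      have := abs_nonneg γ
      rw [abs_le]
      constructor <;> linarith
    linarith
  have hlog : 0 < -Real.log lam := by linarith [Real.log_neg h0 h1]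
  have h2 := (tendsto_rpow_mul_exp_neg_mul_atTop_nhds_zero 1 _ hlog).comp hre
  have h3 := (tendsto_rpow_mul_exp_neg_mul_atTop_nhds_zero 0 _ hlog).comp hre
  have h4 := (h2.const_mul (1 + K)).add (h3.const_mul |c|)
  simp only [mul_zero, add_zero] at h4
  have hneg : ∀ᶠ s in atInftyIn (Dplus γ ∩ thickSector K c), 0 < -s.re :=
    hre.eventually_gt_atTop 0
  refine squeeze_zero' (Eventually.of_forall fun s => by positivity) ?_ h4
  filter_upwards [hneg, eventually_mem_atInftyIn _] with s hs hsD
  have h5 : |s.im| ≤ K * |s.re| + c := hsD.2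
  have h6 := Complex.norm_le_abs_re_add_abs_im s
  have h7 : |s.re| = -s.re := abs_of_neg (by linarith)
  rw [h7] at h5 h6
  have e : lam ^ (-s.re) = Real.exp (-(-Real.log lam) * -s.re) := by
    rw [Real.rpow_def_of_pos h0]; congr 1; ring
  simp only [Function.comp_apply, Real.rpow_one, Real.rpow_zero, one_mul]
  rw [e, ← mul_assoc, ← add_mul]
  gcongr
  have := le_abs_self c
  linarith

/-- Inside the sector the cotangent term decays exponentially, so q0 may be arbitrary. With p0 = 0
only the series with coefficients p contributes to the limit. -/
lemma PolesCancel.tendsto_mul_rowExt (h : PolesCancel lam p q q0) {γ K c : ℝ} (hγ : γ < 1) :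
    Tendsto (fun s => s * rowExt lam p q 0 q0 s) (atInftyIn (Dplus γ ∩ thickSector K c))
      (𝓝 (1 / 2 * ∑' m, p m)) := by
  set γ' := max γ (1 / 2) with hγ'
  have hγ1 : γ' < 1 := max_lt hγ (by norm_num)
  -- The thickening absorbs the discs around poles that meet the original sector.
  set D' := Dplus γ' ∩ thickSector |K| (|c| + |K| + 1) with hD'
  have hsub : ∀ s ∈ thickSector K c, ∀ z : ℂ, ‖s - z‖ ≤ 1 → z ∈ thickSector |K| (|c| + |K| + 1) := by
    intro s hs z hz
    have h1 : |s.im| ≤ K * |s.re| + c := hs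
    have h2 := (Complex.abs_im_le_norm (s - z)).trans hz
    have h3 := (Complex.abs_re_le_norm (s - z)).trans hz
    rw [Complex.sub_im] at h2
    rw [Complex.sub_re] at h3
    have h4 : |z.im| ≤ |s.im| + 1 := by
      have := abs_sub_abs_le_abs_sub z.im s.im
      rw [abs_sub_comm] at this
      linarith
    have h5 : |s.re| ≤ |z.re| + 1 := by
      have := abs_sub_abs_le_abs_sub s.re z.re
      linarith
    have h6 : K * |s.re| ≤ |K| * |s.re| := by gcongr; exact le_abs_self K
    have h7 : |K| * |s.re| ≤ |K| * (|z.re| + 1) := by gcongr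
    have := le_abs_self c
    change |z.im| ≤ |K| * |z.re| + (|c| + |K| + 1)
    linarith
  refine tendsto_of_awayFromPoles (differentiableOn_id.mul h.differentiableOn_rowExt) (D' := D')
    (fun s hs => ⟨Dplus_mono (le_max_left _ _) hs.1, hsub s hs.2 s (by simp)⟩)
    (fun n s hs hn z hz => ⟨Dplus_half_of_sphere (le_max_right _ _) hz, hsub s hs.2 z ?_⟩) ?_
  · rw [show s - z = (s + 2 * n) - (z + 2 * n) by ring]
    exact (norm_sub_le _ _).trans (by linarith)
  set l := atInftyIn (D' ∩ awayFromPoles (1 / 2))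
  have h1 : Tendsto (fun s => s * poleSeries p s) l (𝓝 (∑' m, p m)) :=
    (tendsto_mul_poleSeries h.summable_p (by norm_num)).mono_left
      (atInftyIn_mono Set.inter_subset_right)
  have h2 : Tendsto (fun s => poleSeries q (1 - s)) l (𝓝 0) :=
    (tendsto_poleSeries_one_sub h.summable_q hγ1).mono_left
      (atInftyIn_mono fun s hs => hs.1.1)
  have h5 : Tendsto (fun s : ℂ => ‖s‖ * lam ^ (-s.re)) l (𝓝 0) :=
    (tendsto_mul_rpow_neg_re h.pos h.lt_one (abs_nonneg K)).mono_left
      (atInftyIn_mono Set.inter_subset_left)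
  have h3 : Tendsto (fun s : ℂ => s * ((lam : ℂ) ^ (-s) * Complex.cot (Real.pi * s / 2) *
      (q0 - poleSeries q (1 - s)))) l (𝓝 0) := by
    refine squeeze_zero_norm' (a := fun s => ‖s‖ * lam ^ (-s.re) * (3 *
      ‖q0 - poleSeries q (1 - s)‖)) ?_ ?_
    · filter_upwards [eventually_mem_atInftyIn _] with s hs
      have := norm_cpow_neg_mul_cot_le h.pos (lt_of_le_of_lt hs.1.1 hγ1) hs.2
      rw [norm_mul, norm_mul]
      calc _ ≤ ‖s‖ * (3 * lam ^ (-s.re) * ‖q0 - poleSeries q (1 - s)‖) := by gcongr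
        _ = _ := by ring
    · simpa using h5.mul ((h2.const_sub q0).norm.const_mul 3)
  have h4 := (h1.add h3).const_mul (1 / 2)
  rw [add_zero] at h4
  refine h4.congr' ?_
  filter_upwards [eventually_mem_atInftyIn _] with s hs
  rw [Pi.mul_apply, h.rowExt_eq (lt_of_le_of_lt hs.1.1 hγ1) (ne_of_mem_awayFromPoles (by norm_num) hs.2),
    rowExpr]
  ring

end Row


/-! ### The factors: analyticity, factorization, limits and determinants. -/

/-- The factor `X⁺`, with the removable singularities removed. -/
def Xplus (lam : ℝ) (A B : Fin 2 → ℕ → ℂ) (s : ℂ) : Matrix (Fin 2) (Fin 2) ℂ :=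
  Matrix.of fun i l =>
    if i = 0 then rowExt lam (B l) (A l) (kron l 1) (kron l 0) s else Psi A l s + kron l 0

/-- The factor `X⁻`, with the removable singularities removed. -/
def Xminus (lam : ℝ) (A B : Fin 2 → ℕ → ℂ) (s : ℂ) : Matrix (Fin 2) (Fin 2) ℂ :=
  Matrix.of fun i l =>
    if i = 0 then rowExt lam (-(A l)) (-((lam : ℂ) • B l)) (kron l 0) (lam * kron l 1) (1 - s)
    else 1 / (lam : ℂ) * (Omega B l s + kron l 1)

lemma Omega_eq (B : Fin 2 → ℕ → ℂ) (l : Fin 2) : Omega B l = poleSeries (B l) := rfl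

lemma Psi_eq (A : Fin 2 → ℕ → ℂ) (l : Fin 2) (s : ℂ) : Psi A l s = -poleSeries (A l) (1 - s) := by
  rw [Psi, poleSeries, ← tsum_neg]
  refine tsum_congr fun m => ?_
  rw [← div_neg]
  congr 1
  ring

lemma poleSeries_neg (c : ℕ → ℂ) (s : ℂ) : poleSeries (-c) s = -poleSeries c s := by
  rw [poleSeries, poleSeries, ← tsum_neg]
  exact tsum_congr fun m => by rw [Pi.neg_apply, neg_div]

lemma poleSeries_smul (r : ℂ) (c : ℕ → ℂ) (s : ℂ) :
    poleSeries (r • c) s = r * poleSeries c s := by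
  rw [poleSeries, poleSeries, ← tsum_mul_left]
  exact tsum_congr fun m => by rw [Pi.smul_apply, smul_eq_mul, mul_div_assoc]

lemma mem_awayFromPoles_of_le_re {γ : ℝ} {s : ℂ} (hs : γ ≤ s.re) : s ∈ awayFromPoles γ := by
  have := one_sub_mem_awayFromPoles (s := 1 - s) (γ := 1 - γ) (by simp; linarith)
  rwa [sub_sub_cancel, sub_sub_cancel] at this

section Factors

variable {lam : ℝ} {A B : Fin 2 → ℕ → ℂ}

lemma SolvesSystem.summable_weighted (h : SolvesSystem lam A B) (h0 : 0 < lam) (h1 : lam < 1)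
    (l : Fin 2) : (Summable fun m => ‖A l m‖ * ((m : ℝ) + 1)) ∧
      Summable fun m => ‖B l m‖ * ((m : ℝ) + 1) := by
  obtain ⟨C, hC0, hC⟩ := h.exists_bound h0 h1
  have hr2 : ‖lam ^ 2‖ < 1 := by
    rw [Real.norm_of_nonneg (by positivity)]; nlinarith
  have hs : Summable fun m : ℕ => C * (lam ^ 2) ^ m * ((m : ℝ) + 1) := by
    have h2 := (summable_pow_mul_geometric_of_norm_lt_one 1 hr2).add
      (summable_geometric_of_norm_lt_one hr2)
    refine (h2.mul_left C).congr fun m => ?_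
    ring
  exact ⟨Summable.of_nonneg_of_le (fun m => by positivity)
      (fun m => mul_le_mul_of_nonneg_right (hC l m).1 (by positivity)) hs,
    Summable.of_nonneg_of_le (fun m => by positivity)
      (fun m => mul_le_mul_of_nonneg_right (hC l m).2 (by positivity)) hs⟩

lemma tsum_half (c : ℕ → ℂ) (n : ℕ) :
    ∑' m : ℕ, c m / ((n : ℂ) + m + 1 / 2) = 2 * poleSeries c (1 + 2 * n) := by
  rw [poleSeries, ← tsum_mul_left]
  refine tsum_congr fun m => ?_
  rw [show (1 : ℂ) + 2 * n + 2 * m = 2 * (n + m + 1 / 2) by ring]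
  rw [← mul_div_assoc, mul_div_mul_left _ _ two_ne_zero]

/-- The residue of cot(πs/2) is 2/π, and λ^(-s) equals λ^{2n} at s = -2n. The vanishing of the total
residue is the equation for B. -/
lemma SolvesSystem.polesCancel_plus (h : SolvesSystem lam A B) (h0 : 0 < lam) (h1 : lam < 1)
    (l : Fin 2) : PolesCancel lam (B l) (A l) (kron l 0) where
  pos := h0
  lt_one := h1
  summable_p := (h.summable_weighted h0 h1 l).2
  summable_q := (h.summable_weighted h0 h1 l).1
  residue n := by
    rw [h.eq_B, tsum_half]
    ring

/-- Under s ↦ 1 - s the tangent becomes the cotangent, λ^s becomes λ · λ^(-s), and Ψ becomes minus a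
series with poles at -2n. Hence the signs and the factor λ; the residue condition is the equation
for A. -/
lemma SolvesSystem.polesCancel_minus (h : SolvesSystem lam A B) (h0 : 0 < lam) (h1 : lam < 1)
    (l : Fin 2) : PolesCancel lam (-(A l)) (-((lam : ℂ) • B l)) (lam * kron l 1) where
  pos := h0
  lt_one := h1
  summable_p := by simpa using (h.summable_weighted h0 h1 l).1
  summable_q := by
    refine ((h.summable_weighted h0 h1 l).2.mul_left lam).congr fun m => ?_
    simp [abs_of_pos h0]
    ring
  residue n := by
    rw [Pi.neg_apply, h.eq_A, tsum_half, poleSeries_neg, poleSeries_smul]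
    ring

lemma SolvesSystem.analyticAt_Psi (h : SolvesSystem lam A B) (h0 : 0 < lam) (h1 : lam < 1)
    (l : Fin 2) {s : ℂ} (hs : s.re < 1) : AnalyticAt ℂ (Psi A l) s := by
  rw [show Psi A l = fun s => -poleSeries (A l) (1 - s) from funext (Psi_eq A l)]
  exact (analyticAt_poleSeries_one_sub
    (summable_norm_of_weighted (h.summable_weighted h0 h1 l).1) hs).neg

lemma SolvesSystem.analyticAt_Omega (h : SolvesSystem lam A B) (h0 : 0 < lam) (h1 : lam < 1)
    (l : Fin 2) {s : ℂ} (hs : 0 < s.re) : AnalyticAt ℂ (Omega B l) s := by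
  refine analyticAt_poleSeries (summable_norm_of_weighted (h.summable_weighted h0 h1 l).2)
    fun m hm => ?_
  have := mem_awayFromPoles_of_le_re le_rfl m (s := s)
  rw [hm, norm_zero] at this
  linarith

lemma SolvesSystem.meromorphicOn (h : SolvesSystem lam A B) (h0 : 0 < lam) (h1 : lam < 1)
    (l : Fin 2) : MeromorphicOn (Psi A l) Set.univ ∧ MeromorphicOn (Omega B l) Set.univ := by
  refine ⟨fun s _ => ?_, fun s _ => meromorphicAt_poleSeries
    (summable_norm_of_weighted (h.summable_weighted h0 h1 l).2) s⟩
  rw [show Psi A l = fun s => -poleSeries (A l) (1 - s) from funext (Psi_eq A l)]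
  refine MeromorphicAt.neg ?_
  exact (meromorphicAt_poleSeries (summable_norm_of_weighted (h.summable_weighted h0 h1 l).1)
    (1 - s)).comp_analyticAt (by fun_prop)

lemma SolvesSystem.analyticAt_Xplus (h : SolvesSystem lam A B) (h0 : 0 < lam) (h1 : lam < 1)
    {s : ℂ} (hs : s.re < 1) (i l : Fin 2) : AnalyticAt ℂ (fun s => Xplus lam A B s i l) s := by
  simp only [Xplus, Matrix.of_apply]
  split_ifs
  · exact (h.polesCancel_plus h0 h1 l).analyticAt_rowExt hs
  · exact (h.analyticAt_Psi h0 h1 l hs).add analyticAt_const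

lemma SolvesSystem.analyticAt_Xminus (h : SolvesSystem lam A B) (h0 : 0 < lam) (h1 : lam < 1)
    {s : ℂ} (hs : 0 < s.re) (i l : Fin 2) : AnalyticAt ℂ (fun s => Xminus lam A B s i l) s := by
  simp only [Xminus, Matrix.of_apply]
  split_ifs
  · have := (h.polesCancel_minus h0 h1 l).analyticAt_rowExt (p0 := kron l 0) (s := 1 - s)
      (by simpa using hs)
    exact this.comp (f := fun s => 1 - s) (by fun_prop)
  · exact analyticAt_const.mul ((h.analyticAt_Omega h0 h1 l hs).add analyticAt_const)

lemma SolvesSystem.Xplus_eq (h : SolvesSystem lam A B) (h0 : 0 < lam) (h1 : lam < 1)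
    {s : ℂ} (hs : s.re < 1) (hne : ∀ n : ℕ, s ≠ -(2 * n)) :
    Xplus lam A B s = XplusExpr lam A B s := by
  ext i l
  simp only [Xplus, XplusExpr, Matrix.of_apply]
  split_ifs
  · rw [(h.polesCancel_plus h0 h1 l).rowExt_eq hs hne, rowExpr, Psi_eq, Omega_eq]
    ring
  · rfl

lemma SolvesSystem.Xminus_eq (h : SolvesSystem lam A B) (h0 : 0 < lam) (h1 : lam < 1)
    {s : ℂ} (hs : 0 < s.re) (hne : ∀ n : ℕ, s ≠ 2 * n + 1) :
    Xminus lam A B s = XminusExpr lam A B s := by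
  have hl : (lam : ℂ) ≠ 0 := by exact_mod_cast h0.ne'
  ext i l
  simp only [Xminus, XminusExpr, Matrix.of_apply]
  split_ifs
  · rw [(h.polesCancel_minus h0 h1 l).rowExt_eq (by simpa using hs) (fun n hn => hne n (by
      linear_combination -hn)), rowExpr, sub_sub_cancel, poleSeries_neg, poleSeries_neg,
      poleSeries_smul, Psi_eq, Omega_eq, Complex.cot_eq_cos_div_sin, Complex.tan_eq_sin_div_cos,
      show (Real.pi * (1 - s) / 2 : ℂ) = Real.pi / 2 - Real.pi * s / 2 by ring,
      Complex.cos_pi_div_two_sub, Complex.sin_pi_div_two_sub,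
      show (-(1 - s) : ℂ) = s - 1 by ring, Complex.cpow_sub _ _ hl, Complex.cpow_one]
    field_simp
    ring
  · rfl

/-- The strip contains none of the exceptional points, so the factors are the explicit expressions,
and with cot = cos / sin the product is checked entrywise. The infinite systems play no part in this
identity. -/
lemma SolvesSystem.G0_mul_Xminus (h : SolvesSystem lam A B) (h0 : 0 < lam) (h1 : lam < 1)
    {s : ℂ} (hs0 : 0 < s.re) (hs1 : s.re < 1) : G0 lam s * Xminus lam A B s = Xplus lam A B s := by
  have hne1 : ∀ n : ℕ, s ≠ -(2 * n) := by
    rintro n rfl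
    have : (0 : ℝ) ≤ n := by positivity
    simp at hs0
    linarith
  have hne2 : ∀ n : ℕ, s ≠ 2 * n + 1 := by
    rintro n rfl
    have : (0 : ℝ) ≤ n := by positivity
    simp at hs1
    linarith
  have hsin := sin_ne_zero_of_ne hs1 hne1
  have hcos : Complex.cos (Real.pi * s / 2) ≠ 0 := by
    have := sin_ne_zero_of_ne (s := 1 - s) (by simpa using hs0) (fun n hn => hne2 n (by
      linear_combination -hn))
    rwa [show (Real.pi * (1 - s) / 2 : ℂ) = Real.pi / 2 - Real.pi * s / 2 by ring,
      Complex.sin_pi_div_two_sub] at this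
  have hl : (lam : ℂ) ≠ 0 := by exact_mod_cast h0.ne'
  have hls : (lam : ℂ) ^ s ≠ 0 := by simp [Complex.cpow_eq_zero_iff, hl]
  rw [h.Xplus_eq h0 h1 hs1 hne1, h.Xminus_eq h0 h1 hs0 hne2]
  ext i l
  rw [Matrix.mul_apply, Fin.sum_univ_two]
  simp only [G0, XplusExpr, XminusExpr, Matrix.of_apply, Complex.cot_eq_cos_div_sin,
    Complex.tan_eq_sin_div_cos, Complex.cpow_add _ _ hl, Complex.cpow_neg, Complex.cpow_one]
  fin_cases i
  · simp
    field_simp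
    ring
  · simp
    field_simp
    ring

lemma det_G0 (h0 : 0 < lam) {s : ℂ} (hs0 : 0 < s.re) (hs1 : s.re < 1) :
    (G0 lam s).det = -lam := by
  have hne1 : ∀ n : ℕ, s ≠ -(2 * n) := by
    rintro n rfl
    have : (0 : ℝ) ≤ n := by positivity
    simp at hs0
    linarith
  have hne2 : ∀ n : ℕ, 1 - s ≠ -(2 * n) := by
    intro n hn
    have : s = 2 * n + 1 := by linear_combination -hn
    rw [this] at hs1
    have : (0 : ℝ) ≤ n := by positivity
    simp at hs1
    linarith
  have hsin := sin_ne_zero_of_ne hs1 hne1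
  have hcos : Complex.cos (Real.pi * s / 2) ≠ 0 := by
    have := sin_ne_zero_of_ne (s := 1 - s) (by simpa using hs0) hne2
    rwa [show (Real.pi * (1 - s) / 2 : ℂ) = Real.pi / 2 - Real.pi * s / 2 by ring,
      Complex.sin_pi_div_two_sub] at this
  have hl : (lam : ℂ) ≠ 0 := by exact_mod_cast h0.ne'
  have hls : (lam : ℂ) ^ s ≠ 0 := by simp [Complex.cpow_eq_zero_iff, hl]
  simp only [G0, Matrix.det_fin_two_of, Complex.cot_eq_cos_div_sin,
    Complex.tan_eq_sin_div_cos, Complex.cpow_add _ _ hl, Complex.cpow_neg, Complex.cpow_one]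
  field_simp
  ring

lemma SolvesSystem.exists_norm_Xplus_le (h : SolvesSystem lam A B) (h0 : 0 < lam) (h1 : lam < 1)
    {γ : ℝ} (hγ : γ < 1) : ∃ C : ℝ, ∀ s ∈ Dplus γ, ∀ i l, ‖Xplus lam A B s i l‖ ≤ C := by
  have key : ∀ i l, ∃ C : ℝ, ∀ s ∈ Dplus γ, ‖Xplus lam A B s i l‖ ≤ C := by
    intro i l
    simp only [Xplus, Matrix.of_apply]
    split_ifs
    · exact (h.polesCancel_plus h0 h1 l).exists_norm_rowExt_le hγ
    · refine ⟨(∑' m, ‖A l m‖) / (1 - γ) + ‖kron l 0‖, fun s hs => (norm_add_le _ _).trans (add_le_add_left ?_ _)⟩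
      rw [Psi_eq, norm_neg]
      exact norm_poleSeries_le (summable_norm_of_weighted (h.summable_weighted h0 h1 l).1)
        (by linarith : 0 < 1 - γ) (one_sub_mem_awayFromPoles hs)
  choose C hC using key
  refine ⟨∑ i, ∑ l, |C i l|, fun s hs i l => (hC i l s hs).trans ((le_abs_self _).trans ?_)⟩
  exact (Finset.single_le_sum (f := fun l => |C i l|) (fun _ _ => abs_nonneg _)
    (Finset.mem_univ l)).trans (Finset.single_le_sum (f := fun i => ∑ l, |C i l|)
      (fun _ _ => Finset.sum_nonneg fun _ _ => abs_nonneg _) (Finset.mem_univ i))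

lemma one_sub_mem_Dplus {γ : ℝ} {s : ℂ} (hs : s ∈ Dminus γ) : 1 - s ∈ Dplus (1 - γ) := by
  have : γ ≤ s.re := hs
  simp [Dplus]
  linarith

lemma SolvesSystem.exists_norm_Xminus_le (h : SolvesSystem lam A B) (h0 : 0 < lam) (h1 : lam < 1)
    {γ : ℝ} (hγ : 0 < γ) : ∃ C : ℝ, ∀ s ∈ Dminus γ, ∀ i l, ‖Xminus lam A B s i l‖ ≤ C := by
  have key : ∀ i l, ∃ C : ℝ, ∀ s ∈ Dminus γ, ‖Xminus lam A B s i l‖ ≤ C := by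
    intro i l
    simp only [Xminus, Matrix.of_apply]
    split_ifs
    · obtain ⟨C, hC⟩ := (h.polesCancel_minus h0 h1 l).exists_norm_rowExt_le (p0 := kron l 0)
        (by linarith : 1 - γ < 1)
      exact ⟨C, fun s hs => hC _ (one_sub_mem_Dplus hs)⟩
    · refine ⟨‖1 / (lam : ℂ)‖ * ((∑' m, ‖B l m‖) / γ + ‖kron l 1‖), fun s hs => ?_⟩
      rw [norm_mul]
      gcongr
      refine (norm_add_le _ _).trans (add_le_add_left ?_ _)
      exact norm_poleSeries_le (summable_norm_of_weighted (h.summable_weighted h0 h1 l).2)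
        hγ (mem_awayFromPoles_of_le_re hs)
  choose C hC using key
  refine ⟨∑ i, ∑ l, |C i l|, fun s hs i l => (hC i l s hs).trans ((le_abs_self _).trans ?_)⟩
  exact (Finset.single_le_sum (f := fun l => |C i l|) (fun _ _ => abs_nonneg _)
    (Finset.mem_univ l)).trans (Finset.single_le_sum (f := fun i => ∑ l, |C i l|)
      (fun _ _ => Finset.sum_nonneg fun _ _ => abs_nonneg _) (Finset.mem_univ i))

lemma tendsto_one_sub_Dminus (γ : ℝ) :
    Tendsto (fun s : ℂ => 1 - s) (atInftyIn (Dminus γ)) (atInftyIn (Dplus (1 - γ))) :=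
  tendsto_one_sub_atInftyIn fun _ => one_sub_mem_Dplus

section Limits

variable {γ : ℝ}

lemma SolvesSystem.tendsto_Psi (h : SolvesSystem lam A B) (h0 : 0 < lam) (h1 : lam < 1)
    (hγ : γ < 1) (l : Fin 2) : Tendsto (Psi A l) (atInftyIn (Dplus γ)) (𝓝 0) := by
  have := (tendsto_poleSeries_one_sub (h.summable_weighted h0 h1 l).1 hγ).neg
  rw [neg_zero] at this
  exact this.congr fun s => (Psi_eq A l s).symm

lemma SolvesSystem.tendsto_Xplus_one_zero (h : SolvesSystem lam A B) (h0 : 0 < lam) (h1 : lam < 1)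
    (hγ : γ < 1) : Tendsto (fun s => Xplus lam A B s 1 0) (atInftyIn (Dplus γ)) (𝓝 1) := by
  simpa [Xplus, kron] using (h.tendsto_Psi h0 h1 hγ 0).add_const 1

lemma SolvesSystem.tendsto_Xplus_one_one (h : SolvesSystem lam A B) (h0 : 0 < lam) (h1 : lam < 1)
    (hγ : γ < 1) : Tendsto (fun s => Xplus lam A B s 1 1) (atInftyIn (Dplus γ)) (𝓝 0) := by
  simpa [Xplus, kron] using h.tendsto_Psi h0 h1 hγ 1

lemma SolvesSystem.tendsto_Xplus_zero_one (h : SolvesSystem lam A B) (h0 : 0 < lam) (h1 : lam < 1)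
    (hγ : γ < 1) : Tendsto (fun s => Xplus lam A B s 0 1) (atInftyIn (Dplus γ)) (𝓝 (1 / 2)) := by
  have hk : kron 1 0 = 0 := by simp [kron]
  have hc := h.polesCancel_plus h0 h1 1
  rw [hk] at hc
  simpa [Xplus, kron] using hc.tendsto_rowExt (p0 := 1) hγ

lemma SolvesSystem.tendsto_Xminus_zero_zero (h : SolvesSystem lam A B) (h0 : 0 < lam)
    (h1 : lam < 1) (hγ : 0 < γ) :
    Tendsto (fun s => Xminus lam A B s 0 0) (atInftyIn (Dminus γ)) (𝓝 (1 / 2)) := by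
  have hk : (lam : ℂ) * kron 0 1 = 0 := by simp [kron]
  have hc := h.polesCancel_minus h0 h1 0
  rw [hk] at hc
  have := (hc.tendsto_rowExt (p0 := 1) (by linarith : 1 - γ < 1)).comp (tendsto_one_sub_Dminus γ)
  rw [mul_one] at this
  refine this.congr fun s => ?_
  simp [Xminus, kron]

lemma SolvesSystem.tendsto_Xminus_one_one (h : SolvesSystem lam A B) (h0 : 0 < lam)
    (h1 : lam < 1) (hγ : 0 < γ) :
    Tendsto (fun s => Xminus lam A B s 1 1) (atInftyIn (Dminus γ)) (𝓝 (1 / (lam : ℂ))) := by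
  have h2 : Tendsto (Omega B 1) (atInftyIn (Dminus γ)) (𝓝 0) :=
    (tendsto_poleSeries (h.summable_weighted h0 h1 1).2 hγ).mono_left
      (atInftyIn_mono fun s hs => mem_awayFromPoles_of_le_re hs)
  simpa [Xminus, kron] using (h2.add_const 1).const_mul (1 / (lam : ℂ))

lemma SolvesSystem.tendsto_mul_Xplus_one_one (h : SolvesSystem lam A B) (h0 : 0 < lam)
    (h1 : lam < 1) (hγ : γ < 1) :
    Tendsto (fun s => s * Xplus lam A B s 1 1) (atInftyIn (Dplus γ)) (𝓝 (∑' m, A 1 m)) := by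
  have h2 := (tendsto_mul_poleSeries (h.summable_weighted h0 h1 1).1 (by linarith :
    0 < 1 - γ)).comp (tendsto_one_sub_atInftyIn fun _ hs => one_sub_mem_awayFromPoles hs)
  have h3 := h2.add (h.tendsto_Psi h0 h1 hγ 1)
  rw [add_zero] at h3
  refine h3.congr fun s => ?_
  simp [Xplus, kron, Psi_eq]
  ring

lemma SolvesSystem.tendsto_mul_Xminus_one_zero (h : SolvesSystem lam A B) (h0 : 0 < lam)
    (h1 : lam < 1) (hγ : 0 < γ) :
    Tendsto (fun s => s * Xminus lam A B s 1 0) (atInftyIn (Dminus γ))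
      (𝓝 (1 / lam * ∑' m, B 0 m)) := by
  have h2 := (tendsto_mul_poleSeries (h.summable_weighted h0 h1 0).2 hγ).mono_left
      (atInftyIn_mono (E := Dminus γ) fun s hs => mem_awayFromPoles_of_le_re hs)
  refine (h2.const_mul (1 / (lam : ℂ))).congr fun s => ?_
  simp [Xminus, kron, Omega_eq]
  ring

lemma SolvesSystem.tendsto_mul_Xplus_zero_zero (h : SolvesSystem lam A B) (h0 : 0 < lam)
    (h1 : lam < 1) (hγ : γ < 1) (K : ℝ) :
    Tendsto (fun s => s * Xplus lam A B s 0 0)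
      (atInftyIn (Dplus γ ∩ {s | |s.im| ≤ K * |s.re|})) (𝓝 (1 / 2 * ∑' m, B 0 m)) := by
  have hk : kron 0 1 = 0 := by simp [kron]
  have := (h.polesCancel_plus h0 h1 0).tendsto_mul_rowExt (K := K) (c := 0) hγ
  simp only [thickSector, add_zero] at this
  refine this.congr fun s => ?_
  simp [Xplus, hk]

lemma SolvesSystem.tendsto_mul_Xminus_zero_one (h : SolvesSystem lam A B) (h0 : 0 < lam)
    (h1 : lam < 1) (hγ : 0 < γ) (K : ℝ) :
    Tendsto (fun s => s * Xminus lam A B s 0 1)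
      (atInftyIn (Dminus γ ∩ {s | |s.im| ≤ K * |s.re|})) (𝓝 (1 / 2 * ∑' m, A 1 m)) := by
  have hk : kron 1 0 = 0 := by simp [kron]
  -- The reflection s ↦ 1 - s changes |Re s| by at most 1, so the sector is mapped into itself
  -- thickened by |K|.
  have h2 := (h.polesCancel_minus h0 h1 1).tendsto_mul_rowExt (γ := 1 - γ) (K := K) (c := |K|)
    (by linarith)
  have hmap : Tendsto (fun s : ℂ => 1 - s) (atInftyIn (Dminus γ ∩ {s | |s.im| ≤ K * |s.re|}))
      (atInftyIn (Dplus (1 - γ) ∩ thickSector K |K|)) := by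
    refine tendsto_one_sub_atInftyIn fun s hs => ⟨one_sub_mem_Dplus hs.1, ?_⟩
    have h3 : |s.im| ≤ K * |s.re| := hs.2
    change |(1 - s).im| ≤ K * |(1 - s).re| + |K|
    simp only [Complex.sub_im, Complex.one_im, zero_sub, abs_neg, Complex.sub_re, Complex.one_re]
    have h4 : |(|s.re| - |1 - s.re|)| ≤ 1 := by
      have := abs_abs_sub_abs_le s.re (s.re - 1)
      rw [abs_sub_comm s.re 1] at this
      simpa using this
    have h5 : K * (|s.re| - |1 - s.re|) ≤ |K| * 1 := by
      refine (le_abs_self _).trans ?_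
      rw [abs_mul]
      gcongr
    linarith
  have h3 := h2.comp hmap
  have hinv : Tendsto (fun s : ℂ => (1 - s)⁻¹) (atInftyIn (Dminus γ ∩ {s | |s.im| ≤ K * |s.re|}))
      (𝓝 0) := (tendsto_inv₀_cobounded.mono_left inf_le_left).comp hmap
  -- The known limit is that of (1 - s) f; it is converted through s f = f - (1 - s) f, where f → 0.
  have h4 := (hinv.mul h3).sub h3
  have hlim : (0 : ℂ) * (1 / 2 * ∑' m, (-(A 1)) m) - 1 / 2 * ∑' m, (-(A 1)) m =
      1 / 2 * ∑' m, A 1 m := by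
    simp only [Pi.neg_apply, tsum_neg]
    ring
  rw [hlim] at h4
  refine h4.congr' ?_
  have hne : ∀ᶠ s : ℂ in Bornology.cobounded ℂ, s ≠ 0 := Bornology.eventually_ne_cobounded 0
  filter_upwards [hmap.eventually (mem_inf_of_left hne)] with s hs
  simp only [Function.comp_apply, Xminus, Matrix.of_apply, if_true, hk]
  field_simp
  ring

lemma neBot_atInftyIn_Dplus : (atInftyIn (Dplus γ)).NeBot := by
  have : Tendsto (fun n : ℕ => (γ : ℂ) - n) atTop (atInftyIn (Dplus γ)) := by
    refine tendsto_inf.2 ⟨?_, tendsto_principal.2 (Eventually.of_forall fun n => ?_)⟩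
    · rw [← tendsto_norm_atTop_iff_cobounded]
      refine tendsto_atTop_mono (fun n => ?_)
        (tendsto_atTop_add_const_right _ (-|γ|) tendsto_natCast_atTop_atTop)
      have := norm_sub_norm_le (n : ℂ) γ
      rw [norm_sub_rev, Complex.norm_natCast, Complex.norm_real, Real.norm_eq_abs] at this
      linarith
    · simp [Dplus]
  exact this.neBot

end Limits

/-- In the strip det X⁺ = -λ det X⁻, since det G₀ = -λ. The two sides glue to an entire function,
bounded because the entries are, and Liouville's theorem makes it constant. -/
lemma SolvesSystem.det_eq (h : SolvesSystem lam A B) (h0 : 0 < lam) (h1 : lam < 1) :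
    (∀ s : ℂ, s.re < 1 → (Xplus lam A B s).det = -1 / 2) ∧
    ∀ s : ℂ, 0 < s.re → (Xminus lam A B s).det = 1 / (2 * (lam : ℂ)) := by
  have hl : (lam : ℂ) ≠ 0 := by exact_mod_cast h0.ne'
  have hstrip : ∀ s : ℂ, 0 < s.re → s.re < 1 →
      (Xplus lam A B s).det = -lam * (Xminus lam A B s).det := by
    intro s hs0 hs1
    rw [← h.G0_mul_Xminus h0 h1 hs0 hs1, Matrix.det_mul, det_G0 h0 hs0 hs1]
  set E : ℂ → ℂ := fun s =>
    if s.re < 1 then (Xplus lam A B s).det else -lam * (Xminus lam A B s).det with hE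
  have hEp : ∀ s : ℂ, s.re < 1 → E s = (Xplus lam A B s).det := fun s hs => if_pos hs
  have hEm : ∀ s : ℂ, 0 < s.re → E s = -lam * (Xminus lam A B s).det := by
    intro s hs
    by_cases hs1 : s.re < 1
    · rw [hEp s hs1, hstrip s hs hs1]
    · exact if_neg hs1
  have hdiff : Differentiable ℂ E := by
    intro s
    rcases lt_or_ge s.re 1 with hs | hs
    · have h2 : E =ᶠ[𝓝 s] fun s => (Xplus lam A B s).det := by
        filter_upwards [(isOpen_lt Complex.continuous_re continuous_const).mem_nhds hs] with z hz
        exact hEp z hz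
      refine h2.differentiableAt_iff.2 ?_
      simp only [Matrix.det_fin_two]
      have hd := fun i l => (h.analyticAt_Xplus h0 h1 hs i l).differentiableAt
      exact ((hd 0 0).mul (hd 1 1)).sub ((hd 0 1).mul (hd 1 0))
    · have hs' : 0 < s.re := by linarith
      have h2 : E =ᶠ[𝓝 s] fun s => -lam * (Xminus lam A B s).det := by
        filter_upwards [(isOpen_lt continuous_const Complex.continuous_re).mem_nhds hs'] with z hz
        exact hEm z hz
      refine h2.differentiableAt_iff.2 ?_
      simp only [Matrix.det_fin_two]
      have hd := fun i l => (h.analyticAt_Xminus h0 h1 hs' i l).differentiableAt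
      exact (((hd 0 0).mul (hd 1 1)).sub ((hd 0 1).mul (hd 1 0))).const_mul _
  obtain ⟨Cp, hCp⟩ := h.exists_norm_Xplus_le h0 h1 (γ := 1 / 2) (by norm_num)
  obtain ⟨Cm, hCm⟩ := h.exists_norm_Xminus_le h0 h1 (γ := 1 / 2) (by norm_num)
  have hdet : ∀ (M : Matrix (Fin 2) (Fin 2) ℂ) (C : ℝ), (∀ i l, ‖M i l‖ ≤ C) →
      ‖M.det‖ ≤ C * C + C * C := by
    intro M C hM
    have hC : 0 ≤ C := (norm_nonneg _).trans (hM 0 0)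
    rw [Matrix.det_fin_two]
    refine (norm_sub_le _ _).trans ?_
    rw [norm_mul, norm_mul]
    gcongr <;> exact hM _ _
  have hbdd : Bornology.IsBounded (Set.range E) := by
    rw [isBounded_iff_forall_norm_le]
    refine ⟨max (Cp * Cp + Cp * Cp) (lam * (Cm * Cm + Cm * Cm)), ?_⟩
    rintro _ ⟨s, rfl⟩
    rcases le_total s.re (1 / 2) with hs | hs
    · rw [hEp s (by linarith)]
      exact (hdet _ _ (hCp s hs)).trans (le_max_left _ _)
    · rw [hEm s (by linarith), norm_mul, norm_neg, Complex.norm_real, Real.norm_of_nonneg h0.le]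
      exact (mul_le_mul_of_nonneg_left (hdet _ _ (hCm s hs)) h0.le).trans (le_max_right _ _)
  have hconst : ∀ z, E z = E 0 := fun z => hdiff.apply_eq_apply_of_bounded hbdd z 0
  have hlim : Tendsto E (atInftyIn (Dplus (1 / 2))) (𝓝 (-1 / 2)) := by
    have hγ : (1 / 2 : ℝ) < 1 := by norm_num
    -- In the whole half-plane only boundedness of the entry (0, 0) is at hand; the decay of the
    -- entry (1, 1) suffices for the product.
    have h00 : Tendsto (fun s => Xplus lam A B s 0 0 * Xplus lam A B s 1 1)
        (atInftyIn (Dplus (1 / 2))) (𝓝 0) := by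
      refine squeeze_zero_norm' (a := fun s => Cp * ‖Xplus lam A B s 1 1‖) ?_ ?_
      · filter_upwards [eventually_mem_atInftyIn _] with s hs
        rw [norm_mul]
        gcongr
        exact hCp s hs 0 0
      · simpa using (h.tendsto_Xplus_one_one h0 h1 hγ).norm.const_mul Cp
    have h2 := h00.sub ((h.tendsto_Xplus_zero_one h0 h1 hγ).mul
      (h.tendsto_Xplus_one_zero h0 h1 hγ))
    rw [show (0 : ℂ) - 1 / 2 * 1 = -1 / 2 by norm_num] at h2
    refine h2.congr' ?_
    filter_upwards [eventually_mem_atInftyIn _] with s hs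
    have hs' : s.re ≤ 1 / 2 := hs
    rw [hEp s (by linarith), Matrix.det_fin_two]
  have hE0 : E 0 = -1 / 2 := by
    have := neBot_atInftyIn_Dplus (γ := 1 / 2)
    refine tendsto_nhds_unique ?_ hlim
    rw [show E = fun _ => E 0 from funext hconst]
    exact tendsto_const_nhds
  constructor
  · intro s hs
    rw [← hEp s hs, hconst, hE0]
  · intro s hs
    have h2 := hEm s hs
    rw [hconst, hE0] at h2
    field_simp
    linear_combination 2 * h2

end Factors


/-! ### Orthogonality on the line of functions analytic in opposite half-planes. -/

lemma closure_re_lt (γ : ℝ) : closure {s : ℂ | s.re < γ} = Dplus γ :=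
  Complex.closure_setOfPred_re_lt γ

lemma closure_lt_re (γ : ℝ) : closure {s : ℂ | γ < s.re} = Dminus γ :=
  Complex.closure_setOfPred_lt_re γ

lemma DiffContOnCl.fun_mul {U : Set ℂ} {f g : ℂ → ℂ} (hf : DiffContOnCl ℂ f U)
    (hg : DiffContOnCl ℂ g U) : DiffContOnCl ℂ (fun s => f s * g s) U := hf.smul hg

lemma DiffContOnCl.fun_sum {U : Set ℂ} {ι : Type*} {t : Finset ι} {f : ι → ℂ → ℂ}
    (hf : ∀ i ∈ t, DiffContOnCl ℂ (f i) U) : DiffContOnCl ℂ (fun s => ∑ i ∈ t, f i s) U := by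
  classical
  induction t using Finset.induction_on with
  | empty => simpa using diffContOnCl_const
  | insert i t hi ih =>
    simp only [Finset.sum_insert hi]
    exact (hf i (Finset.mem_insert_self _ _)).add
      (ih fun j hj => hf j (Finset.mem_insert_of_mem hj))

/-- The line `Re s = γ`, parametrized. -/
def linePoint (γ t : ℝ) : ℂ := γ + t * I

lemma linePoint_re (γ t : ℝ) : (linePoint γ t).re = γ := by simp [linePoint]

lemma linePoint_mem_plus (γ t : ℝ) : linePoint γ t ∈ Dplus γ := (linePoint_re γ t).le

lemma linePoint_mem_minus (γ t : ℝ) : linePoint γ t ∈ Dminus γ := (linePoint_re γ t).ge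

lemma continuous_linePoint (γ : ℝ) : Continuous (linePoint γ) := by
  unfold linePoint; fun_prop

lemma eq_linePoint {γ : ℝ} {s : ℂ} (hs : s.re = γ) : s = linePoint γ s.im := by
  rw [linePoint, ← hs, Complex.re_add_im]

section Cauchy

variable {γ : ℝ}

lemma continuous_comp_linePoint {h : ℂ → ℂ} {D : Set ℂ} (hc : ContinuousOn h D)
    (hD : ∀ t, linePoint γ t ∈ D) : Continuous fun t => h (linePoint γ t) :=
  hc.comp_continuous (continuous_linePoint γ) hD

lemma norm_linePoint_sub (t : ℝ) : ‖linePoint γ t - γ‖ = |t| := by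
  simp [linePoint]

lemma integrable_of_norm_linePoint_le {h : ℝ → ℂ} (hc : Continuous h) {C : ℝ}
    (hb : ∀ t, ‖h t‖ ≤ C / (1 + |t|) ^ 2) : MeasureTheory.Integrable h := by
  refine ((integrable_inv_one_add_sq).const_mul |C|).mono' hc.aestronglyMeasurable
    (Eventually.of_forall fun t => (hb t).trans ?_)
  rw [div_eq_mul_inv]
  gcongr
  · exact le_abs_self C
  · have := sq_abs t
    nlinarith [abs_nonneg t]

/-- The integral over the boundary line vanishes for functions analytic in the half-plane with
quadratic decay. -/
lemma integral_line_eq_zero {h : ℂ → ℂ} (hd : DiffContOnCl ℂ h {s | s.re < γ}) {C : ℝ}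
    (hb : ∀ s ∈ Dplus γ, ‖h s‖ ≤ C / (1 + ‖s - γ‖) ^ 2) :
    ∫ t : ℝ, h (linePoint γ t) = 0 := by
  have hcont : ContinuousOn h (Dplus γ) := by
    rw [← closure_re_lt]; exact hd.continuousOn
  have hC : 0 ≤ C := by
    have := (norm_nonneg _).trans (hb γ (by simp [Dplus]))
    simpa using this
  have hint : MeasureTheory.Integrable fun t => h (linePoint γ t) :=
    integrable_of_norm_linePoint_le (continuous_comp_linePoint hcont (linePoint_mem_plus γ))
      fun t => by rw [← norm_linePoint_sub (γ := γ)]; exact hb _ (linePoint_mem_plus γ t)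
  have hlim := MeasureTheory.intervalIntegral_tendsto_integral hint
    (tendsto_neg_atBot_iff.2 (tendsto_id (α := ℝ) (x := atTop))) tendsto_id
  refine tendsto_nhds_unique hlim ?_
  have hzero : Tendsto (fun T : ℝ => 4 * C * T⁻¹) atTop (𝓝 0) := by
    simpa using tendsto_inv_atTop_zero.const_mul (4 * C)
  refine squeeze_zero_norm' ?_ hzero
  filter_upwards [eventually_gt_atTop 0] with T hT
  simp only [id]
  -- The rectangle of width T and height 2T has its right side on the line. The other three sides
  -- have total length 4T and the integrand there is at most C / T².
  set z : ℂ := ⟨γ - T, -T⟩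
  set w : ℂ := ⟨γ, T⟩
  have hsub : Set.uIcc z.re w.re ×ℂ Set.uIcc z.im w.im ⊆ Dplus γ := by
    intro s hs
    have h1 := (Complex.mem_reProdIm.1 hs).1
    rw [Set.uIcc_of_le (show γ - T ≤ γ by linarith)] at h1
    exact h1.2
  have hrect := Complex.integral_boundary_rect_eq_zero_of_continuousOn_of_differentiableOn h z w
    (hcont.mono hsub) (hd.differentiableOn.mono (by
      intro s hs
      have h1 := (Complex.mem_reProdIm.1 hs).1
      rw [max_eq_right (show γ - T ≤ γ by linarith)] at h1
      exact h1.2))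
  have hside : ∀ s ∈ Dplus γ, T ≤ ‖s - γ‖ → ‖h s‖ ≤ C * (T⁻¹ * T⁻¹) := by
    intro s hs hTs
    refine (hb s hs).trans ?_
    rw [div_eq_mul_inv, ← mul_inv, ← sq]
    gcongr
    linarith
  have h1 : ‖∫ x : ℝ in z.re..w.re, h (x + z.im * I)‖ ≤ C * (T⁻¹ * T⁻¹) * |w.re - z.re| := by
    refine intervalIntegral.norm_integral_le_of_norm_le_const fun x hx => ?_
    rw [Set.uIoc_of_le (show γ - T ≤ γ by linarith)] at hx
    refine hside _ (by simpa [Dplus] using hx.2) ?_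
    refine le_trans ?_ (Complex.abs_im_le_norm _)
    simp [z, abs_of_pos hT]
  have h2 : ‖∫ x : ℝ in z.re..w.re, h (x + w.im * I)‖ ≤ C * (T⁻¹ * T⁻¹) * |w.re - z.re| := by
    refine intervalIntegral.norm_integral_le_of_norm_le_const fun x hx => ?_
    rw [Set.uIoc_of_le (show γ - T ≤ γ by linarith)] at hx
    refine hside _ (by simpa [Dplus] using hx.2) ?_
    refine le_trans ?_ (Complex.abs_im_le_norm _)
    simp [w, abs_of_pos hT]
  have h3 : ‖∫ y : ℝ in z.im..w.im, h (z.re + y * I)‖ ≤ C * (T⁻¹ * T⁻¹) * |w.im - z.im| := by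
    refine intervalIntegral.norm_integral_le_of_norm_le_const fun x hx => ?_
    refine hside _ (by simp [Dplus, z, hT.le]) ?_
    refine le_trans ?_ (Complex.abs_re_le_norm _)
    simp [z, abs_of_pos hT]
  have e1 : |w.re - z.re| = T := by simp [z, w, abs_of_pos hT]
  have e2 : |w.im - z.im| = 2 * T := by
    simp only [z, w, sub_neg_eq_add]; rw [abs_of_pos (by linarith)]; ring
  rw [e1] at h1 h2
  rw [e2] at h3
  have e3 : (∫ y : ℝ in z.im..w.im, h (w.re + y * I)) =
      ∫ t in -T..T, h (linePoint γ t) := rfl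
  rw [e3] at hrect
  have h4 : I • (∫ t in -T..T, h (linePoint γ t)) =
      (∫ x : ℝ in z.re..w.re, h (x + w.im * I)) - (∫ x : ℝ in z.re..w.re, h (x + z.im * I)) +
      I • (∫ y : ℝ in z.im..w.im, h (z.re + y * I)) := by
    linear_combination hrect
  have h5 : ‖∫ t in -T..T, h (linePoint γ t)‖ = ‖I • (∫ t in -T..T, h (linePoint γ t))‖ := by
    rw [norm_smul, Complex.norm_I, one_mul]
  rw [h5, h4]
  refine (norm_add_le _ _).trans ((add_le_add_left (norm_sub_le _ _) _).trans ?_)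
  rw [norm_smul, Complex.norm_I, one_mul]
  have e6 : C * (T⁻¹ * T⁻¹) * T = C * T⁻¹ := by field_simp
  rw [e6] at h1 h2
  have e7 : C * (T⁻¹ * T⁻¹) * (2 * T) = 2 * (C * T⁻¹) := by field_simp
  rw [e7] at h3
  linarith

/-- Reflection of a function on `Re s ≥ γ` to a function on `Re s ≤ γ`, conjugate to it on the
line. -/
def reflect (γ : ℝ) (g : ℂ → ℂ) (s : ℂ) : ℂ :=
  (starRingEnd ℂ) (g (2 * γ - (starRingEnd ℂ) s))

lemma reflect_linePoint (g : ℂ → ℂ) (t : ℝ) :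
    reflect γ g (linePoint γ t) = (starRingEnd ℂ) (g (linePoint γ t)) := by
  unfold reflect linePoint
  congr 2
  simp
  ring

lemma diffContOnCl_reflect {g : ℂ → ℂ} (hg : DiffContOnCl ℂ g {s | γ < s.re}) :
    DiffContOnCl ℂ (reflect γ g) {s | s.re < γ} := by
  refine ⟨fun s hs => ?_, ?_⟩
  · have hs' : s.re < γ := hs
    have h1 : DifferentiableAt ℂ g (2 * γ - (starRingEnd ℂ) s) :=
      hg.differentiableAt (isOpen_re_gt γ) (by
        show γ < (2 * γ - (starRingEnd ℂ) s : ℂ).re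
        simp; linarith)
    have h2 : DifferentiableAt ℂ (fun z => g (2 * γ - z)) ((starRingEnd ℂ) s) :=
      h1.comp _ (by fun_prop)
    have h3 := h2.conj_conj
    rw [Complex.conj_conj] at h3
    exact h3.differentiableWithinAt
  · rw [closure_re_lt]
    have hc := hg.continuousOn
    rw [closure_lt_re] at hc
    refine Complex.continuous_conj.comp_continuousOn (hc.comp (by fun_prop) fun s hs => ?_)
    have hs' : s.re ≤ γ := hs
    show γ ≤ (2 * γ - (starRingEnd ℂ) s : ℂ).re
    simp; linarith

lemma norm_reflect_le {g : ℂ → ℂ} {C : ℝ} (hg : ∀ s ∈ Dminus γ, ‖g s‖ ≤ C / (1 + ‖s - γ‖)) :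
    ∀ s ∈ Dplus γ, ‖reflect γ g s‖ ≤ C / (1 + ‖s - γ‖) := by
  intro s hs
  have hs' : s.re ≤ γ := hs
  have h1 := hg (2 * γ - (starRingEnd ℂ) s) (by
    show γ ≤ (2 * γ - (starRingEnd ℂ) s : ℂ).re
    simp; linarith)
  have e : ‖2 * γ - (starRingEnd ℂ) s - γ‖ = ‖s - γ‖ := by
    rw [← Complex.norm_conj (s - γ), ← norm_neg]
    congr 1
    simp
    ring
  rw [e] at h1
  rwa [reflect, Complex.norm_conj]

/-- Compactness turns decay near infinity into a bound on the whole closed set, in the form needed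
for integration along the line. -/
lemma exists_decay {D : Set ℂ} (hD : IsClosed D) {u : ℂ → ℂ} (hu : ContinuousOn u D)
    (h : ∃ C R : ℝ, ∀ s ∈ D, R ≤ ‖s‖ → ‖u s‖ ≤ C / ‖s‖) :
    ∃ C : ℝ, 0 ≤ C ∧ ∀ s ∈ D, ‖u s‖ ≤ C / (1 + ‖s - γ‖) := by
  obtain ⟨C, R, hCR⟩ := h
  set R' := max R 1
  have hcomp : IsCompact (D ∩ Metric.closedBall 0 R') :=
    (isCompact_closedBall (0 : ℂ) R').inter_left hD
  obtain ⟨M, hM⟩ := hcomp.exists_bound_of_continuousOn (hu.mono Set.inter_subset_left)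
  have hn : ∀ s : ℂ, ‖s - γ‖ ≤ ‖s‖ + |γ| := fun s => by
    have := norm_sub_le s γ
    rwa [Complex.norm_real, Real.norm_eq_abs] at this
  have hγ := abs_nonneg γ
  refine ⟨max (|M| * (1 + R' + |γ|)) (|C| * (2 + |γ|)), ?_, fun s hs => ?_⟩
  · exact le_max_of_le_right (by positivity)
  · have hpos : 0 < 1 + ‖s - γ‖ := by positivity
    rw [le_div_iff₀ hpos]
    rcases le_total ‖s‖ R' with hsR | hsR
    · refine le_trans ?_ (le_max_left _ _)
      have h1 := hM s ⟨hs, by simpa using hsR⟩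
      exact mul_le_mul (h1.trans (le_abs_self M)) (by linarith [hn s]) hpos.le (abs_nonneg M)
    · refine le_trans ?_ (le_max_right _ _)
      have hs1 : 1 ≤ ‖s‖ := (le_max_right _ _).trans hsR
      have h1 := hCR s hs ((le_max_left _ _).trans hsR)
      have h2 : ‖u s‖ * ‖s‖ ≤ |C| := by
        rw [le_div_iff₀ (by linarith)] at h1
        exact h1.trans (le_abs_self C)
      have h3 : 1 + ‖s - γ‖ ≤ (2 + |γ|) * ‖s‖ := by nlinarith [hn s]
      calc ‖u s‖ * (1 + ‖s - γ‖) ≤ ‖u s‖ * ((2 + |γ|) * ‖s‖) := by gcongr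
        _ = ‖u s‖ * ‖s‖ * (2 + |γ|) := by ring
        _ ≤ _ := by gcongr

lemma isClosed_Dplus (γ : ℝ) : IsClosed (Dplus γ) :=
  isClosed_le Complex.continuous_re continuous_const

lemma isClosed_Dminus (γ : ℝ) : IsClosed (Dminus γ) :=
  isClosed_le continuous_const Complex.continuous_re

/-- Decaying functions analytic in the two half-planes are orthogonal on the line, hence they
cannot be close to each other there unless they vanish. -/
lemma eq_zero_of_close {f g : Fin 2 → ℂ → ℂ} (hf : ∀ i, DiffContOnCl ℂ (f i) {s | s.re < γ})
    (hg : ∀ i, DiffContOnCl ℂ (g i) {s | γ < s.re})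
    (hfd : ∀ i, ∃ C R : ℝ, ∀ s ∈ Dplus γ, R ≤ ‖s‖ → ‖f i s‖ ≤ C / ‖s‖)
    (hgd : ∀ i, ∃ C R : ℝ, ∀ s ∈ Dminus γ, R ≤ ‖s‖ → ‖g i s‖ ≤ C / ‖s‖)
    (hclose : ∀ s : ℂ, s.re = γ → ∑ i, ‖f i s - g i s‖ ^ 2 ≤
      1 / 2 * ∑ i, (‖f i s‖ ^ 2 + ‖g i s‖ ^ 2)) :
    ∀ i, f i γ = 0 ∧ g i γ = 0 := by
  have hfc : ∀ i, ContinuousOn (f i) (Dplus γ) := fun i => by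
    rw [← closure_re_lt]; exact (hf i).continuousOn
  have hgc : ∀ i, ContinuousOn (g i) (Dminus γ) := fun i => by
    rw [← closure_lt_re]; exact (hg i).continuousOn
  choose Cf hCf0 hCf using fun i => exists_decay (γ := γ) (isClosed_Dplus γ) (hfc i) (hfd i)
  choose Cg hCg0 hCg using fun i => exists_decay (γ := γ) (isClosed_Dminus γ) (hgc i) (hgd i)
  have hfl : ∀ i, Continuous fun t => f i (linePoint γ t) := fun i =>
    continuous_comp_linePoint (hfc i) (linePoint_mem_plus γ)
  have hgl : ∀ i, Continuous fun t => g i (linePoint γ t) := fun i =>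
    continuous_comp_linePoint (hgc i) (linePoint_mem_minus γ)
  have hfb : ∀ i t, ‖f i (linePoint γ t)‖ ≤ Cf i / (1 + |t|) := fun i t => by
    rw [← norm_linePoint_sub (γ := γ)]; exact hCf i _ (linePoint_mem_plus γ t)
  have hgb : ∀ i t, ‖g i (linePoint γ t)‖ ≤ Cg i / (1 + |t|) := fun i t => by
    rw [← norm_linePoint_sub (γ := γ)]; exact hCg i _ (linePoint_mem_minus γ t)
  have hprod : ∀ {u v : ℝ → ℂ} {a b : ℝ}, Continuous u → Continuous v →
      (∀ t, ‖u t‖ ≤ a / (1 + |t|)) → (∀ t, ‖v t‖ ≤ b / (1 + |t|)) →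
      MeasureTheory.Integrable fun t => u t * v t := by
    intro u v a b hu hv hua hvb
    refine integrable_of_norm_linePoint_le (C := a * b) (hu.mul hv) fun t => ?_
    rw [norm_mul]
    calc _ ≤ a / (1 + |t|) * (b / (1 + |t|)) :=
          mul_le_mul (hua t) (hvb t) (norm_nonneg _) ((norm_nonneg _).trans (hua t))
      _ = _ := by rw [div_mul_div_comm, sq]
  have hconj : ∀ {u : ℝ → ℂ}, Continuous u → Continuous fun t => (starRingEnd ℂ) (u t) :=
    fun hu => Complex.continuous_conj.comp hu
  have hsq : ∀ {u : ℝ → ℂ} {a : ℝ}, Continuous u → (∀ t, ‖u t‖ ≤ a / (1 + |t|)) →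
      MeasureTheory.Integrable fun t => ‖u t‖ ^ 2 := by
    intro u a hu hua
    have := (hprod hu (hconj hu) hua (fun t => by rw [Complex.norm_conj]; exact hua t)).re
    refine this.congr (Eventually.of_forall fun t => ?_)
    simp [Complex.mul_conj, Complex.normSq_eq_norm_sq, -Complex.ofReal_pow]
  -- On the line the conjugate of g is the boundary value of its reflection, which is analytic on
  -- the side of f. The product decays quadratically, so Cauchy's theorem applies.
  have horth : ∀ i, ∫ t : ℝ, f i (linePoint γ t) * (starRingEnd ℂ) (g i (linePoint γ t)) = 0 := by
    intro i
    have := integral_line_eq_zero (γ := γ) (h := fun s => f i s * reflect γ (g i) s)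
      (C := Cf i * Cg i) ((hf i).fun_mul (diffContOnCl_reflect (hg i))) (fun s hs => by
        rw [norm_mul]
        calc _ ≤ Cf i / (1 + ‖s - γ‖) * (Cg i / (1 + ‖s - γ‖)) :=
              mul_le_mul (hCf i s hs) (norm_reflect_le (hCg i) s hs) (norm_nonneg _)
                ((norm_nonneg _).trans (hCf i s hs))
          _ = _ := by rw [div_mul_div_comm, sq])
    simpa only [reflect_linePoint] using this
  set S : ℝ → ℝ := fun t => ∑ i, (‖f i (linePoint γ t)‖ ^ 2 + ‖g i (linePoint γ t)‖ ^ 2) with hS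
  have hSint : MeasureTheory.Integrable S := MeasureTheory.integrable_finsetSum _ fun i _ =>
    (hsq (hfl i) (hfb i)).add (hsq (hgl i) (hgb i))
  have hSc : Continuous S := by
    refine continuous_finsetSum _ fun i _ => ?_
    exact ((hfl i).norm.pow 2).add ((hgl i).norm.pow 2)
  set P : ℝ → ℝ := fun t =>
    ∑ i, (f i (linePoint γ t) * (starRingEnd ℂ) (g i (linePoint γ t))).re with hP
  have hPi : ∀ i, MeasureTheory.Integrable fun t =>
      f i (linePoint γ t) * (starRingEnd ℂ) (g i (linePoint γ t)) := fun i =>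
    hprod (hfl i) (hconj (hgl i)) (hfb i) fun t => by rw [Complex.norm_conj]; exact hgb i t
  have hPint : MeasureTheory.Integrable P := MeasureTheory.integrable_finsetSum _ fun i _ =>
    (hPi i).re
  have hP0 : ∫ t, P t = 0 := by
    simp only [hP]
    refine (MeasureTheory.integral_finsetSum _ fun i _ => (hPi i).re).trans ?_
    refine Finset.sum_eq_zero fun i _ => ?_
    have := integral_re (hPi i)
    rw [horth i] at this
    simpa using this
  -- Expanding the square gives S - 2P ≤ S / 2. Since P integrates to zero, so does S.
  have hle : ∀ t, 1 / 2 * S t ≤ 2 * P t := by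
    intro t
    have h1 := hclose (linePoint γ t) (linePoint_re γ t)
    have h2 : ∑ i, ‖f i (linePoint γ t) - g i (linePoint γ t)‖ ^ 2 = S t - 2 * P t := by
      simp only [hS, hP, Finset.mul_sum]
      rw [← Finset.sum_sub_distrib]
      refine Finset.sum_congr rfl fun i _ => ?_
      rw [Complex.sq_norm, Complex.normSq_sub, Complex.normSq_eq_norm_sq,
        Complex.normSq_eq_norm_sq]
    rw [h2] at h1
    linarith
  have hS0 : ∀ t, 0 ≤ S t := fun t => Finset.sum_nonneg fun i _ => by positivity
  have hSint0 : ∫ t, S t = 0 := by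
    refine le_antisymm ?_ (MeasureTheory.integral_nonneg hS0)
    have := MeasureTheory.integral_mono (hSint.const_mul (1 / 2)) (hPint.const_mul 2) hle
    rw [MeasureTheory.integral_const_mul, MeasureTheory.integral_const_mul, hP0] at this
    linarith
  have hae := (MeasureTheory.integral_eq_zero_iff_of_nonneg hS0 hSint).1 hSint0
  have hzero : S = 0 := (hSc.ae_eq_iff_eq MeasureTheory.volume continuous_zero).1 hae
  intro i
  have h0 := congrFun hzero 0
  simp only [hS, Pi.zero_apply] at h0
  have hi := (Finset.sum_eq_zero_iff_of_nonneg fun j _ => by positivity).1 h0 i (Finset.mem_univ i)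
  have e : linePoint γ 0 = γ := by simp [linePoint]
  rw [e] at hi
  have h1 : ‖f i γ‖ ^ 2 = 0 := by nlinarith [sq_nonneg ‖f i γ‖, sq_nonneg ‖g i γ‖]
  have h2 : ‖g i γ‖ ^ 2 = 0 := by nlinarith [sq_nonneg ‖f i γ‖, sq_nonneg ‖g i γ‖]
  exact ⟨by simpa using h1, by simpa using h2⟩

end Cauchy


/-! ### Bounded factors with bounded inverses. -/

/-- Matrix functions on `closure U` which are bounded with bounded inverse, and analytic in `U`. -/
structure GoodFactor (U : Set ℂ) (X : ℂ → Matrix (Fin 2) (Fin 2) ℂ) : Prop where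
  diff : ∀ i j, DiffContOnCl ℂ (fun s => X s i j) U
  bdd : ∃ C : ℝ, ∀ s ∈ closure U, ∀ i j, ‖X s i j‖ ≤ C
  det_ge : ∃ c : ℝ, 0 < c ∧ ∀ s ∈ closure U, c ≤ ‖(X s).det‖

section GoodFactor

variable {U : Set ℂ} {X Y : ℂ → Matrix (Fin 2) (Fin 2) ℂ}

lemma norm_det_le {M : Matrix (Fin 2) (Fin 2) ℂ} {C : ℝ} (hM : ∀ i l, ‖M i l‖ ≤ C) :
    ‖M.det‖ ≤ C * C + C * C := by
  have hC : 0 ≤ C := (norm_nonneg _).trans (hM 0 0)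
  rw [Matrix.det_fin_two]
  refine (norm_sub_le _ _).trans ?_
  rw [norm_mul, norm_mul]
  gcongr <;> exact hM _ _

lemma GoodFactor.det_ne_zero (hX : GoodFactor U X) {s : ℂ} (hs : s ∈ closure U) :
    (X s).det ≠ 0 := by
  obtain ⟨c, hc, h⟩ := hX.det_ge
  exact norm_pos_iff.1 (hc.trans_le (h s hs))

lemma inv_apply_eq (M : Matrix (Fin 2) (Fin 2) ℂ) (i j : Fin 2) :
    M⁻¹ i j = M.det⁻¹ * M.adjugate i j := by
  rw [Matrix.inv_def, Matrix.smul_apply, Ring.inverse_eq_inv', smul_eq_mul]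

lemma diffContOnCl_adjugate (h : ∀ i j, DiffContOnCl ℂ (fun s => X s i j) U) (i j : Fin 2) :
    DiffContOnCl ℂ (fun s => (X s).adjugate i j) U := by
  simp only [Matrix.adjugate_fin_two]
  fin_cases i <;> fin_cases j
  · exact h 1 1
  · exact (h 0 1).neg
  · exact (h 1 0).neg
  · exact h 0 0

lemma diffContOnCl_inv (h : ∀ i j, DiffContOnCl ℂ (fun s => X s i j) U)
    (hdet : ∀ s ∈ closure U, (X s).det ≠ 0) (i j : Fin 2) :
    DiffContOnCl ℂ (fun s => (X s)⁻¹ i j) U := by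
  simp only [inv_apply_eq]
  refine DiffContOnCl.fun_mul (DiffContOnCl.inv ?_ hdet) (diffContOnCl_adjugate h i j)
  simp only [Matrix.det_fin_two]
  exact ((h 0 0).fun_mul (h 1 1)).sub ((h 0 1).fun_mul (h 1 0))

lemma norm_adjugate_le {M : Matrix (Fin 2) (Fin 2) ℂ} {C : ℝ} (hM : ∀ i l, ‖M i l‖ ≤ C)
    (i j : Fin 2) : ‖M.adjugate i j‖ ≤ C := by
  rw [Matrix.adjugate_fin_two]
  fin_cases i <;> fin_cases j
  · exact hM 1 1
  · simpa using hM 0 1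
  · simpa using hM 1 0
  · exact hM 0 0

lemma diffContOnCl_matrix_mul (hX : ∀ i j, DiffContOnCl ℂ (fun s => X s i j) U)
    (hY : ∀ i j, DiffContOnCl ℂ (fun s => Y s i j) U) (i j : Fin 2) :
    DiffContOnCl ℂ (fun s => (X s * Y s) i j) U := by
  simp only [Matrix.mul_apply]
  exact DiffContOnCl.fun_sum fun k _ => (hX i k).fun_mul (hY k j)

lemma norm_mul_apply_le {M N : Matrix (Fin 2) (Fin 2) ℂ} {a b : ℝ} {i j : Fin 2}
    (ha : ∀ k, ‖M i k‖ ≤ a) (hb : ∀ k, ‖N k j‖ ≤ b) : ‖(M * N) i j‖ ≤ 2 * (a * b) := by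
  have ha0 : 0 ≤ a := (norm_nonneg _).trans (ha 0)
  rw [Matrix.mul_apply, Fin.sum_univ_two]
  refine (norm_add_le _ _).trans ?_
  rw [norm_mul, norm_mul, two_mul]
  gcongr
  · exact ha 0
  · exact hb 0
  · exact ha 1
  · exact hb 1

lemma GoodFactor.mul (hX : GoodFactor U X) (hY : GoodFactor U Y) :
    GoodFactor U fun s => X s * Y s := by
  obtain ⟨C, hC⟩ := hX.bdd
  obtain ⟨C', hC'⟩ := hY.bdd
  obtain ⟨c, hc, h⟩ := hX.det_ge
  obtain ⟨c', hc', h'⟩ := hY.det_ge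
  refine ⟨diffContOnCl_matrix_mul hX.diff hY.diff,
    ⟨2 * (C * C'), fun s hs i j => norm_mul_apply_le (hC s hs i) fun k => hC' s hs k j⟩,
    ⟨c * c', by positivity, fun s hs => ?_⟩⟩
  rw [Matrix.det_mul, norm_mul]
  gcongr
  · exact h s hs
  · exact h' s hs

lemma GoodFactor.inv (hX : GoodFactor U X) : GoodFactor U fun s => (X s)⁻¹ := by
  obtain ⟨C, hC⟩ := hX.bdd
  obtain ⟨c, hc, h⟩ := hX.det_ge
  refine ⟨diffContOnCl_inv hX.diff fun s => hX.det_ne_zero,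
    ⟨c⁻¹ * C, fun s hs i j => ?_⟩, ⟨(C * C + C * C + 1)⁻¹, ?_, fun s hs => ?_⟩⟩
  · rw [inv_apply_eq, norm_mul, norm_inv]
    gcongr
    · exact h s hs
    · exact norm_adjugate_le (hC s hs) i j
  · have := mul_self_nonneg C
    positivity
  · rw [Matrix.det_nonsing_inv, Ring.inverse_eq_inv', norm_inv]
    have := norm_pos_iff.2 (hX.det_ne_zero hs)
    gcongr
    linarith [norm_det_le (hC s hs)]

/-- The lower bound for the determinant keeps each column away from zero: |det| is at most twice the
norm of the column times a bound for the other entries. -/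
lemma GoodFactor.hasOrder (hX : GoodFactor U X) (j : Fin 2) :
    HasOrderAtInfty (closure U) (fun s i => X s i j) 0 ∧
    HasOrderAtInfty (closure U) (fun s => (X s).det) 0 := by
  obtain ⟨C, hC⟩ := hX.bdd
  obtain ⟨c, hc, h⟩ := hX.det_ge
  refine ⟨⟨c / (2 * (|C| + 1)), |C|, 0, by positivity, fun s hs _ => ?_⟩,
    ⟨c, C * C + C * C, 0, hc, fun s hs _ => ?_⟩⟩
  · rw [zpow_zero, one_smul]
    constructor
    · rw [div_le_iff₀ (by positivity)]
      refine (h s hs).trans ?_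
      have hcol : ∀ i, ‖X s i j‖ ≤ ‖fun i => X s i j‖ := fun i =>
        norm_le_pi_norm (fun i => X s i j) i
      have hC' : ∀ i k, ‖X s i k‖ ≤ |C| + 1 := fun i k =>
        (hC s hs i k).trans (by linarith [le_abs_self C])
      rw [Matrix.det_fin_two]
      refine (norm_sub_le _ _).trans ?_
      rw [norm_mul, norm_mul]
      have hn := norm_nonneg fun i => X s i j
      fin_cases j
      · have h1 := mul_le_mul (hcol 0) (hC' 1 1) (norm_nonneg _) hn
        have h2 := mul_le_mul (hC' 0 1) (hcol 1) (norm_nonneg _) (by positivity)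
        simp only [Fin.zero_eta] at h1 h2 ⊢
        linarith
      · have h1 := mul_le_mul (hC' 0 0) (hcol 1) (norm_nonneg _) (by positivity)
        have h2 := mul_le_mul (hcol 0) (hC' 1 0) (norm_nonneg _) hn
        simp only [Fin.mk_one] at h1 h2 ⊢
        linarith
    · rw [pi_norm_le_iff_of_nonneg (abs_nonneg C)]
      exact fun i => (hC s hs i j).trans (le_abs_self C)
  · rw [zpow_zero, one_smul]
    exact ⟨h s hs, norm_det_le (hC s hs)⟩

end GoodFactor

/-! ### Stability of zero indices among nearby matrix functions that have indices. -/

section Canonical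

variable {γ : ℝ} {G Xp Xm : ℂ → Matrix (Fin 2) (Fin 2) ℂ}

lemma isCanonicalFactorization_zero (hp : GoodFactor {s | s.re < γ} Xp)
    (hm : GoodFactor {s | γ < s.re} Xm) (hG : ∀ s : ℂ, s.re = γ → G s * Xm s = Xp s) :
    IsCanonicalFactorization γ G Xp Xm fun _ => 0 where
  analytic_plus := hp.diff
  analytic_minus := hm.diff
  factor s hs := by
    have hu : IsUnit (Xm s).det := isUnit_iff_ne_zero.2 (hm.det_ne_zero (by
      rw [closure_lt_re]; exact hs.ge))
    rw [← hG s hs, Matrix.mul_nonsing_inv_cancel_right _ _ hu]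
  det_plus s hs := hp.det_ne_zero (by rwa [closure_re_lt])
  det_minus s hs := hm.det_ne_zero (by rwa [closure_lt_re])
  order_plus j := by rw [← closure_re_lt]; exact (hp.hasOrder j).1
  order_minus j := by rw [← closure_lt_re]; exact (hm.hasOrder j).1
  normal_plus := by rw [← closure_re_lt]; simpa using (hp.hasOrder 0).2
  normal_minus := by rw [← closure_lt_re]; simpa using (hm.hasOrder 0).2

/-- A column of positive order decays. -/
lemma HasOrderAtInfty.exists_col_le {D : Set ℂ} {Y : ℂ → Matrix (Fin 2) (Fin 2) ℂ} {j : Fin 2}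
    {κ : ℤ} (h : HasOrderAtInfty D (fun s i => Y s i j) κ) (hκ : 1 ≤ κ) :
    ∃ C R : ℝ, 1 ≤ R ∧ ∀ s ∈ D, R ≤ ‖s‖ → ∀ i, ‖Y s i j‖ ≤ C / ‖s‖ := by
  obtain ⟨c, C, R, -, hb⟩ := h
  refine ⟨C, max R 1, le_max_right _ _, fun s hs hR i => ?_⟩
  have hs1 : 1 ≤ ‖s‖ := (le_max_right _ _).trans hR
  have h1 := (hb s hs ((le_max_left _ _).trans hR)).2
  rw [norm_smul, norm_zpow] at h1
  rw [le_div_iff₀ (by linarith), mul_comm]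
  refine le_trans ?_ h1
  gcongr
  · calc ‖s‖ = ‖s‖ ^ (1 : ℤ) := (zpow_one _).symm
      _ ≤ ‖s‖ ^ κ := zpow_le_zpow_right₀ hs1 hκ
  · exact norm_le_pi_norm (fun i => Y s i j) i

/-- A row of the inverse decays if the corresponding column has negative order. -/
lemma exists_inv_row_le {D : Set ℂ} {Y : ℂ → Matrix (Fin 2) (Fin 2) ℂ} {κ : Fin 2 → ℤ}
    (h : ∀ j, HasOrderAtInfty D (fun s i => Y s i j) (κ j))
    (hdet : HasOrderAtInfty D (fun s => (Y s).det) (∑ j, κ j)) {j : Fin 2} (hκ : κ j ≤ -1) :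
    ∃ C R : ℝ, 1 ≤ R ∧ ∀ s ∈ D, R ≤ ‖s‖ → ∀ k, ‖(Y s)⁻¹ j k‖ ≤ C / ‖s‖ := by
  obtain ⟨c, _, R, hc, hb⟩ := hdet
  -- Row j of the adjugate is, up to signs and order, the other column. After division by the
  -- determinant it is of size |s|^(κ j), hence O(1/|s|).
  obtain ⟨_, C, R', -, hb'⟩ := h (1 - j)
  refine ⟨c⁻¹ * C, max (max R R') 1, le_max_right _ _, fun s hs hR k => ?_⟩
  have hs1 : 1 ≤ ‖s‖ := (le_max_right _ _).trans hR
  have hs0 : 0 < ‖s‖ := by linarith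
  have h1 := (hb s hs (((le_max_left _ _).trans (le_max_left _ _)).trans hR)).1
  have h2 := (hb' s hs (((le_max_right _ _).trans (le_max_left _ _)).trans hR)).2
  rw [norm_smul, norm_zpow] at h1 h2
  have hsum : ∑ j, κ j = κ j + κ (1 - j) := by
    rw [Fin.sum_univ_two]
    fin_cases j
    · simp
    · simp [add_comm]
  rw [hsum] at h1
  have hadj : ‖(Y s).adjugate j k‖ ≤ ‖fun i => Y s i (1 - j)‖ := by
    have hcol : ∀ i, ‖Y s i (1 - j)‖ ≤ ‖fun i => Y s i (1 - j)‖ := fun i =>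
      norm_le_pi_norm (fun i => Y s i (1 - j)) i
    rw [Matrix.adjugate_fin_two]
    fin_cases j <;> fin_cases k
    · simpa using hcol 1
    · simpa using hcol 0
    · simpa using hcol 1
    · simpa using hcol 0
  have h3 : ‖s‖ ^ κ (1 - j) * ‖(Y s).adjugate j k‖ ≤ C := le_trans (by gcongr) h2
  have hdpos : 0 < ‖(Y s).det‖ := by
    by_contra! h0
    have : ‖s‖ ^ (κ j + κ (1 - j)) * ‖(Y s).det‖ ≤ 0 :=
      mul_nonpos_of_nonneg_of_nonpos (by positivity) h0
    linarith
  rw [inv_apply_eq, norm_mul, norm_inv]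
  have hz1 : 0 < ‖s‖ ^ κ (1 - j) := by positivity
  have hz : ‖s‖ ^ κ j * ‖s‖ ≤ 1 := by
    rw [← zpow_add_one₀ hs0.ne']
    exact zpow_le_one_of_nonpos₀ hs1 (by omega)
  rw [zpow_add₀ hs0.ne'] at h1
  have hC0 : 0 ≤ C := le_trans (by positivity) h3
  have h4 : ‖(Y s).det‖⁻¹ ≤ c⁻¹ * (‖s‖ ^ κ j * ‖s‖ ^ κ (1 - j)) := by
    rw [inv_le_iff_one_le_mul₀ hdpos, mul_assoc, ← div_eq_inv_mul, one_le_div hc]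
    exact h1
  rw [le_div_iff₀ hs0]
  calc ‖(Y s).det‖⁻¹ * ‖(Y s).adjugate j k‖ * ‖s‖
      ≤ c⁻¹ * (‖s‖ ^ κ j * ‖s‖ ^ κ (1 - j)) * ‖(Y s).adjugate j k‖ * ‖s‖ := by gcongr
    _ = c⁻¹ * (‖s‖ ^ κ (1 - j) * ‖(Y s).adjugate j k‖) * (‖s‖ ^ κ j * ‖s‖) := by ring
    _ ≤ c⁻¹ * C * 1 := by gcongr
    _ = c⁻¹ * C := mul_one _

/-- Two entries of size at most 1/4 give |u i|² ≤ ⅛ ∑ |v|², so a perturbation of this size meets the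
closeness condition of `eq_zero_of_close`. -/
lemma sum_sq_le_of_mul {E : Fin 2 → Fin 2 → ℂ} {u v w : Fin 2 → ℂ} (hE : ∀ i k, ‖E i k‖ ≤ 1 / 4)
    (h : ∀ i, u i = ∑ k, E i k * v k) (hv : ∑ i, ‖v i‖ ^ 2 ≤ ∑ i, (‖v i‖ ^ 2 + ‖w i‖ ^ 2)) :
    ∑ i, ‖u i‖ ^ 2 ≤ 1 / 2 * ∑ i, (‖v i‖ ^ 2 + ‖w i‖ ^ 2) := by
  have key : ∀ i, ‖u i‖ ≤ 1 / 4 * (‖v 0‖ + ‖v 1‖) := by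
    intro i
    rw [h, Fin.sum_univ_two]
    refine (norm_add_le _ _).trans ?_
    rw [norm_mul, norm_mul, mul_add]
    gcongr <;> exact hE _ _
  have h2 : ∀ i, ‖u i‖ ^ 2 ≤ 1 / 8 * ∑ i, ‖v i‖ ^ 2 := by
    intro i
    rw [Fin.sum_univ_two]
    have h0 := norm_nonneg (u i)
    nlinarith [key i, sq_nonneg (‖v 0‖ - ‖v 1‖), norm_nonneg (v 0), norm_nonneg (v 1)]
  have h3 : ∑ i, ‖u i‖ ^ 2 ≤ 1 / 4 * ∑ i, ‖v i‖ ^ 2 := by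
    rw [Fin.sum_univ_two (fun i => ‖u i‖ ^ 2)]
    linarith [h2 0, h2 1]
  have h4 : 0 ≤ ∑ i, ‖v i‖ ^ 2 := Finset.sum_nonneg fun i _ => by positivity
  linarith

/-- If `G` has a factorization with zero indices, then no nearby matrix function has partial
indices other than zero. -/
lemma exists_indices_eq_zero (hp : GoodFactor {s | s.re < γ} Xp)
    (hm : GoodFactor {s | γ < s.re} Xm) (hG : ∀ s : ℂ, s.re = γ → G s * Xm s = Xp s) :
    ∃ ε : ℝ, 0 < ε ∧ ∀ (G' : ℂ → Matrix (Fin 2) (Fin 2) ℂ) (κ : Fin 2 → ℤ),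
      (∀ s : ℂ, s.re = γ → ∀ i j, ‖G' s i j - G s i j‖ < ε) → HasPartialIndices γ G' κ →
        ∀ j, κ j = 0 := by
  obtain ⟨C, hC⟩ := hp.inv.bdd
  obtain ⟨C', hC'⟩ := hm.bdd
  obtain ⟨Cp, hCp⟩ := hp.bdd
  obtain ⟨Cm, hCm⟩ := hm.inv.bdd
  rw [closure_re_lt] at hC hCp
  rw [closure_lt_re] at hC' hCm
  have hmem : (γ : ℂ) ∈ Dplus γ := by simp [Dplus]
  have hmem' : (γ : ℂ) ∈ Dminus γ := by simp [Dminus]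
  have hC0 : 0 ≤ C := (norm_nonneg _).trans (hC γ hmem 0 0)
  have hC'0 : 0 ≤ C' := (norm_nonneg _).trans (hC' γ hmem' 0 0)
  -- Each of the two 2 × 2 products costs a factor 2, so the entries of (X⁺)⁻¹ (G' - G) X⁻ are at
  -- most 4 ε C C' ≤ 1/4.
  set ε : ℝ := 1 / (16 * (C * C' + 1)) with hε
  have hε0 : 0 < ε := by positivity
  have hsmall : 2 * (C * (2 * (ε * C'))) ≤ 1 / 4 := by
    have : 2 * (C * (2 * (ε * C'))) = 1 / 4 * (C * C' / (C * C' + 1)) := by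
      rw [hε]; field_simp; ring
    rw [this]
    have : C * C' / (C * C' + 1) ≤ 1 := (div_le_one (by positivity)).2 (by linarith)
    linarith
  refine ⟨ε, hε0, fun G' κ hG' ⟨Yp, Ym, hY⟩ j => ?_⟩
  have hdetp : ∀ s ∈ Dplus γ, IsUnit (Yp s).det := fun s hs =>
    isUnit_iff_ne_zero.2 (hY.det_plus s hs)
  have hdetm : ∀ s ∈ Dminus γ, IsUnit (Ym s).det := fun s hs =>
    isUnit_iff_ne_zero.2 (hY.det_minus s hs)
  have hXp : ∀ s ∈ Dplus γ, IsUnit (Xp s).det := fun s hs =>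
    isUnit_iff_ne_zero.2 (hp.det_ne_zero (by rwa [closure_re_lt]))
  have hXm : ∀ s ∈ Dminus γ, IsUnit (Xm s).det := fun s hs =>
    isUnit_iff_ne_zero.2 (hm.det_ne_zero (by rwa [closure_lt_re]))
  set E : ℂ → Matrix (Fin 2) (Fin 2) ℂ := fun s => (Xp s)⁻¹ * ((G' s - G s) * Xm s) with hEdef
  have hE : ∀ s : ℂ, s.re = γ → ∀ i k, ‖E s i k‖ ≤ 1 / 4 := by
    intro s hs i k
    refine (norm_mul_apply_le (fun k => hC s hs.le i k) fun k' =>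
      norm_mul_apply_le (a := ε) (b := C') (fun l => ?_) fun l => hC' s hs.ge l k).trans hsmall
    rw [Matrix.sub_apply]
    exact (hG' s hs _ _).le
  have hH : ∀ s : ℂ, s.re = γ → (Xp s)⁻¹ * (G' s * Xm s) = 1 + E s := by
    intro s hs
    simp only [hEdef]
    rw [sub_mul, mul_sub, hG s hs, Matrix.nonsing_inv_mul _ (hXp s hs.le)]
    abel
  have hY' : ∀ s : ℂ, s.re = γ → G' s * Ym s = Yp s := by
    intro s hs
    rw [hY.factor s hs, Matrix.nonsing_inv_mul_cancel_right _ _ (hdetm s hs.ge)]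
  rcases lt_trichotomy (κ j) 0 with hκ | hκ | hκ
  -- Negative index: row j of the inverses of Y^± decays. Multiplied by X^± on the right it gives
  -- two row functions which on the line differ by the factor 1 + E.
  · exfalso
    obtain ⟨C1, R1, hR1, h1⟩ := exists_inv_row_le hY.order_plus hY.normal_plus
      (by omega : κ j ≤ -1)
    obtain ⟨C2, R2, hR2, h2⟩ := exists_inv_row_le hY.order_minus hY.normal_minus
      (by omega : κ j ≤ -1)
    have hz := eq_zero_of_close (γ := γ) (f := fun i s => ((Yp s)⁻¹ * Xp s) j i)
      (g := fun i s => ((Ym s)⁻¹ * Xm s) j i)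
      (fun i => diffContOnCl_matrix_mul (diffContOnCl_inv hY.analytic_plus (by
        rw [closure_re_lt]; exact hY.det_plus)) hp.diff j i)
      (fun i => diffContOnCl_matrix_mul (diffContOnCl_inv hY.analytic_minus (by
        rw [closure_lt_re]; exact hY.det_minus)) hm.diff j i)
      (fun i => ⟨2 * (C1 * Cp), R1, fun s hs hR => (norm_mul_apply_le (h1 s hs hR)
        fun k => hCp s hs k i).trans (le_of_eq (by ring))⟩)
      (fun i => ⟨2 * (C2 * C'), R2, fun s hs hR => (norm_mul_apply_le (h2 s hs hR)
        fun k => hC' s hs k i).trans (le_of_eq (by ring))⟩) ?_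
    · have hrow : ∀ i, ((Yp γ)⁻¹ * Xp γ) j i = 0 := fun i => (hz i).1
      have : (((Yp γ)⁻¹ * Xp γ) * ((Xp γ)⁻¹ * Yp γ)) j j = 0 := by
        rw [Matrix.mul_apply]
        exact Finset.sum_eq_zero fun k _ => by rw [hrow k, zero_mul]
      rw [Matrix.mul_assoc, Matrix.mul_nonsing_inv_cancel_left _ _ (hXp _ hmem),
        Matrix.nonsing_inv_mul _ (hdetp _ hmem), Matrix.one_apply_eq] at this
      exact one_ne_zero this
    · intro s hs
      have hinv : (Ym s)⁻¹ = (Yp s)⁻¹ * G' s := by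
        rw [← Matrix.mul_nonsing_inv_cancel_right (Ym s) ((Yp s)⁻¹ * G' s) (hdetm s hs.ge),
          Matrix.mul_assoc _ (G' s), hY' s hs, Matrix.nonsing_inv_mul _ (hdetp s hs.le),
          Matrix.one_mul]
      have hfg : (Ym s)⁻¹ * Xm s = (Yp s)⁻¹ * Xp s * (1 + E s) := by
        rw [hinv, ← hH s hs, Matrix.mul_assoc, Matrix.mul_assoc,
          Matrix.mul_nonsing_inv_cancel_left _ _ (hXp s hs.le)]
      simp only [hfg]
      have := sum_sq_le_of_mul (E := fun i k => E s k i)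
        (u := fun i => ((Yp s)⁻¹ * Xp s * E s) j i)
        (v := fun i => ((Yp s)⁻¹ * Xp s) j i)
        (w := fun i => ((Yp s)⁻¹ * Xp s * (1 + E s)) j i) (fun i k => hE s hs k i)
        (fun i => by
          rw [Matrix.mul_apply]
          exact Finset.sum_congr rfl fun k _ => mul_comm _ _) (Finset.sum_le_sum fun i _ => by
          linarith [sq_nonneg ‖((Yp s)⁻¹ * Xp s * (1 + E s)) j i‖])
      refine le_trans (le_of_eq ?_) this
      refine Finset.sum_congr rfl fun i _ => ?_
      rw [← Matrix.sub_apply, mul_add, mul_one, sub_add_cancel_left, Matrix.neg_apply, norm_neg]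
  · exact hκ
  -- Positive index: column j of Y^± decays. Multiplied by the inverses of X^± on the left it gives
  -- two column functions which on the line differ by the factor 1 + E.
  · exfalso
    obtain ⟨C1, R1, hR1, h1⟩ := (hY.order_plus j).exists_col_le hκ
    obtain ⟨C2, R2, hR2, h2⟩ := (hY.order_minus j).exists_col_le hκ
    have hz := eq_zero_of_close (γ := γ) (f := fun i s => ((Xp s)⁻¹ * Yp s) i j)
      (g := fun i s => ((Xm s)⁻¹ * Ym s) i j)
      (fun i => diffContOnCl_matrix_mul hp.inv.diff hY.analytic_plus i j)
      (fun i => diffContOnCl_matrix_mul hm.inv.diff hY.analytic_minus i j)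
      (fun i => ⟨2 * (C * C1), R1, fun s hs hR => (norm_mul_apply_le (hC s hs i)
        fun k => h1 s hs hR k).trans (le_of_eq (by ring))⟩)
      (fun i => ⟨2 * (Cm * C2), R2, fun s hs hR => (norm_mul_apply_le (hCm s hs i)
        fun k => h2 s hs hR k).trans (le_of_eq (by ring))⟩) ?_
    · have hcol : ∀ i, ((Xp γ)⁻¹ * Yp γ) i j = 0 := fun i => (hz i).1
      have : (((Yp γ)⁻¹ * Xp γ) * ((Xp γ)⁻¹ * Yp γ)) j j = 0 := by
        rw [Matrix.mul_apply]
        exact Finset.sum_eq_zero fun k _ => by rw [hcol k, mul_zero]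
      rw [Matrix.mul_assoc, Matrix.mul_nonsing_inv_cancel_left _ _ (hXp _ hmem),
        Matrix.nonsing_inv_mul _ (hdetp _ hmem), Matrix.one_apply_eq] at this
      exact one_ne_zero this
    · intro s hs
      have hfg : (Xp s)⁻¹ * Yp s = (1 + E s) * ((Xm s)⁻¹ * Ym s) := by
        rw [← hH s hs, ← hY' s hs, Matrix.mul_assoc, Matrix.mul_assoc,
          Matrix.mul_nonsing_inv_cancel_left _ _ (hXm s hs.ge)]
      simp only [hfg]
      have := sum_sq_le_of_mul (E := E s) (u := fun i => (E s * ((Xm s)⁻¹ * Ym s)) i j)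
        (v := fun i => ((Xm s)⁻¹ * Ym s) i j)
        (w := fun i => ((1 + E s) * ((Xm s)⁻¹ * Ym s)) i j) (hE s hs)
        (fun i => Matrix.mul_apply) (Finset.sum_le_sum fun i _ => by
          linarith [sq_nonneg ‖((1 + E s) * ((Xm s)⁻¹ * Ym s)) i j‖])
      refine le_trans (le_of_eq ?_) (this.trans (le_of_eq ?_))
      · refine Finset.sum_congr rfl fun i _ => ?_
        rw [← Matrix.sub_apply, add_mul, one_mul, add_sub_cancel_left]
      · congr 1
        exact Finset.sum_congr rfl fun i _ => add_comm _ _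

end Canonical


end

noncomputable section

open MeasureTheory FourierTransform Convolution

/-! ### Laplace transforms and the analytic splitting of a Fourier integral. -/

/-- The Laplace transform of a function on the positive half-line. -/
def lap (f : ℝ → ℂ) (z : ℂ) : ℂ := ∫ x : ℝ in Set.Ioi 0, cexp (-z * x) * f x

lemma norm_lap_integrand_le {f : ℝ → ℂ} {z : ℂ} (hz : 0 ≤ z.re) {x : ℝ} (hx : 0 < x) :
    ‖cexp (-z * x) * f x‖ ≤ ‖f x‖ := by
  rw [norm_mul, Complex.norm_exp]
  refine mul_le_of_le_one_left (norm_nonneg _) (Real.exp_le_one_iff.2 ?_)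
  have : (-z * x).re = -(z.re * x) := by simp
  rw [this]
  exact neg_nonpos.2 (by positivity)

lemma aestronglyMeasurable_lap {f : ℝ → ℂ} (hf : Integrable f) (z : ℂ) :
    AEStronglyMeasurable (fun x : ℝ => cexp (-z * x) * f x) (volume.restrict (Set.Ioi 0)) :=
  (by fun_prop : Continuous fun x : ℝ => cexp (-z * x)).aestronglyMeasurable.mul
    hf.1.restrict

lemma norm_lap_le {f : ℝ → ℂ} (hf : Integrable f) {z : ℂ} (hz : 0 ≤ z.re) :
    ‖lap f z‖ ≤ ∫ x, ‖f x‖ := by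
  refine (norm_integral_le_of_norm_le hf.norm.integrableOn
    ((ae_restrict_mem measurableSet_Ioi).mono fun x hx => norm_lap_integrand_le hz hx)).trans ?_
  exact setIntegral_le_integral hf.norm (Eventually.of_forall fun _ => norm_nonneg _)

/-- For Re w > δ one has x exp(-x Re w) ≤ 1/δ, which allows differentiation under the integral.
Continuity up to the boundary follows by domination with ‖f‖. -/
lemma diffContOnCl_lap {f : ℝ → ℂ} (hf : Integrable f) :
    DiffContOnCl ℂ (lap f) {z | 0 < z.re} := by
  refine ⟨fun z hz => ?_, ?_⟩
  · have hz' : 0 < z.re := hz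
    set δ := z.re / 2 with hδ
    have hδ0 : 0 < δ := by positivity
    refine ((hasDerivAt_integral_of_dominated_loc_of_deriv_le
      (F := fun z (x : ℝ) => cexp (-z * x) * f x)
      (F' := fun z (x : ℝ) => cexp (-z * x) * (-1 * x) * f x)
      (bound := fun x => δ⁻¹ * ‖f x‖) (s := {w : ℂ | δ < w.re})
      ((isOpen_re_gt δ).mem_nhds (by show δ < z.re; linarith))
      (Eventually.of_forall fun w => aestronglyMeasurable_lap hf w)
      (hf.norm.integrableOn.mono' (aestronglyMeasurable_lap hf z)
        ((ae_restrict_mem measurableSet_Ioi).mono fun x hx => norm_lap_integrand_le hz'.le hx))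
      ?_ ?_ (hf.norm.integrableOn.const_mul _) ?_).2).differentiableAt.differentiableWithinAt
    · exact (by fun_prop : Continuous fun x : ℝ => cexp (-z * x) * (-1 * x)).aestronglyMeasurable.mul
        hf.1.restrict
    · refine (ae_restrict_mem measurableSet_Ioi).mono fun x (hx : 0 < x) w (hw : δ < w.re) => ?_
      rw [norm_mul]
      gcongr
      rw [norm_mul, Complex.norm_exp]
      have e1 : (-w * x).re = -(w.re * x) := by simp
      have e2 : ‖(-1 * x : ℂ)‖ = x := by simp [hx.le]
      rw [e1, e2, Real.exp_neg, inv_mul_le_iff₀ (Real.exp_pos _), ← div_eq_mul_inv,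
        le_div_iff₀ hδ0]
      have := Real.add_one_le_exp (w.re * x)
      nlinarith
    · refine Eventually.of_forall fun x w _ => ?_
      have h1 : HasDerivAt (fun w : ℂ => -w * x) (-1 * x) w :=
        (hasDerivAt_id w).neg.mul_const (x : ℂ)
      exact h1.cexp.mul_const _
  · rw [closure_lt_re]
    refine continuousOn_of_dominated (bound := fun x => ‖f x‖)
      (fun w _ => aestronglyMeasurable_lap hf w) (fun w hw => ?_) hf.norm.integrableOn ?_
    · exact (ae_restrict_mem measurableSet_Ioi).mono fun x hx => norm_lap_integrand_le hw hx
    · exact Eventually.of_forall fun x => by fun_prop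

/-- The part of the Fourier integral of `f` over the positive half-line, continued analytically to
the half-plane `Re s > γ`. -/
def minusPart (γ : ℝ) (f : ℝ → ℂ) (s : ℂ) : ℂ := lap f (2 * Real.pi * (s - γ))

/-- The part of the Fourier integral of `f` over the negative half-line, continued analytically to
the half-plane `Re s < γ`. -/
def plusPart (γ : ℝ) (f : ℝ → ℂ) (s : ℂ) : ℂ := lap (fun x => f (-x)) (2 * Real.pi * (γ - s))

section Parts

variable {γ : ℝ} {f : ℝ → ℂ}

lemma re_two_pi_mul (z : ℂ) : (2 * Real.pi * z : ℂ).re = 2 * Real.pi * z.re := by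
  have : (2 * Real.pi * z : ℂ) = ((2 * Real.pi : ℝ) : ℂ) * z := by push_cast; ring
  rw [this, Complex.re_ofReal_mul]

lemma norm_minusPart_le (hf : Integrable f) {s : ℂ} (hs : s ∈ Dminus γ) :
    ‖minusPart γ f s‖ ≤ ∫ x, ‖f x‖ := by
  refine norm_lap_le hf ?_
  have hs' : γ ≤ s.re := hs
  rw [re_two_pi_mul, sub_re, ofReal_re]
  have := Real.pi_pos
  exact mul_nonneg (by positivity) (by linarith)

lemma norm_plusPart_le (hf : Integrable f) {s : ℂ} (hs : s ∈ Dplus γ) :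
    ‖plusPart γ f s‖ ≤ ∫ x, ‖f x‖ := by
  rw [← integral_neg_eq_self (fun x => ‖f x‖)]
  refine norm_lap_le hf.comp_neg ?_
  have hs' : s.re ≤ γ := hs
  rw [re_two_pi_mul, sub_re, ofReal_re]
  have := Real.pi_pos
  exact mul_nonneg (by positivity) (by linarith)

lemma diffContOnCl_minusPart (hf : Integrable f) :
    DiffContOnCl ℂ (minusPart γ f) {s | γ < s.re} := by
  have h : DiffContOnCl ℂ (fun s : ℂ => 2 * Real.pi * (s - γ)) {s | γ < s.re} :=
    Differentiable.diffContOnCl (by fun_prop)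
  refine (diffContOnCl_lap hf).comp h fun s hs => ?_
  have hs' : γ < s.re := hs
  show 0 < (2 * Real.pi * (s - γ) : ℂ).re
  rw [re_two_pi_mul, sub_re, ofReal_re]
  have := Real.pi_pos
  exact mul_pos (by positivity) (by linarith)

lemma diffContOnCl_plusPart (hf : Integrable f) :
    DiffContOnCl ℂ (plusPart γ f) {s | s.re < γ} := by
  have h : DiffContOnCl ℂ (fun s : ℂ => 2 * Real.pi * (γ - s)) {s | s.re < γ} :=
    Differentiable.diffContOnCl (by fun_prop)
  refine (diffContOnCl_lap hf.comp_neg).comp h fun s hs => ?_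
  have hs' : s.re < γ := hs
  show 0 < (2 * Real.pi * (γ - s) : ℂ).re
  rw [re_two_pi_mul, sub_re, ofReal_re]
  have := Real.pi_pos
  exact mul_pos (by positivity) (by linarith)

lemma minusPart_linePoint (t : ℝ) :
    minusPart γ f (linePoint γ t) = 𝓕 ((Set.Ioi 0).indicator f) t := by
  rw [Real.fourier_real_eq_integral_exp_smul, minusPart, lap,
    ← integral_indicator measurableSet_Ioi]
  congr 1
  ext x
  by_cases hx : x ∈ Set.Ioi (0 : ℝ)
  · rw [Set.indicator_of_mem hx, Set.indicator_of_mem hx, smul_eq_mul, linePoint]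
    congr 2
    push_cast
    ring
  · rw [Set.indicator_of_notMem hx, Set.indicator_of_notMem hx, smul_zero]

lemma plusPart_add_minusPart_linePoint (hf : Integrable f) (t : ℝ) :
    plusPart γ f (linePoint γ t) + minusPart γ f (linePoint γ t) = 𝓕 f t := by
  have hint : Integrable fun v : ℝ => cexp (↑(-2 * Real.pi * v * t) * I) • f v := by
    refine hf.norm.mono' ((by fun_prop :
      Continuous fun v : ℝ => cexp (↑(-2 * Real.pi * v * t) * I)).aestronglyMeasurable.smul hf.1)
      (Eventually.of_forall fun v => ?_)
    rw [norm_smul, Complex.norm_exp_ofReal_mul_I, one_mul]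
  rw [Real.fourier_real_eq_integral_exp_smul,
    ← intervalIntegral.integral_Iic_add_Ioi (b := 0) hint.integrableOn hint.integrableOn]
  congr 1
  · have := integral_comp_neg_Ioi (0 : ℝ)
      (fun v : ℝ => cexp (↑(-2 * Real.pi * v * t) * I) • f v)
    rw [neg_zero] at this
    rw [← this, plusPart, lap]
    refine integral_congr_ae (Eventually.of_forall fun x => ?_)
    simp only [smul_eq_mul, linePoint]
    congr 2
    push_cast
    ring
  · rw [minusPart, lap]
    refine integral_congr_ae (Eventually.of_forall fun x => ?_)
    simp only [smul_eq_mul, linePoint]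
    congr 2
    push_cast
    ring

end Parts


end

noncomputable section

open MeasureTheory FourierTransform Convolution

/-! ### Wiener–Hopf factorization near the identity. -/

lemma integral_norm_convolution_le {u v : ℝ → ℂ} (hu : Integrable u) (hv : Integrable v) :
    ∫ x, ‖(u ⋆[ContinuousLinearMap.mul ℂ ℂ] v) x‖ ≤ (∫ x, ‖u x‖) * ∫ x, ‖v x‖ := by
  have h1 := integral_convolution (ContinuousLinearMap.mul ℝ ℝ) hu.norm hv.norm
  rw [ContinuousLinearMap.mul_apply'] at h1
  rw [← h1]
  refine integral_mono (hu.integrable_convolution _ hv).norm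
    (hu.norm.integrable_convolution _ hv.norm) fun x => ?_
  refine (norm_integral_le_integral_norm _).trans (le_of_eq ?_)
  simp only [convolution, ContinuousLinearMap.mul_apply', norm_mul]

/-- One step of the iteration solving the Wiener–Hopf equation with the kernel `φ`. -/
def wienerStep (φ f : Fin 2 → Fin 2 → ℝ → ℂ) (i j : Fin 2) : ℝ → ℂ :=
  ∑ l, (φ i l ⋆[ContinuousLinearMap.mul ℂ ℂ] (-(Set.Ioi 0).indicator (f l j)))

/-- The terms of the Neumann series of the Wiener–Hopf equation with the kernel `φ`. -/
def wienerIter (φ : Fin 2 → Fin 2 → ℝ → ℂ) : ℕ → Fin 2 → Fin 2 → ℝ → ℂ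
  | 0 => φ
  | k + 1 => wienerStep φ (wienerIter φ k)

section Wiener

variable {φ f : Fin 2 → Fin 2 → ℝ → ℂ}

lemma integrable_neg_indicator {g : ℝ → ℂ} (hg : Integrable g) :
    Integrable (-(Set.Ioi 0).indicator g) := (hg.indicator measurableSet_Ioi).neg

lemma integrable_wienerStep (hφ : ∀ i j, Integrable (φ i j)) (hf : ∀ i j, Integrable (f i j))
    (i j : Fin 2) : Integrable (wienerStep φ f i j) :=
  integrable_finsetSum' _ fun l _ =>
    (hφ i l).integrable_convolution _ (integrable_neg_indicator (hf l j))

lemma integral_norm_wienerStep_le (hφ : ∀ i j, Integrable (φ i j))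
    (hf : ∀ i j, Integrable (f i j)) {a b : ℝ} (ha : ∀ i j, ∫ x, ‖φ i j x‖ ≤ a)
    (hb : ∀ i j, ∫ x, ‖f i j x‖ ≤ b) (i j : Fin 2) :
    ∫ x, ‖wienerStep φ f i j x‖ ≤ 2 * (a * b) := by
  have ha0 : 0 ≤ a := (integral_nonneg fun _ => norm_nonneg _).trans (ha 0 0)
  have hint : ∀ l, Integrable
      (φ i l ⋆[ContinuousLinearMap.mul ℂ ℂ] (-(Set.Ioi 0).indicator (f l j))) := fun l =>
    (hφ i l).integrable_convolution _ (integrable_neg_indicator (hf l j))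
  have hterm : ∀ l, ∫ x,
      ‖(φ i l ⋆[ContinuousLinearMap.mul ℂ ℂ] (-(Set.Ioi 0).indicator (f l j))) x‖ ≤ a * b := by
    intro l
    refine (integral_norm_convolution_le (hφ i l) (integrable_neg_indicator (hf l j))).trans ?_
    refine mul_le_mul (ha i l) (le_trans ?_ (hb l j)) (integral_nonneg fun _ => norm_nonneg _) ha0
    refine integral_mono (integrable_neg_indicator (hf l j)).norm (hf l j).norm fun x => ?_
    rw [Pi.neg_apply, norm_neg]
    exact norm_indicator_le_norm_self _ _
  calc ∫ x, ‖wienerStep φ f i j x‖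
      ≤ ∫ x, ∑ l, ‖(φ i l ⋆[ContinuousLinearMap.mul ℂ ℂ] (-(Set.Ioi 0).indicator (f l j))) x‖ := by
        refine integral_mono (integrable_wienerStep hφ hf i j).norm
          (integrable_finsetSum _ fun l _ => (hint l).norm) fun x => ?_
        simp only [wienerStep, Finset.sum_apply]
        exact norm_sum_le _ _
    _ = ∑ l, ∫ x,
        ‖(φ i l ⋆[ContinuousLinearMap.mul ℂ ℂ] (-(Set.Ioi 0).indicator (f l j))) x‖ :=
        integral_finsetSum _ fun l _ => (hint l).norm
    _ ≤ ∑ _l : Fin 2, a * b := Finset.sum_le_sum fun l _ => hterm l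
    _ = 2 * (a * b) := by simp

/-- Convolution becomes multiplication, and cutting off to the positive half-line becomes passage to
the boundary value of the minus part. -/
lemma fourier_wienerStep (hφ : ∀ i j, Integrable (φ i j)) (hf : ∀ i j, Integrable (f i j))
    (γ : ℝ) (i j : Fin 2) (t : ℝ) :
    𝓕 (wienerStep φ f i j) t = ∑ l, 𝓕 (φ i l) t * -minusPart γ (f l j) (linePoint γ t) := by
  have hint : ∀ l, Integrable
      (φ i l ⋆[ContinuousLinearMap.mul ℂ ℂ] (-(Set.Ioi 0).indicator (f l j))) := fun l =>
    (hφ i l).integrable_convolution _ (integrable_neg_indicator (hf l j))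
  have hneg : ∀ g : ℝ → ℂ, 𝓕 (-g) t = -𝓕 g t := fun g => by
    rw [Real.fourier_real_eq_integral_exp_smul, Real.fourier_real_eq_integral_exp_smul,
      ← integral_neg]
    simp
  have hadd : ∀ u v : ℝ → ℂ, Integrable u → Integrable v → 𝓕 (u + v) t = 𝓕 u t + 𝓕 v t := by
    intro u v hu hv
    exact congrFun (VectorFourier.fourierIntegral_add (L := innerₗ ℝ) Real.continuous_fourierChar
      continuous_inner hu hv) t
  simp only [wienerStep, Fin.sum_univ_two]
  rw [hadd _ _ (hint 0) (hint 1), Real.fourier_mul_convolution_eq (hφ i 0)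
    (integrable_neg_indicator (hf 0 j)), Real.fourier_mul_convolution_eq (hφ i 1)
    (integrable_neg_indicator (hf 1 j)), hneg, hneg, minusPart_linePoint, minusPart_linePoint]

lemma integrable_wienerIter (hφ : ∀ i j, Integrable (φ i j)) (k : ℕ) :
    ∀ i j, Integrable (wienerIter φ k i j) := by
  induction k with
  | zero => exact hφ
  | succ k ih => exact integrable_wienerStep hφ ih

lemma integral_norm_wienerIter_le (hφ : ∀ i j, Integrable (φ i j)) {a : ℝ}
    (ha : ∀ i j, ∫ x, ‖φ i j x‖ ≤ a) (k : ℕ) :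
    ∀ i j, ∫ x, ‖wienerIter φ k i j x‖ ≤ a * (2 * a) ^ k := by
  induction k with
  | zero => simpa [wienerIter] using ha
  | succ k ih =>
    intro i j
    refine (integral_norm_wienerStep_le hφ (integrable_wienerIter hφ k) ha ih i j).trans
      (le_of_eq ?_)
    ring

end Wiener

lemma diffContOnCl_tsum {U : Set ℂ} (hU : IsOpen U) {g : ℕ → ℂ → ℂ} {u : ℕ → ℝ} (hu : Summable u)
    (hg : ∀ k, DiffContOnCl ℂ (g k) U) (hb : ∀ k, ∀ s ∈ closure U, ‖g k s‖ ≤ u k) :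
    DiffContOnCl ℂ (fun s => ∑' k, g k s) U :=
  ⟨differentiableOn_tsum_of_summable_norm hu (fun k => (hg k).differentiableOn) hU
    fun k s hs => hb k s (subset_closure hs),
  continuousOn_tsum (fun k => (hg k).continuousOn) hu hb⟩

/-- With entries at most 1/8 the determinant differs from 1 by at most 1/8 + 1/8 + 1/64 + 1/64 <
1/2. -/
lemma goodFactor_one_add {U : Set ℂ} {N : ℂ → Matrix (Fin 2) (Fin 2) ℂ}
    (hN : ∀ i j, DiffContOnCl ℂ (fun s => N s i j) U)
    (hb : ∀ s ∈ closure U, ∀ i j, ‖N s i j‖ ≤ 1 / 8) : GoodFactor U fun s => 1 + N s := by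
  refine ⟨fun i j => diffContOnCl_const.add (hN i j), ⟨2, fun s hs i j => ?_⟩,
    ⟨1 / 2, by norm_num, fun s hs => ?_⟩⟩
  · rw [Matrix.add_apply]
    refine (norm_add_le _ _).trans ?_
    have h1 : ‖(1 : Matrix (Fin 2) (Fin 2) ℂ) i j‖ ≤ 1 := by
      rw [Matrix.one_apply]; split_ifs <;> simp
    linarith [hb s hs i j]
  · have e : (1 + N s).det = 1 - (-(N s 0 0 + N s 1 1 + N s 0 0 * N s 1 1 - N s 0 1 * N s 1 0)) := by
      rw [Matrix.det_fin_two]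
      simp
      ring
    rw [e]
    have h := hb s hs
    have h1 : ‖-(N s 0 0 + N s 1 1 + N s 0 0 * N s 1 1 - N s 0 1 * N s 1 0)‖ ≤ 1 / 2 := by
      rw [norm_neg]
      have p1 : ‖N s 0 0 * N s 1 1‖ ≤ 1 / 8 * (1 / 8) := by
        rw [norm_mul]; gcongr <;> exact h _ _
      have p2 : ‖N s 0 1 * N s 1 0‖ ≤ 1 / 8 * (1 / 8) := by
        rw [norm_mul]; gcongr <;> exact h _ _
      have t1 := norm_sub_le (N s 0 0 + N s 1 1 + N s 0 0 * N s 1 1) (N s 0 1 * N s 1 0)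
      have t2 := norm_add_le (N s 0 0 + N s 1 1) (N s 0 0 * N s 1 1)
      have t3 := norm_add_le (N s 0 0) (N s 1 1)
      linarith [h 0 0, h 1 1]
    have h2 := norm_sub_norm_le (1 : ℂ)
      (-(N s 0 0 + N s 1 1 + N s 0 0 * N s 1 1 - N s 0 1 * N s 1 0))
    rw [norm_one] at h2
    linarith

/-- Matrix functions close to the identity in the Wiener algebra of the line have a factorization
with bounded factors. -/
lemma exists_wiener_factorization (γ : ℝ) {φ : Fin 2 → Fin 2 → ℝ → ℂ}
    (hφ : ∀ i j, Integrable (φ i j)) (ha : ∀ i j, ∫ x, ‖φ i j x‖ ≤ 1 / 16) :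
    ∃ P N : ℂ → Matrix (Fin 2) (Fin 2) ℂ, GoodFactor {s | s.re < γ} P ∧
      GoodFactor {s | γ < s.re} N ∧ ∀ t : ℝ,
      (1 + Matrix.of fun i j => 𝓕 (φ i j) t) * N (linePoint γ t) = P (linePoint γ t) := by
  set u : ℕ → ℝ := fun k => 1 / 16 * (2 * (1 / 16)) ^ k
  have hu : HasSum u (1 / 16 * (1 - 2 * (1 / 16))⁻¹) :=
    (hasSum_geometric_of_lt_one (by norm_num) (by norm_num)).mul_left _
  have hu8 : ∑' k, u k ≤ 1 / 8 := by rw [hu.tsum_eq]; norm_num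
  set f := wienerIter φ
  have hf : ∀ k i j, Integrable (f k i j) := integrable_wienerIter hφ
  have hfu : ∀ k i j, ∫ x, ‖f k i j x‖ ≤ u k := integral_norm_wienerIter_le hφ ha
  have hpb : ∀ k i j, ∀ s ∈ Dplus γ, ‖plusPart γ (f k i j) s‖ ≤ u k := fun k i j s hs =>
    (norm_plusPart_le (hf k i j) hs).trans (hfu k i j)
  have hnb : ∀ k i j, ∀ s ∈ Dminus γ, ‖-minusPart γ (f k i j) s‖ ≤ u k := fun k i j s hs => by
    rw [norm_neg]
    exact (norm_minusPart_le (hf k i j) hs).trans (hfu k i j)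
  -- The sum f of the iterates satisfies f̂ = φ̂ (1 - f⁻). Since f̂ = f⁺ + f⁻ on the line, this says
  -- (1 + φ̂)(1 - f⁻) = 1 + f⁺, so the factors are 1 + f⁺ and 1 - f⁻.
  refine ⟨fun s => 1 + Matrix.of fun i j => ∑' k, plusPart γ (f k i j) s,
    fun s => 1 + Matrix.of fun i j => ∑' k, -minusPart γ (f k i j) s, goodFactor_one_add ?_ ?_,
    goodFactor_one_add ?_ ?_, fun t => ?_⟩
  · intro i j
    refine diffContOnCl_tsum (isOpen_re_lt γ) hu.summable
      (fun k => diffContOnCl_plusPart (hf k i j)) fun k s hs => ?_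
    rw [closure_re_lt] at hs
    exact hpb k i j s hs
  · intro s hs i j
    rw [closure_re_lt] at hs
    exact (tsum_of_norm_bounded hu fun k => hpb k i j s hs).trans (hu.tsum_eq ▸ hu8)
  · intro i j
    refine diffContOnCl_tsum (isOpen_re_gt γ) hu.summable
      (fun k => (diffContOnCl_minusPart (hf k i j)).neg) fun k s hs => ?_
    rw [closure_lt_re] at hs
    exact hnb k i j s hs
  · intro s hs i j
    rw [closure_lt_re] at hs
    exact (tsum_of_norm_bounded hu fun k => hnb k i j s hs).trans (hu.tsum_eq ▸ hu8)
  · set s := linePoint γ t with hs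
    have sp : ∀ i j, Summable fun k => plusPart γ (f k i j) s := fun i j =>
      hu.summable.of_norm_bounded fun k => hpb k i j s (linePoint_mem_plus γ t)
    have sn : ∀ i j, Summable fun k => -minusPart γ (f k i j) s := fun i j =>
      hu.summable.of_norm_bounded fun k => hnb k i j s (linePoint_mem_minus γ t)
    have key : ∀ k i j, plusPart γ (f k i j) s - -minusPart γ (f k i j) s = 𝓕 (f k i j) t :=
      fun k i j => by rw [sub_neg_eq_add, hs, plusPart_add_minusPart_linePoint (hf k i j)]
    have main : ∀ i j, ∑' k, plusPart γ (f k i j) s - ∑' k, -minusPart γ (f k i j) s =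
        𝓕 (φ i j) t + ∑ l, 𝓕 (φ i l) t * ∑' k, -minusPart γ (f k l j) s := by
      intro i j
      rw [← (sp i j).tsum_sub (sn i j), ((sp i j).sub (sn i j)).tsum_eq_zero_add]
      congr 1
      · exact key 0 i j
      · simp_rw [← tsum_mul_left]
        rw [← Summable.tsum_finsetSum fun l _ => (sn l j).mul_left _]
        refine tsum_congr fun k => ?_
        rw [key (k + 1) i j]
        exact fourier_wienerStep hφ (hf k) γ i j t
    ext i j
    have hm := main i j
    simp only [Matrix.add_mul, Matrix.one_mul, Matrix.mul_add, Matrix.mul_one, Matrix.add_apply,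
      Matrix.of_apply, Matrix.mul_apply (M := Matrix.of _)]
    linear_combination -hm


end

noncomputable section

open MeasureTheory FourierTransform

/-! ### Decaying C² functions in the Wiener algebra; derivatives along the line. -/

/-- Twice continuously differentiable functions with quadratic decay of the derivatives up to the
second order. -/
structure DecaysWithDerivs (M : ℝ) (Φ : ℝ → ℂ) : Prop where
  contDiff : ContDiff ℝ 2 Φ
  bound : ∀ k ≤ 2, ∀ t, ‖iteratedDeriv k Φ t‖ ≤ M / (1 + t ^ 2)

/-- Twice continuously differentiable functions, bounded with the derivatives up to the second
order. -/
structure BoundedWithDerivs (C : ℝ) (h : ℝ → ℂ) : Prop where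
  contDiff : ContDiff ℝ 2 h
  bound : ∀ k ≤ 2, ∀ t, ‖iteratedDeriv k h t‖ ≤ C

lemma BoundedWithDerivs.mono {C C' : ℝ} {h : ℝ → ℂ} (hh : BoundedWithDerivs C h) (hC : C ≤ C') :
    BoundedWithDerivs C' h := ⟨hh.contDiff, fun k hk t => (hh.bound k hk t).trans hC⟩

namespace DecaysWithDerivs

variable {M M' C : ℝ} {Φ Φ' h : ℝ → ℂ}

lemma add (hΦ : DecaysWithDerivs M Φ) (hΦ' : DecaysWithDerivs M' Φ') :
    DecaysWithDerivs (M + M') fun t => Φ t + Φ' t := by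
  refine ⟨hΦ.contDiff.add hΦ'.contDiff, fun k hk t => ?_⟩
  have hk' : (k : WithTop ℕ∞) ≤ 2 := by exact_mod_cast hk
  rw [iteratedDeriv_fun_add (hΦ.contDiff.contDiffAt.of_le hk') (hΦ'.contDiff.contDiffAt.of_le hk'),
    add_div]
  exact (norm_add_le _ _).trans (add_le_add (hΦ.bound k hk t) (hΦ'.bound k hk t))

lemma mul (hh : BoundedWithDerivs C h) (hΦ : DecaysWithDerivs M Φ) :
    DecaysWithDerivs (4 * (C * M)) fun t => h t * Φ t := by
  refine ⟨hh.contDiff.mul hΦ.contDiff, fun k hk t => ?_⟩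
  have hk' : (k : WithTop ℕ∞) ≤ 2 := by exact_mod_cast hk
  have hC : 0 ≤ C := (norm_nonneg _).trans (hh.bound 0 (by norm_num) 0)
  have hM : 0 ≤ M / (1 + t ^ 2) := (norm_nonneg _).trans (hΦ.bound 0 (by norm_num) t)
  rw [← norm_iteratedFDeriv_eq_norm_iteratedDeriv]
  refine (norm_iteratedFDeriv_mul_le hh.contDiff hΦ.contDiff t hk').trans ?_
  simp only [norm_iteratedFDeriv_eq_norm_iteratedDeriv]
  calc ∑ i ∈ Finset.range (k + 1),
        (k.choose i : ℝ) * ‖iteratedDeriv i h t‖ * ‖iteratedDeriv (k - i) Φ t‖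
      ≤ ∑ i ∈ Finset.range (k + 1), (k.choose i : ℝ) * (C * (M / (1 + t ^ 2))) := by
        refine Finset.sum_le_sum fun i hi => ?_
        rw [mul_assoc]
        gcongr
        · exact hh.bound i (by have := Finset.mem_range.1 hi; omega) t
        · exact hΦ.bound (k - i) (by omega) t
    _ = 2 ^ k * (C * (M / (1 + t ^ 2))) := by
        rw [← Finset.sum_mul]
        congr 1
        exact_mod_cast Nat.sum_range_choose k
    _ ≤ 2 ^ 2 * (C * (M / (1 + t ^ 2))) := by
        gcongr
        · norm_num
    _ = 4 * (C * M) / (1 + t ^ 2) := by ring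

lemma matrix_mul_mul {U F V : ℝ → Matrix (Fin 2) (Fin 2) ℂ}
    (hU : ∀ i j, BoundedWithDerivs C fun t => U t i j)
    (hF : ∀ i j, DecaysWithDerivs M fun t => F t i j)
    (hV : ∀ i j, BoundedWithDerivs C fun t => V t i j) (i j : Fin 2) :
    DecaysWithDerivs (64 * C ^ 2 * M) fun t => (U t * F t * V t) i j := by
  have h1 : ∀ l, DecaysWithDerivs (8 * C * M) fun t => (U t * F t) i l := by
    intro l
    convert (mul (hU i 0) (hF 0 l)).add (mul (hU i 1) (hF 1 l)) using 1
    · ring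
    · ext t
      rw [Matrix.mul_apply, Fin.sum_univ_two]
  convert (mul (hV 0 j) (h1 0)).add (mul (hV 1 j) (h1 1)) using 1
  · ring
  · ext t
    rw [Matrix.mul_apply, Fin.sum_univ_two, mul_comm, mul_comm (V t 1 j)]

lemma norm_le (hΦ : DecaysWithDerivs M Φ) {k : ℕ} (hk : k ≤ 2) (t : ℝ) :
    ‖iteratedDeriv k Φ t‖ ≤ M * (1 + t ^ 2)⁻¹ := by
  rw [← div_eq_mul_inv]
  exact hΦ.bound k hk t

lemma integrable (hΦ : DecaysWithDerivs M Φ) {k : ℕ} (hk : k ≤ 2) :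
    Integrable (iteratedDeriv k Φ) :=
  (integrable_inv_one_add_sq.const_mul M).mono'
    (hΦ.contDiff.continuous_iteratedDeriv k (by exact_mod_cast hk)).aestronglyMeasurable
    (Eventually.of_forall fun t => hΦ.norm_le hk t)

lemma norm_fourier_iteratedDeriv_le (hΦ : DecaysWithDerivs M Φ) {k : ℕ} (hk : k ≤ 2) (x : ℝ) :
    ‖𝓕 (iteratedDeriv k Φ) x‖ ≤ M * Real.pi := by
  refine (VectorFourier.norm_fourierIntegral_le_integral_norm _ _ _ _ _).trans ?_
  rw [← integral_univ_inv_one_add_sq, ← integral_const_mul]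
  exact integral_mono (hΦ.integrable hk).norm (integrable_inv_one_add_sq.const_mul M)
    fun t => hΦ.norm_le hk t

/-- The transforms of Φ and of Φ'' are both at most πM, and the latter is (2πx)² times the former in
modulus, with (2πx)² ≥ x². -/
lemma norm_fourier_le (hΦ : DecaysWithDerivs M Φ) (x : ℝ) :
    ‖𝓕 Φ x‖ ≤ 2 * Real.pi * M * (1 + x ^ 2)⁻¹ := by
  have h0 := hΦ.norm_fourier_iteratedDeriv_le (k := 0) (by norm_num) x
  have h2 := hΦ.norm_fourier_iteratedDeriv_le (k := 2) le_rfl x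
  rw [iteratedDeriv_zero] at h0
  rw [Real.fourier_iteratedDeriv (N := 2) hΦ.contDiff
    (fun n hn => hΦ.integrable (by exact_mod_cast hn)) le_rfl, norm_smul] at h2
  have e : ‖(2 * Real.pi * I * x : ℂ) ^ 2‖ = 4 * Real.pi ^ 2 * x ^ 2 := by
    rw [norm_pow, norm_mul, norm_mul, norm_mul, Complex.norm_I, Complex.norm_real,
      Complex.norm_real, Real.norm_eq_abs, Real.norm_eq_abs, mul_pow, mul_pow, mul_pow, sq_abs,
      sq_abs]
    norm_num
  rw [e] at h2
  rw [← div_eq_mul_inv, le_div_iff₀ (by positivity)]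
  have h3 : x ^ 2 * ‖𝓕 Φ x‖ ≤ 4 * Real.pi ^ 2 * x ^ 2 * ‖𝓕 Φ x‖ := by
    have h4 : 1 ≤ 4 * Real.pi ^ 2 := by nlinarith [Real.pi_gt_three]
    rw [mul_assoc (4 * Real.pi ^ 2)]
    exact le_mul_of_one_le_left (by positivity) h4
  linarith

lemma continuous_fourier (hΦ : DecaysWithDerivs M Φ) : Continuous (𝓕 Φ) :=
  VectorFourier.fourierIntegral_continuous (L := innerₗ ℝ) Real.continuous_fourierChar
    continuous_inner (by simpa using hΦ.integrable (k := 0) (by norm_num))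

lemma integrable_fourier (hΦ : DecaysWithDerivs M Φ) : Integrable (𝓕 Φ) :=
  (integrable_inv_one_add_sq.const_mul (2 * Real.pi * M)).mono'
    hΦ.continuous_fourier.aestronglyMeasurable (Eventually.of_forall hΦ.norm_fourier_le)

/-- Functions with quadratic decay of the derivatives belong to the Wiener algebra. -/
lemma exists_fourier_eq (hΦ : DecaysWithDerivs M Φ) :
    ∃ φ : ℝ → ℂ, Integrable φ ∧ ∫ x, ‖φ x‖ ≤ 2 * Real.pi ^ 2 * M ∧ 𝓕 φ = Φ := by
  have e : 𝓕⁻ Φ = fun x => 𝓕 Φ (-x) := funext fun x => Real.fourierInv_eq_fourier_neg Φ x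
  refine ⟨𝓕⁻ Φ, ?_, ?_, ?_⟩
  · rw [e]
    exact hΦ.integrable_fourier.comp_neg
  · rw [e, integral_neg_eq_self (fun x => ‖𝓕 Φ x‖)]
    refine (integral_mono hΦ.integrable_fourier.norm
      (integrable_inv_one_add_sq.const_mul (2 * Real.pi * M)) hΦ.norm_fourier_le).trans ?_
    rw [integral_const_mul, integral_univ_inv_one_add_sq]
    exact le_of_eq (by ring)
  · exact hΦ.contDiff.continuous.fourier_fourierInv_eq
      (by simpa using hΦ.integrable (k := 0) (by norm_num)) hΦ.integrable_fourier

end DecaysWithDerivs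

/-- Cauchy's estimate on discs of radius δ/2 bounds the derivative in the strip of half the width.
The induction therefore has to range over all widths, bounds and functions. -/
lemma contDiff_linePoint {γ : ℝ} (n : ℕ) : ∀ {δ C : ℝ} {h : ℂ → ℂ}, 0 < δ →
    DifferentiableOn ℂ h {s | |s.re - γ| < δ} → (∀ s, |s.re - γ| < δ → ‖h s‖ ≤ C) →
    ContDiff ℝ n (fun t => h (linePoint γ t)) ∧
      ∃ C', ∀ k ≤ n, ∀ t, ‖iteratedDeriv k (fun t => h (linePoint γ t)) t‖ ≤ C' := by
  have hopen : ∀ δ, IsOpen {s : ℂ | |s.re - γ| < δ} := fun δ =>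
    isOpen_lt (by fun_prop) continuous_const
  induction n with
  | zero =>
    intro δ C h hδ hd hb
    have hmem : ∀ t, linePoint γ t ∈ {s : ℂ | |s.re - γ| < δ} := fun t => by
      show |(linePoint γ t).re - γ| < δ
      rwa [linePoint_re, sub_self, abs_zero]
    refine ⟨contDiff_zero.2 (continuous_comp_linePoint hd.continuousOn hmem), C, fun k hk t => ?_⟩
    obtain rfl : k = 0 := by omega
    rw [iteratedDeriv_zero]
    exact hb _ (hmem t)
  | succ n ih =>
    intro δ C h hδ hd hb
    have hmem : ∀ t, linePoint γ t ∈ {s : ℂ | |s.re - γ| < δ} := fun t => by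
      show |(linePoint γ t).re - γ| < δ
      rwa [linePoint_re, sub_self, abs_zero]
    have hderiv : ∀ t, HasDerivAt (fun t => h (linePoint γ t)) (I * deriv h (linePoint γ t)) t := by
      intro t
      have h1 : HasDerivAt (linePoint γ) I t := by
        have := ((hasDerivAt_id t).ofReal_comp.mul_const I).const_add (γ : ℂ)
        rw [ofReal_one, one_mul] at this
        exact this
      have h2 := (hd.differentiableAt ((hopen δ).mem_nhds (hmem t))).hasDerivAt
      rw [mul_comm]
      exact h2.comp t h1
    have hd' : deriv (fun t => h (linePoint γ t)) = fun t => I * deriv h (linePoint γ t) :=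
      funext fun t => (hderiv t).deriv
    have hb' : ∀ s : ℂ, |s.re - γ| < δ / 2 → ‖I * deriv h s‖ ≤ C / (δ / 2) := by
      intro s hs
      rw [norm_mul, Complex.norm_I, one_mul]
      have hsub : Metric.closedBall s (δ / 2) ⊆ {s : ℂ | |s.re - γ| < δ} := by
        intro w hw
        have h1 : |(w - s).re| ≤ δ / 2 :=
          (Complex.abs_re_le_norm _).trans (by simpa [dist_eq_norm] using hw)
        rw [sub_re] at h1
        show |w.re - γ| < δ
        calc |w.re - γ| ≤ |w.re - s.re| + |s.re - γ| := abs_sub_le _ _ _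
          _ < δ := by linarith
      exact Complex.norm_deriv_le_of_forall_mem_sphere_norm_le (by positivity)
        (hd.diffContOnCl_ball hsub)
        fun w hw => hb w (hsub (Metric.sphere_subset_closedBall hw))
    have hdd : DifferentiableOn ℂ (fun s => I * deriv h s) {s | |s.re - γ| < δ / 2} :=
      ((hd.deriv (hopen δ)).mono fun s (hs : |s.re - γ| < δ / 2) => by
        show |s.re - γ| < δ
        linarith).const_mul I
    obtain ⟨hc, C', hC'⟩ := ih (half_pos hδ) hdd hb'
    refine ⟨?_, max C C', fun k hk t => ?_⟩
    · push_cast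
      rw [contDiff_succ_iff_deriv, hd']
      exact ⟨fun t => (hderiv t).differentiableAt, by simp, hc⟩
    · rcases k with _ | k
      · rw [iteratedDeriv_zero]
        exact (hb _ (hmem t)).trans (le_max_left _ _)
      · rw [iteratedDeriv_succ', hd']
        exact (hC' k (by omega) t).trans (le_max_right _ _)

/-! ### Persistence of the indices under small decaying perturbations. -/

section Persistent

variable {γ δ : ℝ} {U : Set ℂ} {G X Xp Xm : ℂ → Matrix (Fin 2) (Fin 2) ℂ}

lemma GoodFactor.mono {V : Set ℂ} (hX : GoodFactor V X) (h : U ⊆ V) : GoodFactor U X := by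
  obtain ⟨C, hC⟩ := hX.bdd
  obtain ⟨c, hc, hdet⟩ := hX.det_ge
  exact ⟨fun i j => (hX.diff i j).mono h, ⟨C, fun s hs => hC s (closure_mono h hs)⟩,
    ⟨c, hc, fun s hs => hdet s (closure_mono h hs)⟩⟩

lemma GoodFactor.exists_boundedWithDerivs (hX : GoodFactor U X) (hδ : 0 < δ)
    (hU : {s : ℂ | |s.re - γ| < δ} ⊆ U) :
    ∃ C, ∀ i j, BoundedWithDerivs C fun t => X (linePoint γ t) i j := by
  obtain ⟨C, hC⟩ := hX.bdd
  have h := fun i j => contDiff_linePoint (γ := γ) 2 hδ ((hX.diff i j).differentiableOn.mono hU)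
    fun s hs => hC s (subset_closure (hU hs)) i j
  choose hc C' hC' using h
  refine ⟨∑ i, ∑ j, |C' i j|, fun i j => ⟨hc i j, fun k hk t => ?_⟩⟩
  refine (hC' i j k hk t).trans ((le_abs_self _).trans ?_)
  refine (Finset.single_le_sum (f := fun j => |C' i j|) (fun _ _ => abs_nonneg _)
    (Finset.mem_univ j)).trans ?_
  exact Finset.single_le_sum (f := fun i => ∑ j, |C' i j|)
    (fun _ _ => Finset.sum_nonneg fun _ _ => abs_nonneg _) (Finset.mem_univ i)

/-- A matrix function with good factors that continue to a strip around the line has zero partial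
indices after small decaying perturbations. -/
lemma exists_persistent (hδ : 0 < δ) (hp : GoodFactor {s | s.re < γ + δ} Xp)
    (hm : GoodFactor {s | γ - δ < s.re} Xm) (hG : ∀ s : ℂ, s.re = γ → G s * Xm s = Xp s) :
    ∃ ε : ℝ, 0 < ε ∧ ∀ F : ℝ → Matrix (Fin 2) (Fin 2) ℂ,
      (∀ i j, ContDiff ℝ 2 fun t => F t i j) →
      (∀ i j, ∀ k ≤ 2, ∀ t : ℝ, ‖iteratedDeriv k (fun t => F t i j) t‖ ≤ ε / (1 + t ^ 2)) →
        HasPartialIndices γ (fun s => G s + F s.im) fun _ => 0 := by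
  obtain ⟨C₁, hC₁⟩ := hp.inv.exists_boundedWithDerivs (γ := γ) hδ fun s hs => by
    have := (abs_lt.1 (show |s.re - γ| < δ from hs)).2
    show s.re < γ + δ
    linarith
  obtain ⟨C₂, hC₂⟩ := hm.exists_boundedWithDerivs (γ := γ) hδ fun s hs => by
    have := (abs_lt.1 (show |s.re - γ| < δ from hs)).1
    show γ - δ < s.re
    linarith
  set C := max C₁ C₂
  have hpi := Real.pi_pos
  -- The product (X⁺)⁻¹ F X⁻ has decay constant 64 C² ε, so its kernel has L¹ norm at most 128 π² C²
  -- ε. Here 2048 = 16 · 128 makes this at most 1/16.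
  refine ⟨(2048 * Real.pi ^ 2 * (C ^ 2 + 1))⁻¹, by positivity, fun F hF hFb => ?_⟩
  set ε := (2048 * Real.pi ^ 2 * (C ^ 2 + 1))⁻¹ with hε
  have hΦ := DecaysWithDerivs.matrix_mul_mul
    (fun i j => (hC₁ i j).mono (le_max_left C₁ C₂)) (fun i j => ⟨hF i j, hFb i j⟩)
    (fun i j => (hC₂ i j).mono (le_max_right C₁ C₂))
  choose φ hφ hφb hφΦ using fun i j => (hΦ i j).exists_fourier_eq
  have hsmall : 2 * Real.pi ^ 2 * (64 * C ^ 2 * ε) ≤ 1 / 16 := by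
    rw [hε, ← div_eq_mul_inv, mul_div_assoc', div_le_iff₀ (by positivity)]
    have : 0 < Real.pi ^ 2 := by positivity
    nlinarith
  obtain ⟨P, N, hP, hN, hPN⟩ := exists_wiener_factorization γ hφ
    fun i j => (hφb i j).trans hsmall
  have hp' : GoodFactor {s | s.re < γ} Xp := hp.mono fun s (hs : s.re < γ) => by
    show s.re < γ + δ
    linarith
  have hm' : GoodFactor {s | γ < s.re} Xm := hm.mono fun s (hs : γ < s.re) => by
    show γ - δ < s.re
    linarith
  -- From G + F = X⁺ (1 + (X⁺)⁻¹ F X⁻) (X⁻)⁻¹ and the factorization P N⁻¹ of the middle term, the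
  -- new factors are X⁺ P and X⁻ N.
  refine ⟨_, _, isCanonicalFactorization_zero (hp'.mul hP) (hm'.mul hN) fun s hs => ?_⟩
  have hu : IsUnit (Xp s).det := isUnit_iff_ne_zero.2 (hp'.det_ne_zero (by
    rw [closure_re_lt]; exact hs.le))
  have h1 := hPN s.im
  rw [← eq_linePoint hs] at h1
  have h2 : (Matrix.of fun i j => 𝓕 (φ i j) s.im) = (Xp s)⁻¹ * F s.im * Xm s := by
    ext i j
    have h3 : 𝓕 (φ i j) s.im =
        ((Xp (linePoint γ s.im))⁻¹ * F s.im * Xm (linePoint γ s.im)) i j := congrFun (hφΦ i j) s.im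
    rwa [← eq_linePoint hs] at h3
  rw [h2] at h1
  rw [← h1, ← Matrix.mul_assoc, ← Matrix.mul_assoc]
  congr 1
  rw [Matrix.add_mul, hG s hs, Matrix.mul_add, Matrix.mul_one, Matrix.mul_assoc (Xp s)⁻¹,
    Matrix.mul_nonsing_inv_cancel_left _ _ hu]

end Persistent


section

variable {lam γ : ℝ} {A B : Fin 2 → ℕ → ℂ}

lemma SolvesSystem.goodFactor_Xplus (h : SolvesSystem lam A B) (h0 : 0 < lam) (h1 : lam < 1)
    (hγ : γ < 1) : GoodFactor {s | s.re < γ} (Xplus lam A B) := by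
  obtain ⟨C, hC⟩ := h.exists_norm_Xplus_le h0 h1 hγ
  refine ⟨fun i j => DifferentiableOn.diffContOnCl fun s hs => ?_, ⟨C, fun s hs => ?_⟩,
    ⟨1 / 2, by norm_num, fun s hs => ?_⟩⟩
  all_goals rw [closure_re_lt] at hs
  · exact (h.analyticAt_Xplus h0 h1 (lt_of_le_of_lt hs hγ) i j).differentiableAt.differentiableWithinAt
  · exact hC s hs
  · rw [(h.det_eq h0 h1).1 s (lt_of_le_of_lt hs hγ)]
    norm_num

lemma SolvesSystem.goodFactor_Xminus (h : SolvesSystem lam A B) (h0 : 0 < lam) (h1 : lam < 1)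
    (hγ : 0 < γ) : GoodFactor {s | γ < s.re} (Xminus lam A B) := by
  obtain ⟨C, hC⟩ := h.exists_norm_Xminus_le h0 h1 hγ
  refine ⟨fun i j => DifferentiableOn.diffContOnCl fun s hs => ?_, ⟨C, fun s hs => ?_⟩,
    ⟨‖1 / (2 * (lam : ℂ))‖, norm_pos_iff.2 (by simp [h0.ne']), fun s hs => ?_⟩⟩
  all_goals rw [closure_lt_re] at hs
  · exact (h.analyticAt_Xminus h0 h1 (lt_of_lt_of_le hγ hs) i j).differentiableAt.differentiableWithinAt
  · exact hC s hs
  · rw [(h.det_eq h0 h1).2 s (lt_of_lt_of_le hγ hs)]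

end

end

/-! ### The main theorem. -/

theorem mainTheorem1 (lam γ : ℝ) (hlam0 : 0 < lam) (hlam1 : lam < 1) (hγ0 : 0 < γ) (hγ1 : γ < 1) :
    ∃ a b : Fin 2 → ℕ → ℕ → ℝ,
      -- the recurrences determine the coefficients, and the power series converge
      Recurrences a b ∧
      (∀ a' b' : Fin 2 → ℕ → ℕ → ℝ, Recurrences a' b' → a' = a ∧ b' = b) ∧
      (∀ l n, Summable fun k : ℕ => a l n k * lam ^ k) ∧
      (∀ l n, Summable fun k : ℕ => b l n k * lam ^ k) ∧
      -- their sums are the unique solution of the infinite systems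
      SolvesSystem lam (coefA lam a) (coefB lam b) ∧
      (∀ A B : Fin 2 → ℕ → ℂ, SolvesSystem lam A B → A = coefA lam a ∧ B = coefB lam b) ∧
      -- the series for `Ψ` and `Ω` converge off their poles to meromorphic functions
      (∀ (l : Fin 2) (s : ℂ), (∀ m : ℕ, s ≠ 2 * m + 1) →
        Summable fun m : ℕ => coefA lam a l m / (s - 2 * m - 1)) ∧
      (∀ (l : Fin 2) (s : ℂ), (∀ m : ℕ, s ≠ -(2 * m)) →
        Summable fun m : ℕ => coefB lam b l m / (s + 2 * m)) ∧
      (∀ l, MeromorphicOn (Psi (coefA lam a) l) Set.univ) ∧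
      (∀ l, MeromorphicOn (Omega (coefB lam b) l) Set.univ) ∧
      -- the factors, analytic in the closed half-planes and given by the explicit expressions
      ∃ Xp Xm : ℂ → Matrix (Fin 2) (Fin 2) ℂ,
        (∀ i j, AnalyticOnNhd ℂ (fun s => Xp s i j) (Dplus γ)) ∧
        (∀ i j, AnalyticOnNhd ℂ (fun s => Xm s i j) (Dminus γ)) ∧
        (∀ s ∈ Dplus γ, (∀ n : ℕ, s ≠ -(2 * n)) →
          Xp s = XplusExpr lam (coefA lam a) (coefB lam b) s) ∧
        (∀ s ∈ Dminus γ, (∀ n : ℕ, s ≠ 2 * n + 1) →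
          Xm s = XminusExpr lam (coefA lam a) (coefB lam b) s) ∧
        -- factorization on the line and the determinants
        (∀ s : ℂ, s.re = γ → G0 lam s = Xp s * (Xm s)⁻¹) ∧
        (∀ s ∈ Dplus γ, (Xp s).det = -1 / 2) ∧
        (∀ s ∈ Dminus γ, (Xm s).det = 1 / (2 * (lam : ℂ))) ∧
        -- behaviour of the entries of the columns at infinity
        Tendsto (fun s => Xp s 1 0) (atInftyIn (Dplus γ)) (𝓝 1) ∧
        Tendsto (fun s => Xp s 0 1) (atInftyIn (Dplus γ)) (𝓝 (1 / 2)) ∧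
        Tendsto (fun s => Xm s 0 0) (atInftyIn (Dminus γ)) (𝓝 (1 / 2)) ∧
        Tendsto (fun s => Xm s 1 1) (atInftyIn (Dminus γ)) (𝓝 (1 / (lam : ℂ))) ∧
        (∃ c : ℂ, c ≠ 0 ∧ Tendsto (fun s => s * Xp s 1 1) (atInftyIn (Dplus γ)) (𝓝 c)) ∧
        (∃ c : ℂ, c ≠ 0 ∧ Tendsto (fun s => s * Xm s 1 0) (atInftyIn (Dminus γ)) (𝓝 c)) ∧
        (∃ C : ℝ, ∀ s ∈ Dplus γ, ‖Xp s 0 0‖ ≤ C) ∧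
        (∃ C : ℝ, ∀ s ∈ Dminus γ, ‖Xm s 0 1‖ ≤ C) ∧
        (∃ c : ℂ, c ≠ 0 ∧ ∀ K : ℝ, Tendsto (fun s => s * Xp s 0 0)
          (atInftyIn (Dplus γ ∩ {s | |s.im| ≤ K * |s.re|})) (𝓝 c)) ∧
        (∃ c : ℂ, c ≠ 0 ∧ ∀ K : ℝ, Tendsto (fun s => s * Xm s 0 1)
          (atInftyIn (Dminus γ ∩ {s | |s.im| ≤ K * |s.re|})) (𝓝 c)) ∧
        -- canonical factorization with zero partial indices, and stability
        IsCanonicalFactorization γ (G0 lam) Xp Xm (fun _ => 0) ∧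
        StablePartialIndices γ (G0 lam) (fun _ => 0) := by
  have hrec := recurrences_recCoef
  set a : Fin 2 → ℕ → ℕ → ℝ := fun l n k => (recCoef l k).2 n
  set b : Fin 2 → ℕ → ℕ → ℝ := fun l n k => (recCoef l k).1 n
  obtain ⟨V, -, hV⟩ := hrec.exists_bound_tsum hlam0 hlam1
  have h := solvesSystem_coef hrec hlam0 hlam1
  have hG : ∀ s : ℂ, s.re = γ → G0 lam s * Xminus lam (coefA lam a) (coefB lam b) s =
      Xplus lam (coefA lam a) (coefB lam b) s := fun s hs =>
    h.G0_mul_Xminus hlam0 hlam1 (by rwa [hs]) (by rwa [hs])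
  have hcan := isCanonicalFactorization_zero (h.goodFactor_Xplus hlam0 hlam1 hγ1)
    (h.goodFactor_Xminus hlam0 hlam1 hγ0) hG
  have hA0 := tsum_coefA_ne_zero hrec hlam0 hlam1
  have hB0 := tsum_coefB_ne_zero hrec hlam0 hlam1
  have hw := h.summable_weighted hlam0 hlam1
  have hlam : (lam : ℂ) ≠ 0 := ofReal_ne_zero.2 hlam0.ne'
  refine ⟨a, b, hrec, fun a' b' h' => hrec.unique h', fun l n => (hV l n).1,
    fun l n => (hV l n).2.1, h, fun A B h' => h.unique h' hlam0 hlam1, fun l s _ => ?_,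
    fun l s _ => ?_, fun l => (h.meromorphicOn hlam0 hlam1 l).1,
    fun l => (h.meromorphicOn hlam0 hlam1 l).2, Xplus lam (coefA lam a) (coefB lam b),
    Xminus lam (coefA lam a) (coefB lam b),
    fun i j s hs => h.analyticAt_Xplus hlam0 hlam1 (lt_of_le_of_lt hs hγ1) i j,
    fun i j s hs => h.analyticAt_Xminus hlam0 hlam1 (lt_of_lt_of_le hγ0 hs) i j,
    fun s hs hne => h.Xplus_eq hlam0 hlam1 (lt_of_le_of_lt hs hγ1) hne,
    fun s hs hne => h.Xminus_eq hlam0 hlam1 (lt_of_lt_of_le hγ0 hs) hne,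
    hcan.factor,
    fun s hs => (h.det_eq hlam0 hlam1).1 s (lt_of_le_of_lt hs hγ1),
    fun s hs => (h.det_eq hlam0 hlam1).2 s (lt_of_lt_of_le hγ0 hs),
    h.tendsto_Xplus_one_zero hlam0 hlam1 hγ1, h.tendsto_Xplus_zero_one hlam0 hlam1 hγ1,
    h.tendsto_Xminus_zero_zero hlam0 hlam1 hγ0, h.tendsto_Xminus_one_one hlam0 hlam1 hγ0,
    ⟨_, hA0, h.tendsto_mul_Xplus_one_one hlam0 hlam1 hγ1⟩,
    ⟨_, mul_ne_zero (one_div_ne_zero hlam) hB0, h.tendsto_mul_Xminus_one_zero hlam0 hlam1 hγ0⟩,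
    ?_, ?_,
    ⟨_, mul_ne_zero (by norm_num) hB0, h.tendsto_mul_Xplus_zero_zero hlam0 hlam1 hγ1⟩,
    ⟨_, mul_ne_zero (by norm_num) hA0, h.tendsto_mul_Xminus_zero_one hlam0 hlam1 hγ0⟩,
    hcan, ⟨_, _, hcan⟩, ?_, ?_⟩
  · refine (summable_poleSeries (summable_norm_of_weighted (hw l).1) (1 - s)).neg.congr fun m => ?_
    rw [← div_neg]
    congr 1
    ring
  · exact summable_poleSeries (summable_norm_of_weighted (hw l).2) s
  · obtain ⟨C, hC⟩ := h.exists_norm_Xplus_le hlam0 hlam1 hγ1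
    exact ⟨C, fun s hs => hC s hs 0 0⟩
  · obtain ⟨C, hC⟩ := h.exists_norm_Xminus_le hlam0 hlam1 hγ0
    exact ⟨C, fun s hs => hC s hs 0 1⟩
  · obtain ⟨ε, hε, hind⟩ := exists_indices_eq_zero (h.goodFactor_Xplus hlam0 hlam1 hγ1)
      (h.goodFactor_Xminus hlam0 hlam1 hγ0) hG
    exact ⟨ε, hε, fun G' κ' hclose hκ => ⟨1, hind G' κ' hclose hκ⟩⟩
  -- The factors are good up to any vertical line inside 0 < Re s < 1, so δ < min(γ, 1 - γ) gives
  -- the common strip around Re s = γ.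
  · obtain ⟨δ, hδ, hδγ⟩ := exists_between (lt_min hγ0 (sub_pos.2 hγ1))
    exact exists_persistent hδ
      (h.goodFactor_Xplus hlam0 hlam1 (by linarith [hδγ.trans_le (min_le_right γ (1 - γ))]))
      (h.goodFactor_Xminus hlam0 hlam1 (by linarith [hδγ.trans_le (min_le_left γ (1 - γ))])) hG
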